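/- There is a single random access program, using an algorithm $\psi$ for single-source shortest paths as a black box, and a constant $C$ such that the following holds. Let $\psi$ be any algorithm that solves the single-source shortest path problem on directed graphs with non-negative real edge lengths, and suppose that on every graph with $m$ edges and $n$ vertices $\psi$ takes time at most $T_\psi(m,n)$ and space at most $S_\psi(m,n)$. Let $G$ be a strongly connected directed graph with $n\ge 2$ vertices, $m$ edges and non-negative real edge lengths, and let $m^*$ be the number of edges of $G$ that lie on at least one shortest path. Then the program solves the all-pairs shortest path problem on $G$ (it outputs all distances and, for every source, a tree of shortest paths) in time at most $$C\Bigl(m^* n + m\lg n + n\max_{m'\le m^*+n}T_\psi(m',n+1)\Bigr)$$ and in space at most $$C\Bigl(n^2+\max_{m'\le m^*+n}S_\psi(m',n+1)\Bigr).$$ In particular, if $T_\psi(m',n+1)\le K\,T_\psi(m^*,n)$ for all $m'\le m^*+n$, then the time is at most $C\,(m^* n+m\lg n+K\,n\,T_\psi(m^*,n))$, and if $S_\psi(m',n+1)\le K\,S_\psi(m^*,n)$ for all $m'\le m^*+n$, then the space is at most $C\,(n^2+K\,S_\psi(m^*,n))$; so for bounds that grow regularly, with $K$ a constant, all-pairs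 shortest paths are computed in time $O(m^* n+m\lg n+n\,T_\psi(m^*,n))$ and space $O(n^2+S_\psi(m^*,n))$. Here the machine manipulates edge lengths only by copying, addition and comparison, integers are machine words bounded by the number of cells in each of its (constantly many) arrays, and a call of $\psi$ is charged the time of $\psi$ plus the number of vertices and edges of the graph passed to it. -/

import Mathlib

open scoped NNReal ENNReal

/-! ### Weighted directed graphs and shortest paths -/

/-- A directed graph on the vertices `0, …, n - 1` with non-negative real edge lengths, given by
the list of its edges `(u, v, ℓ(u, v))`. There is at most one edge for each ordered pair `(u, v)`. -/
structure WDigraph (n : ℕ) where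
  edges : List (Fin n × Fin n × ℝ≥0)
  simple : (edges.map fun e => (e.1, e.2.1)).Nodup

namespace WDigraph

variable {n : ℕ}

/-- The number `m` of edges. -/
def size (G : WDigraph n) : ℕ := G.edges.length

/-- The list of edges `p` is a walk of `G` from `s` to `t`. -/
def IsWalk (G : WDigraph n) (t : Fin n) : Fin n → List (Fin n × Fin n × ℝ≥0) → Prop
  | s, [] => s = t
  | s, e :: p => e ∈ G.edges ∧ e.1 = s ∧ G.IsWalk t e.2.1 p

/-- The total length of a list of edges. -/
def pathLength (p : List (Fin n × Fin n × ℝ≥0)) : ℝ≥0 := (p.map fun e => e.2.2).sum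

/-- The distance from `s` to `t`; it is `∞` if `t` cannot be reached from `s`. -/
noncomputable def dist (G : WDigraph n) (s t : Fin n) : ℝ≥0∞ :=
  ⨅ (p : List (Fin n × Fin n × ℝ≥0)) (_ : G.IsWalk t s p), (pathLength p : ℝ≥0∞)

/-- `p` is a shortest path from `s` to `t`: a walk without repeated vertices whose length
is the distance. -/
def IsShortestPath (G : WDigraph n) (s t : Fin n) (p : List (Fin n × Fin n × ℝ≥0)) : Prop :=
  G.IsWalk t s p ∧ (s :: p.map fun e => e.2.1).Nodup ∧ (pathLength p : ℝ≥0∞) = G.dist s t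

/-- The number `m*` of edges that lie on at least one shortest path. -/
noncomputable def mStar (G : WDigraph n) : ℕ :=
  {e | e ∈ G.edges ∧ ∃ s t p, G.IsShortestPath s t p ∧ e ∈ p}.ncard

/-- Every vertex can be reached from every vertex. -/
def StronglyConnected (G : WDigraph n) : Prop :=
  ∀ s t, ∃ p, G.IsWalk t s p

/-- `d` and `parent` solve the single-source shortest path problem on `G` with source `s`:
`d` holds the distances from `s`, and following `parent` from a reachable vertex `v`
traces a shortest path from `s` to `v` backwards. (The value `parent s` is irrelevant.) -/
structure SolvesSSSP (G : WDigraph n) (s : Fin n) (d : Fin n → ℝ≥0∞)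
    (parent : Fin n → Fin n) : Prop where
  dist_eq : ∀ v, d v = G.dist s v
  parent_edge : ∀ v, v ≠ s → d v ≠ ∞ →
    ∃ w : ℝ≥0, (parent v, v, w) ∈ G.edges ∧ d v = d (parent v) + w
  reaches_source : ∀ v, d v ≠ ∞ → ∃ j : ℕ, parent^[j] v = s

end WDigraph

/-- A black-box algorithm for the single-source shortest path problem on non-negatively weighted
directed graphs: its outputs (distances and parents), and the time and the space that
it takes on each input. -/
structure SSSPAlgorithm where
  dist : {n : ℕ} → WDigraph n → Fin n → Fin n → ℝ≥0∞
  parent : {n : ℕ} → WDigraph n → Fin n → Fin n → Fin n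
  time : {n : ℕ} → WDigraph n → Fin n → ℕ
  space : {n : ℕ} → WDigraph n → Fin n → ℕ
  correct : ∀ {n : ℕ} (G : WDigraph n) (s : Fin n), G.SolvesSSSP s (dist G s) (parent G s)

/-- `T m n` bounds the running time of `ψ` on graphs with `m` edges and `n` vertices. -/
def SSSPAlgorithm.TimeBound (ψ : SSSPAlgorithm) (T : ℕ → ℕ → ℕ) : Prop :=
  ∀ {n : ℕ} (G : WDigraph n) (s : Fin n), ψ.time G s ≤ T G.size n

/-- `S m n` bounds the space used by `ψ` on graphs with `m` edges and `n` vertices. -/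
def SSSPAlgorithm.SpaceBound (ψ : SSSPAlgorithm) (S : ℕ → ℕ → ℕ) : Prop :=
  ∀ {n : ℕ} (G : WDigraph n) (s : Fin n), ψ.space G s ≤ S G.size n

/-! ### The machine: a random access machine that can call a shortest path algorithm

There are `k` arrays of integers and `k` arrays of lengths, each with `M` cells, where `k` depends
only on the program. Integers are machine words: the machine gets stuck when an integer reaches
`M`, and also when a program accesses an array outside its bounds. Lengths can only be
copied, added and compared (comparison-addition model). Expressions occur in a program text, so their
sizes are bounded by a constant; evaluating one counts as part of the command that contains it. -/

namespace RAM

/-- The contents of the arrays: array name, then index. -/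
structure State where
  int : ℕ → ℕ → ℕ
  len : ℕ → ℕ → ℝ≥0∞

/-- Integer expressions. -/
inductive IExp where
  | const (c : ℕ)
  | get (a : ℕ) (i : IExp)
  | add (e f : IExp)
  | sub (e f : IExp)
  | mul (e f : IExp)

/-- Length expressions. -/
inductive LExp where
  | zero
  | infinity
  | get (a : ℕ) (i : IExp)
  | add (x y : LExp)

/-- Tests. -/
inductive Test where
  | intLT (e f : IExp)
  | intEq (e f : IExp)
  | lenLT (x y : LExp)
  | not (b : Test)
  | and (b c : Test)

/-- A word is an integer less than `M`. -/
def word (M x : ℕ) : Option ℕ := if x < M then some x else none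

/-- The value of an integer expression, if its evaluation is legal. -/
def IExp.eval (k M : ℕ) (σ : State) : IExp → Option ℕ
  | .const c => word M c
  | .get a i => (i.eval k M σ).bind fun j => if a < k ∧ j < M then word M (σ.int a j) else none
  | .add e f => (e.eval k M σ).bind fun x => (f.eval k M σ).bind fun y => word M (x + y)
  | .sub e f => (e.eval k M σ).bind fun x => (f.eval k M σ).bind fun y => word M (x - y)
  | .mul e f => (e.eval k M σ).bind fun x => (f.eval k M σ).bind fun y => word M (x * y)

/-- The value of a length expression, if its evaluation is legal. -/
noncomputable def LExp.eval (k M : ℕ) (σ : State) : LExp → Option ℝ≥0∞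
  | .zero => some 0
  | .infinity => some ∞
  | .get a i => (i.eval k M σ).bind fun j => if a < k ∧ j < M then some (σ.len a j) else none
  | .add x y => (x.eval k M σ).bind fun p => (y.eval k M σ).bind fun q => some (p + q)

open Classical in
/-- The value of a test, if its evaluation is legal. -/
noncomputable def Test.eval (k M : ℕ) (σ : State) : Test → Option Bool
  | .intLT e f => (e.eval k M σ).bind fun x => (f.eval k M σ).bind fun y => some (decide (x < y))
  | .intEq e f => (e.eval k M σ).bind fun x => (f.eval k M σ).bind fun y => some (decide (x = y))
  | .lenLT e f => (e.eval k M σ).bind fun x => (f.eval k M σ).bind fun y => some (decide (x < y))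
  | .not b => (b.eval k M σ).bind fun x => some (!x)
  | .and b c => (b.eval k M σ).bind fun x => (c.eval k M σ).bind fun y => some (x && y)

/-- Programs. `call n m s src dst wt d p` runs the shortest path algorithm on the graph with `n`
vertices and `m` edges whose edges are stored in the arrays `src`, `dst` (endpoints) and `wt`
(lengths), with source `s`; the distances are written to the array `d`, the parents to `p`. -/
inductive Cmd where
  | skip
  | setInt (a : ℕ) (i e : IExp)
  | setLen (a : ℕ) (i : IExp) (x : LExp)
  | seq (c₁ c₂ : Cmd)
  | ite (b : Test) (c₁ c₂ : Cmd)
  | while (b : Test) (c : Cmd)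
  | call (n m s : IExp) (src dst wt d p : ℕ)

namespace State

def setInt (σ : State) (a i x : ℕ) : State where
  int b j := if b = a ∧ j = i then x else σ.int b j
  len := σ.len

noncomputable def setLen (σ : State) (a i : ℕ) (x : ℝ≥0∞) : State where
  int := σ.int
  len b j := if b = a ∧ j = i then x else σ.len b j

/-- The edge list of `G` is stored in the arrays `src`, `dst` and `wt`. -/
def Stores (σ : State) (src dst wt : ℕ) {n : ℕ} (G : WDigraph n) : Prop :=
  ∀ j : Fin G.edges.length,
    σ.int src j = (G.edges.get j).1 ∧ σ.int dst j = (G.edges.get j).2.1 ∧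
      σ.len wt j = ((G.edges.get j).2.2 : ℝ≥0∞)

/-- Write distances to the first `n` cells of `d` and parents to the first `n` cells of `p`. -/
noncomputable def writeResult (σ : State) (d p : ℕ) {n : ℕ} (dist : Fin n → ℝ≥0∞)
    (parent : Fin n → Fin n) : State where
  int b j := if h : j < n then (if b = p then (parent ⟨j, h⟩ : ℕ) else σ.int b j) else σ.int b j
  len b j := if h : j < n then (if b = d then dist ⟨j, h⟩ else σ.len b j) else σ.len b j

end State

/-- `Exec ψ k M c σ σ' t s`: with `k` arrays of either kind and `M` cells in each, the program `c`
started in the state `σ` halts in the state `σ'` after time `t`, and `s` is the maximal space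
used by a call of `ψ`. A call takes the time of `ψ`, and one more unit for each edge that is
passed and each vertex for which a result is returned. -/
inductive Exec (ψ : SSSPAlgorithm) (k M : ℕ) : Cmd → State → State → ℕ → ℕ → Prop where
  | skip (σ : State) : Exec ψ k M .skip σ σ 1 0
  | setInt (σ : State) (a : ℕ) (i e : IExp) (j x : ℕ) :
      i.eval k M σ = some j → e.eval k M σ = some x → a < k →
      Exec ψ k M (.setInt a i e) σ (σ.setInt a j x) 1 0
  | setLen (σ : State) (a : ℕ) (i : IExp) (e : LExp) (j : ℕ) (x : ℝ≥0∞) :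
      i.eval k M σ = some j → e.eval k M σ = some x → a < k →
      Exec ψ k M (.setLen a i e) σ (σ.setLen a j x) 1 0
  | seq (c₁ c₂ : Cmd) (σ σ₁ σ₂ : State) (t₁ t₂ s₁ s₂ : ℕ) :
      Exec ψ k M c₁ σ σ₁ t₁ s₁ → Exec ψ k M c₂ σ₁ σ₂ t₂ s₂ →
      Exec ψ k M (.seq c₁ c₂) σ σ₂ (t₁ + t₂) (max s₁ s₂)
  | iteTrue (b : Test) (c₁ c₂ : Cmd) (σ σ' : State) (t s : ℕ) :
      b.eval k M σ = some true → Exec ψ k M c₁ σ σ' t s →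
      Exec ψ k M (.ite b c₁ c₂) σ σ' (t + 1) s
  | iteFalse (b : Test) (c₁ c₂ : Cmd) (σ σ' : State) (t s : ℕ) :
      b.eval k M σ = some false → Exec ψ k M c₂ σ σ' t s →
      Exec ψ k M (.ite b c₁ c₂) σ σ' (t + 1) s
  | whileTrue (b : Test) (c : Cmd) (σ σ₁ σ₂ : State) (t₁ t₂ s₁ s₂ : ℕ) :
      b.eval k M σ = some true → Exec ψ k M c σ σ₁ t₁ s₁ →
      Exec ψ k M (.while b c) σ₁ σ₂ t₂ s₂ →
      Exec ψ k M (.while b c) σ σ₂ (t₁ + t₂ + 1) (max s₁ s₂)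
  | whileFalse (b : Test) (c : Cmd) (σ : State) :
      b.eval k M σ = some false → Exec ψ k M (.while b c) σ σ 1 0
  | call (σ : State) (en em es : IExp) (src dst wt d p : ℕ) (n : ℕ) (G : WDigraph n) (s : Fin n) :
      en.eval k M σ = some n → em.eval k M σ = some G.size → es.eval k M σ = some (s : ℕ) →
      src < k → dst < k → wt < k → d < k → p < k → σ.Stores src dst wt G →
      Exec ψ k M (.call en em es src dst wt d p) σ
        (σ.writeResult d p (ψ.dist G s) (ψ.parent G s))
        (ψ.time G s + n + G.size + 1) (ψ.space G s)

/-- The initial state on input `G`: the integer array `0` holds `n` and `m`, the integer arrays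
`1` and `2` hold the endpoints of the edges, the length array `0` holds the lengths of the
edges, and all other cells are `0`. -/
noncomputable def initState {n : ℕ} (G : WDigraph n) : State where
  int a j := match a with
    | 0 => [n, G.size].getD j 0
    | 1 => (G.edges.map fun e => (e.1 : ℕ)).getD j 0
    | 2 => (G.edges.map fun e => (e.2.1 : ℕ)).getD j 0
    | _ => 0
  len a j := match a with
    | 0 => (G.edges.map fun e => (e.2.2 : ℝ≥0∞)).getD j 0
    | _ => 0

/-- The state holds a solution of the all-pairs shortest path problem on `G`: for every source
`u`, distances in the cells `u * n + v` of the length array `1` and parents in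
the cells `u * n + v` of the integer array `3`. -/
def HoldsAPSP {n : ℕ} (G : WDigraph n) (σ : State) : Prop :=
  ∃ parent : Fin n → Fin n → Fin n,
    (∀ u v : Fin n, σ.int 3 (u * n + v) = parent u v) ∧
    ∀ u : Fin n, G.SolvesSSSP u (fun v => σ.len 1 (u * n + v)) (parent u)

/-- The program `c` with `k` arrays of either kind, calling `ψ`, solves the all-pairs
shortest path problem on `G` in time `t` and space `s`. The space consists of all cells of all
arrays, including input and output, and of the maximal space used by a call of `ψ`. -/
def SolvesAPSP (ψ : SSSPAlgorithm) (k : ℕ) (c : Cmd) {n : ℕ} (G : WDigraph n) (t s : ℕ) : Prop :=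
  ∃ (M : ℕ) (σ' : State) (sψ : ℕ),
    4 ≤ k ∧ n < M ∧ G.size < M ∧ n * n ≤ M ∧
    Exec ψ k M c (initState G) σ' t sψ ∧ s = 2 * k * M + sψ ∧ HoldsAPSP G σ'

end RAM

/-- The maximum of `T m' n` over all `m' ≤ m`: the worst case of the bound `T` over graphs
with at most `m` edges and exactly `n` vertices. -/
def maxUpTo (T : ℕ → ℕ → ℕ) (m n : ℕ) : ℕ := (Finset.range (m + 1)).sup fun m' => T m' n

/-! The program keeps, for every vertex v, the list of its k closest vertices in the order of their
distances, and one round raises k by one for all vertices at once. Once k = n, the lists contain all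
distances and parents. Along with the lists it keeps a set E of known edges: v → u is recorded when
u enters the list of v with parent v, and then W v u = δ v u. Known edges are therefore shortest
paths themselves, so there are at most m* of them, and every list entry is reached from its owner by
a shortest walk along E.

One round rests on the following observation. Let S be the set listed for v. A path from v to a
vertex outside S leaves S along some edge y → z, and y is reached from v by a walk along E. Follow
this walk as long as the lists agree with S as sets. If an edge a → u of it leads to a vertex u
whose list is not contained in S, then the first entry t of that list outside S is at least as close
to u as z, so W a u + δ u t is a candidate for a that is good enough. Otherwise the direct edge y →
z is a candidate for y. Hence the next distance of v is the minimum, over E-walks through vertices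
with list S, of the length of the walk plus the candidate of its last vertex.

For all v simultaneously these minima are the distances from an additional vertex n in an auxiliary
graph: it has the reversals of those known edges whose endpoints have equal lists, and an edge from
n to every vertex whose candidate is finite, with the candidate as length. This graph has n + 1
vertices and at most m* + n edges, and one call of ψ handles it. The vertex after n on the tree path
to v is the root of v, and the target of the root is appended to the list of v. `Closest.le_dist` is
the lower bound, and `Closest.step` combines it with the walk that realizes the minimum; zero
lengths and ties do no harm, because parents always stand earlier in the list.

For the running time, the shortest direct edge to a new target is the winner of a tournament tree at
v. Each of the m edges is inserted at most once and deleted at most once, at cost O(lg n). The first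
new entry in the list of the head of a known edge is found with a pointer that only moves forward,
which costs O(m* n) in total. The remaining work of a round, apart from ψ, is O(m* + n). In
`round_spec` this amortization appears as two potentials, `pointerSum` and `finiteLeaves`. Terms of
order n² are absorbed by m* n, since n ≤ m* (`Knowledge.Valid.le_star`). The machine level is
handled by weakest preconditions (`Ex.of_wp`) with loop rules (`Ex.loop`, `Ex.count`). -/

namespace RAM

/-! ### Evaluation of expressions, bounded states and frames. -/

/-- All integer cells hold words. -/
def Bdd (M : ℕ) (σ : State) : Prop := ∀ a j, σ.int a j < M

/-- The value of a legal integer expression. -/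
def IExp.val (σ : State) : IExp → ℕ
  | .const c => c
  | .get a i => σ.int a (i.val σ)
  | .add e f => e.val σ + f.val σ
  | .sub e f => e.val σ - f.val σ
  | .mul e f => e.val σ * f.val σ

/-- Legality of an integer expression in a bounded state. -/
def IExp.ok (M : ℕ) (σ : State) : IExp → Prop
  | .const c => c < M
  | .get a i => i.ok M σ ∧ a < 32
  | .add e f => e.ok M σ ∧ f.ok M σ ∧ e.val σ + f.val σ < M
  | .sub e f => e.ok M σ ∧ f.ok M σ
  | .mul e f => e.ok M σ ∧ f.ok M σ ∧ e.val σ * f.val σ < M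

/-- The value of a legal length expression. -/
noncomputable def LExp.val (σ : State) : LExp → ℝ≥0∞
  | .zero => 0
  | .infinity => ∞
  | .get a i => σ.len a (i.val σ)
  | .add x y => x.val σ + y.val σ

/-- Legality of a length expression in a bounded state. -/
def LExp.ok (M : ℕ) (σ : State) : LExp → Prop
  | .zero => True
  | .infinity => True
  | .get a i => i.ok M σ ∧ a < 32
  | .add x y => x.ok M σ ∧ y.ok M σ

/-- The truth of a legal test. -/
def Test.val (σ : State) : Test → Prop
  | .intLT e f => e.val σ < f.val σ
  | .intEq e f => e.val σ = f.val σ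
  | .lenLT x y => x.val σ < y.val σ
  | .not b => ¬ b.val σ
  | .and b c => b.val σ ∧ c.val σ

/-- Legality of a test in a bounded state. -/
def Test.ok (M : ℕ) (σ : State) : Test → Prop
  | .intLT e f => e.ok M σ ∧ f.ok M σ
  | .intEq e f => e.ok M σ ∧ f.ok M σ
  | .lenLT x y => x.ok M σ ∧ y.ok M σ
  | .not b => b.ok M σ
  | .and b c => b.ok M σ ∧ c.ok M σ

/-- In a bounded state only constants, sums and products can overflow: a cell that is read holds a
word, an index is itself the value of a legal expression, and truncated subtraction does not
increase its first argument. -/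
theorem IExp.eval_of_ok {M : ℕ} {σ : State} (hσ : Bdd M σ) {e : IExp} (h : e.ok M σ) :
    e.eval 32 M σ = some (e.val σ) ∧ e.val σ < M := by
  induction e with
  | const c => exact ⟨by simpa [IExp.eval, word, IExp.val, IExp.ok] using h, h⟩
  | get a i ih =>
    obtain ⟨h1, h2⟩ := ih h.1
    exact ⟨by simp [IExp.eval, word, IExp.val, h1, h.2, h2, hσ a _], hσ _ _⟩
  | add e f ihe ihf =>
    exact ⟨by simp [IExp.eval, word, IExp.val, (ihe h.1).1, (ihf h.2.1).1, h.2.2], h.2.2⟩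
  | sub e f ihe ihf =>
    have := lt_of_le_of_lt (Nat.sub_le (e.val σ) (f.val σ)) (ihe h.1).2
    exact ⟨by simp [IExp.eval, word, IExp.val, (ihe h.1).1, (ihf h.2).1, this], this⟩
  | mul e f ihe ihf =>
    exact ⟨by simp [IExp.eval, word, IExp.val, (ihe h.1).1, (ihf h.2.1).1, h.2.2], h.2.2⟩

theorem LExp.eval_of_ok {M : ℕ} {σ : State} (hσ : Bdd M σ) {e : LExp} (h : e.ok M σ) :
    e.eval 32 M σ = some (e.val σ) := by
  induction e with
  | zero => rfl
  | infinity => rfl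
  | get a i =>
    obtain ⟨h1, h2⟩ := IExp.eval_of_ok hσ h.1
    simp [LExp.eval, LExp.val, h1, h.2, h2]
  | add e f ihe ihf => simp [LExp.eval, LExp.val, ihe h.1, ihf h.2]

theorem Test.eval_of_ok {M : ℕ} {σ : State} (hσ : Bdd M σ) {b : Test} (h : b.ok M σ) :
    ∃ r, b.eval 32 M σ = some r ∧ (r = true ↔ b.val σ) := by
  induction b with
  | intLT e f =>
    simp [Test.eval, Test.val, (IExp.eval_of_ok hσ h.1).1, (IExp.eval_of_ok hσ h.2).1]
  | intEq e f =>
    simp [Test.eval, Test.val, (IExp.eval_of_ok hσ h.1).1, (IExp.eval_of_ok hσ h.2).1]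
  | lenLT e f =>
    simp [Test.eval, Test.val, LExp.eval_of_ok hσ h.1, LExp.eval_of_ok hσ h.2]
  | not b ih =>
    obtain ⟨r, h1, h2⟩ := ih h
    exact ⟨!r, by simp [Test.eval, h1], by simp [Test.val, ← h2]⟩
  | and b c ihb ihc =>
    obtain ⟨r, h1, h2⟩ := ihb h.1
    obtain ⟨r', h1', h2'⟩ := ihc h.2
    exact ⟨r && r', by simp [Test.eval, h1, h1'], by simp [Test.val, ← h2, ← h2']⟩

theorem IExp.eval_lt {k M : ℕ} {σ : State} {e : IExp} {x : ℕ} (h : e.eval k M σ = some x) :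
    x < M := by
  cases e <;> simp [IExp.eval, word, Option.bind_eq_some_iff] at h <;> grind

@[simp] theorem State.int_setInt (σ : State) (a i x b j : ℕ) :
    (σ.setInt a i x).int b j = if b = a ∧ j = i then x else σ.int b j := rfl

@[simp] theorem State.len_setInt (σ : State) (a i x : ℕ) : (σ.setInt a i x).len = σ.len := rfl

@[simp] theorem State.int_setLen (σ : State) (a i : ℕ) (x : ℝ≥0∞) :
    (σ.setLen a i x).int = σ.int := rfl

@[simp] theorem State.len_setLen (σ : State) (a i : ℕ) (x : ℝ≥0∞) (b j : ℕ) :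
    (σ.setLen a i x).len b j = if b = a ∧ j = i then x else σ.len b j := rfl

@[simp] theorem State.int_setInt_ne (σ : State) (a i x : ℕ) {b : ℕ} (h : b ≠ a) :
    (σ.setInt a i x).int b = σ.int b := by
  funext j
  simp [h]

@[simp] theorem State.len_setLen_ne (σ : State) (a i : ℕ) (x : ℝ≥0∞) {b : ℕ} (h : b ≠ a) :
    (σ.setLen a i x).len b = σ.len b := by
  funext j
  simp [h]

/-- Assignments write words by definition. A call writes parents below the number of vertices, and
that number is a word because it was the value of an expression. -/
theorem Bdd.exec {ψ : SSSPAlgorithm} {k M : ℕ} {c : Cmd} {σ σ' : State} {t s : ℕ}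
    (h : Exec ψ k M c σ σ' t s) (hσ : Bdd M σ) : Bdd M σ' := by
  induction h with
  | skip => exact hσ
  | setInt σ a i e j x _ he _ =>
    intro b l
    simp only [State.int_setInt]
    split
    · exact IExp.eval_lt he
    · exact hσ _ _
  | setLen => exact hσ
  | seq _ _ _ _ _ _ _ _ _ _ _ ih1 ih2 => exact ih2 (ih1 hσ)
  | iteTrue _ _ _ _ _ _ _ _ _ ih => exact ih hσ
  | iteFalse _ _ _ _ _ _ _ _ _ ih => exact ih hσ
  | whileTrue _ _ _ _ _ _ _ _ _ _ _ _ ih1 ih2 => exact ih2 (ih1 hσ)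
  | whileFalse => exact hσ
  | call σ en em es src dst wt d p n G s hn =>
    have := IExp.eval_lt hn
    intro b l
    simp only [State.writeResult]
    split
    · split
      · exact lt_trans (Fin.isLt _) this
      · exact hσ _ _
    · exact hσ _ _

/-- The integer arrays that a program may modify. -/
def Cmd.modI : Cmd → List ℕ
  | .skip => []
  | .setInt a _ _ => [a]
  | .setLen _ _ _ => []
  | .seq c d => c.modI ++ d.modI
  | .ite _ c d => c.modI ++ d.modI
  | .while _ c => c.modI
  | .call _ _ _ _ _ _ _ p => [p]

/-- The length arrays that a program may modify. -/
def Cmd.modL : Cmd → List ℕ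
  | .skip => []
  | .setInt _ _ _ => []
  | .setLen a _ _ => [a]
  | .seq c d => c.modL ++ d.modL
  | .ite _ c d => c.modL ++ d.modL
  | .while _ c => c.modL
  | .call _ _ _ _ _ _ d _ => [d]

/-- The arrays that `c` does not modify agree in the two states. -/
def Frame (c : Cmd) (σ σ' : State) : Prop :=
  (∀ a, a ∉ c.modI → σ'.int a = σ.int a) ∧ ∀ a, a ∉ c.modL → σ'.len a = σ.len a

theorem Frame.rfl {c : Cmd} {σ : State} : Frame c σ σ := ⟨fun _ _ => by simp, fun _ _ => by simp⟩

theorem Frame.trans {c : Cmd} {σ σ' σ'' : State} (h : Frame c σ σ') (h' : Frame c σ' σ'') :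
    Frame c σ σ'' :=
  ⟨fun a ha => (h'.1 a ha).trans (h.1 a ha), fun a ha => (h'.2 a ha).trans (h.2 a ha)⟩

/-- This allows specifications to be silent about untouched arrays; for a concrete program, that an
array is untouched is settled by `decide`. -/
theorem Frame.exec {ψ : SSSPAlgorithm} {k M : ℕ} {c : Cmd} {σ σ' : State} {t s : ℕ}
    (h : Exec ψ k M c σ σ' t s) : Frame c σ σ' := by
  induction h with
  | skip => exact Frame.rfl
  | setInt σ a i e j x _ he _ =>
    refine ⟨fun b hb => ?_, fun _ _ => by simp⟩
    funext l
    simp [Cmd.modI] at hb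
    simp [hb]
  | setLen σ a =>
    refine ⟨fun _ _ => by simp, fun b hb => ?_⟩
    funext l
    simp [Cmd.modL] at hb
    simp [hb]
  | seq _ _ _ _ _ _ _ _ _ _ _ ih1 ih2 =>
    constructor
    · intro a ha
      simp [Cmd.modI] at ha
      rw [ih2.1 a ha.2, ih1.1 a ha.1]
    · intro a ha
      simp [Cmd.modL] at ha
      rw [ih2.2 a ha.2, ih1.2 a ha.1]
  | iteTrue _ _ _ _ _ _ _ _ _ ih =>
    constructor
    · intro a ha
      simp [Cmd.modI] at ha
      exact ih.1 a ha.1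
    · intro a ha
      simp [Cmd.modL] at ha
      exact ih.2 a ha.1
  | iteFalse _ _ _ _ _ _ _ _ _ ih =>
    constructor
    · intro a ha
      simp [Cmd.modI] at ha
      exact ih.1 a ha.2
    · intro a ha
      simp [Cmd.modL] at ha
      exact ih.2 a ha.2
  | whileTrue _ _ _ _ _ _ _ _ _ _ _ _ ih1 ih2 => exact Frame.trans ih1 ih2
  | whileFalse => exact Frame.rfl
  | call σ en em es src dst wt d p n G s hn =>
    constructor
    · intro a ha
      simp [Cmd.modI] at ha
      funext j
      simp [State.writeResult, ha]
    · intro a ha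
      simp [Cmd.modL] at ha
      funext j
      simp [State.writeResult, ha]

/-! ### Weakest preconditions and rules for loops. -/

/-- The program `c`, started in `σ`, halts with a state and a time that satisfy `Q`, and no call
in it uses more space than `B`. -/
def Ex (ψ : SSSPAlgorithm) (M B : ℕ) (c : Cmd) (σ : State) (Q : State → ℕ → Prop) : Prop :=
  ∃ τ t s, Exec ψ 32 M c σ τ t s ∧ s ≤ B ∧ Q τ t

/-- Weakest preconditions of loop-free programs. -/
def wp (ψ : SSSPAlgorithm) (M B : ℕ) : Cmd → (State → ℕ → Prop) → State → Prop
  | .skip, Q, σ => Q σ 1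
  | .setInt a i e, Q, σ =>
    i.ok M σ ∧ e.ok M σ ∧ a < 32 ∧ Q (σ.setInt a (i.val σ) (e.val σ)) 1
  | .setLen a i e, Q, σ =>
    i.ok M σ ∧ e.ok M σ ∧ a < 32 ∧ Q (σ.setLen a (i.val σ) (e.val σ)) 1
  | .seq c d, Q, σ =>
    wp ψ M B c (fun σ₁ t₁ => wp ψ M B d (fun σ₂ t₂ => Q σ₂ (t₁ + t₂)) σ₁) σ
  | .ite b c d, Q, σ =>
    b.ok M σ ∧ (b.val σ → wp ψ M B c (fun σ₁ t => Q σ₁ (t + 1)) σ) ∧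
      (¬ b.val σ → wp ψ M B d (fun σ₁ t => Q σ₁ (t + 1)) σ)
  | .while b c, Q, σ => Bdd M σ → Ex ψ M B (.while b c) σ Q
  | .call n m s src dst wt d p, Q, σ => Bdd M σ → Ex ψ M B (.call n m s src dst wt d p) σ Q

variable {ψ : SSSPAlgorithm} {M B : ℕ}

/-- Boundedness and the frame hold after every execution, so they are handed over for free whenever
a specification is used. -/
theorem Ex.mono {c : Cmd} {σ : State} {Q Q' : State → ℕ → Prop} (h : Ex ψ M B c σ Q)
    (hσ : Bdd M σ) (hQ : ∀ σ' t, Bdd M σ' → Frame c σ σ' → Q σ' t → Q' σ' t) :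
    Ex ψ M B c σ Q' := by
  obtain ⟨σ', t, s, h1, h2, h3⟩ := h
  exact ⟨σ', t, s, h1, h2, hQ _ _ (hσ.exec h1) (Frame.exec h1) h3⟩

theorem Ex.of_wp {c : Cmd} {σ : State} {Q : State → ℕ → Prop} (h : wp ψ M B c Q σ)
    (hσ : Bdd M σ) : Ex ψ M B c σ Q := by
  induction c generalizing σ Q with
  | skip => exact ⟨_, _, _, .skip σ, Nat.zero_le _, h⟩
  | setInt a i e =>
    obtain ⟨h1, h2, h3, h4⟩ := h
    exact ⟨_, _, _, .setInt σ a i e _ _ (IExp.eval_of_ok hσ h1).1 (IExp.eval_of_ok hσ h2).1 h3,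
      Nat.zero_le _, h4⟩
  | setLen a i e =>
    obtain ⟨h1, h2, h3, h4⟩ := h
    exact ⟨_, _, _, .setLen σ a i e _ _ (IExp.eval_of_ok hσ h1).1 (LExp.eval_of_ok hσ h2) h3,
      Nat.zero_le _, h4⟩
  | seq c d ihc ihd =>
    obtain ⟨σ₁, t₁, s₁, e₁, b₁, q₁⟩ := ihc h hσ
    obtain ⟨σ₂, t₂, s₂, e₂, b₂, q₂⟩ := ihd q₁ (hσ.exec e₁)
    exact ⟨_, _, _, .seq _ _ _ _ _ _ _ _ _ e₁ e₂, max_le b₁ b₂, q₂⟩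
  | ite b c d ihc ihd =>
    obtain ⟨h1, h2, h3⟩ := h
    obtain ⟨r, he, hr⟩ := Test.eval_of_ok hσ h1
    by_cases hb : b.val σ
    · obtain ⟨σ₁, t₁, s₁, e₁, b₁, q₁⟩ := ihc (h2 hb) hσ
      exact ⟨_, _, _, .iteTrue _ _ _ _ _ _ _ (by rw [he]; simpa [hb] using hr) e₁, b₁, q₁⟩
    · obtain ⟨σ₁, t₁, s₁, e₁, b₁, q₁⟩ := ihd (h3 hb) hσ
      exact ⟨_, _, _, .iteFalse _ _ _ _ _ _ _ (by rw [he]; simpa [hb] using hr) e₁, b₁, q₁⟩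
  | call => exact h hσ
  | _ b c _ => exact h hσ

/-- The rule for loops: `I j σ τ` is the invariant, where `j` decreases and `τ` is the time
since the start of the loop. -/
theorem Ex.loop {b : Test} {c : Cmd} {σ : State} {Q : State → ℕ → Prop}
    (I : ℕ → State → ℕ → Prop) (j : ℕ) (hσ : Bdd M σ) (h0 : I j σ 0)
    (hstep : ∀ j σ' τ, Bdd M σ' → Frame c σ σ' → I j σ' τ → b.ok M σ' ∧
      (b.val σ' → wp ψ M B c (fun σ'' t => ∃ j' < j, I j' σ'' (τ + t + 1)) σ') ∧
      (¬ b.val σ' → Q σ' (τ + 1))) :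
    Ex ψ M B (.while b c) σ Q := by
  -- The invariant counts time from the first iteration, while the induction builds only the rest of
  -- the execution; hence the current state and the elapsed time are generalized.
  suffices H : ∀ j σ' τ, Bdd M σ' → Frame c σ σ' → I j σ' τ →
      Ex ψ M B (.while b c) σ' (fun σ'' t => Q σ'' (τ + t)) by
    simpa using H j σ 0 hσ Frame.rfl h0
  intro j
  induction j using Nat.strong_induction_on with
  | _ j ih =>
    intro σ' τ hb hf hI
    obtain ⟨h1, h2, h3⟩ := hstep j σ' τ hb hf hI
    obtain ⟨r, he, hr⟩ := Test.eval_of_ok hb h1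
    by_cases hv : b.val σ'
    · obtain ⟨σ₁, t₁, s₁, e₁, b₁, j', hj, hI'⟩ := Ex.of_wp (h2 hv) hb
      obtain ⟨σ₂, t₂, s₂, e₂, b₂, q₂⟩ :=
        ih j' hj σ₁ _ (hb.exec e₁) (hf.trans (Frame.exec e₁)) hI'
      refine ⟨_, _, _, .whileTrue _ _ _ _ _ _ _ _ _ (by rw [he]; simpa [hv] using hr) e₁ e₂,
        max_le b₁ b₂, ?_⟩
      convert q₂ using 1
      omega
    · exact ⟨_, _, _, .whileFalse _ _ _ (by rw [he]; simpa [hv] using hr), Nat.zero_le _, h3 hv⟩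

theorem Bdd.setInt {σ : State} (hσ : Bdd M σ) (a i : ℕ) {x : ℕ} (hx : x < M) :
    Bdd M (σ.setInt a i x) := by
  intro b j
  simp only [State.int_setInt]
  split
  · exact hx
  · exact hσ b j

theorem Frame.mono {c d : Cmd} {σ σ' : State} (h : Frame c σ σ')
    (hI : ∀ a, a ∈ c.modI → a ∈ d.modI) (hL : ∀ a, a ∈ c.modL → a ∈ d.modL) : Frame d σ σ' :=
  ⟨fun a ha => h.1 a fun h' => ha (hI a h'), fun a ha => h.2 a fun h' => ha (hL a h')⟩

theorem wp.mono {c : Cmd} {σ : State} {Q Q' : State → ℕ → Prop} (h' : wp ψ M B c Q σ)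
    (hσ : Bdd M σ) (h : ∀ σ' t, Bdd M σ' → Frame c σ σ' → Q σ' t → Q' σ' t) :
    wp ψ M B c Q' σ := by
  induction c generalizing σ Q Q' with
  | skip => exact h _ _ hσ Frame.rfl h'
  | setInt a i e =>
    refine ⟨h'.1, h'.2.1, h'.2.2.1, h _ _ (hσ.setInt _ _ (IExp.eval_of_ok hσ h'.2.1).2) ?_
      h'.2.2.2⟩
    exact Frame.exec (.setInt (ψ := ψ) σ a i e _ _ (IExp.eval_of_ok hσ h'.1).1
      (IExp.eval_of_ok hσ h'.2.1).1 h'.2.2.1)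
  | setLen a i e =>
    refine ⟨h'.1, h'.2.1, h'.2.2.1, h _ _ hσ ?_ h'.2.2.2⟩
    exact Frame.exec (.setLen (ψ := ψ) σ a i e _ _ (IExp.eval_of_ok hσ h'.1).1
      (LExp.eval_of_ok hσ h'.2.1) h'.2.2.1)
  | seq c d ihc ihd =>
    refine ihc h' hσ fun σ₁ t₁ hb₁ hf₁ h₁ => ihd h₁ hb₁ fun σ₂ t₂ hb₂ hf₂ h₂ => h _ _ hb₂ ?_ h₂
    refine Frame.trans (hf₁.mono ?_ ?_) (hf₂.mono ?_ ?_) <;>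
      simp +contextual [Cmd.modI, Cmd.modL]
  | ite b c d ihc ihd =>
    refine ⟨h'.1, fun hb => ihc (h'.2.1 hb) hσ fun _ _ hb hf => h _ _ hb (hf.mono ?_ ?_),
      fun hb => ihd (h'.2.2 hb) hσ fun _ _ hb hf => h _ _ hb (hf.mono ?_ ?_)⟩ <;>
      simp +contextual [Cmd.modI, Cmd.modL]
  | call => exact fun hb => (h' hb).mono hb h
  | _ b c _ => exact fun hb => (h' hb).mono hb h

/-- The rule for counting loops. -/
theorem Ex.count {b : Test} {c : Cmd} {σ : State} {Q : State → ℕ → Prop}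
    (I : ℕ → State → ℕ → Prop) (N i : ℕ) (hσ : Bdd M σ) (hi : i ≤ N) (h0 : I i σ 0)
    (hstep : ∀ i σ' τ, Bdd M σ' → Frame c σ σ' → I i σ' τ → i ≤ N →
      b.ok M σ' ∧ (b.val σ' ↔ i < N) ∧
      (i < N → wp ψ M B c (fun σ'' t => I (i + 1) σ'' (τ + t + 1)) σ'))
    (hend : ∀ σ' τ, Bdd M σ' → Frame c σ σ' → I N σ' τ → Q σ' (τ + 1)) :
    Ex ψ M B (.while b c) σ Q := by
  -- The number of remaining iterations serves as the decreasing quantity.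
  refine Ex.loop (fun j σ' τ => ∃ i ≤ N, j = N - i ∧ I i σ' τ) (N - i) hσ ⟨i, hi, rfl, h0⟩ ?_
  rintro j σ' τ hb hf ⟨i, hi, rfl, hI⟩
  obtain ⟨h1, h2, h3⟩ := hstep i σ' τ hb hf hI hi
  refine ⟨h1, fun hv => ?_, fun hv => ?_⟩
  · have := h2.1 hv
    exact (h3 this).mono hb fun _ _ _ _ h => ⟨N - (i + 1), by omega, i + 1, by omega, rfl, h⟩
  · have : i = N := by
      rw [h2] at hv
      omega
    subst this
    exact hend _ _ hb hf hI

end RAM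

/-! ### Lists of closest vertices and the correctness of one round, without the machine. -/

/-- The properties of the distances `δ` in a digraph with edge lengths `W` on `0, …, n - 1`. -/
structure IsDistance (n : ℕ) (W δ : ℕ → ℕ → ℝ≥0∞) : Prop where
  self : ∀ v < n, δ v v = 0
  edge : ∀ u < n, ∀ v < n, δ u v ≤ W u v
  triangle : ∀ u < n, ∀ v < n, ∀ w < n, δ u w ≤ δ u v + δ v w
  ne_top : ∀ u < n, ∀ v < n, δ u v ≠ ∞
  cut : ∀ (S : ℕ → Prop) (v t : ℕ) (X : ℝ≥0∞), v < n → t < n → S v → ¬ S t →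
    (∀ y < n, ∀ z < n, S y → ¬ S z → X ≤ δ v y + W y z) → X ≤ δ v t

/-- `EdgeWalk W E u v d`: some walk from `u` to `v` along edges in `E` has length `d`. -/
inductive EdgeWalk (W : ℕ → ℕ → ℝ≥0∞) (E : ℕ → ℕ → Prop) : ℕ → ℕ → ℝ≥0∞ → Prop where
  | nil (v : ℕ) : EdgeWalk W E v v 0
  | cons (v u x : ℕ) (d : ℝ≥0∞) : E v u → EdgeWalk W E u x d → EdgeWalk W E v x (W v u + d)

namespace EdgeWalk

variable {n : ℕ} {W δ : ℕ → ℕ → ℝ≥0∞} {E E' : ℕ → ℕ → Prop} {u v w : ℕ} {d d' : ℝ≥0∞}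

theorem mono (h : EdgeWalk W E u v d) (hE : ∀ a b, E a b → E' a b) : EdgeWalk W E' u v d := by
  induction h with
  | nil v => exact .nil v
  | cons v u x d h _ ih => exact .cons _ _ _ _ (hE _ _ h) ih

theorem trans (h : EdgeWalk W E u v d) (h' : EdgeWalk W E v w d') :
    EdgeWalk W E u w (d + d') := by
  induction h with
  | nil v => simpa using h'
  | cons v u x d h _ ih =>
    rw [add_assoc]
    exact .cons _ _ _ _ h (ih h')

theorem dist_le (h : EdgeWalk W E u v d) (hδ : IsDistance n W δ)
    (hE : ∀ a b, E a b → a < n ∧ b < n) (hu : u < n) : v < n ∧ δ u v ≤ d := by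
  induction h with
  | nil v => exact ⟨hu, (hδ.self v hu).le⟩
  | cons v u x d h _ ih =>
    obtain ⟨hv, hu'⟩ := hE _ _ h
    obtain ⟨h1, h2⟩ := ih hu'
    exact ⟨h1, (hδ.triangle v hv u hu' x h1).trans
      (add_le_add (hδ.edge _ hv _ hu') h2)⟩

end EdgeWalk

/-- `x` is one of the first `k` entries of the list `L v`. -/
def Listed (k : ℕ) (L : ℕ → ℕ → ℕ) (v x : ℕ) : Prop := ∃ i < k, L v i = x

/-- For every vertex `v`, the list `L v` consists of `k` closest vertices in the order of their
distances, with distances `D v` and parents `P v`; the walks along the edges in `E` suffice to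
reach them. -/
structure Closest (n : ℕ) (W δ : ℕ → ℕ → ℝ≥0∞) (k : ℕ) (L P : ℕ → ℕ → ℕ)
    (D : ℕ → ℕ → ℝ≥0∞) (E : ℕ → ℕ → Prop) : Prop where
  lt : ∀ v < n, ∀ i < k, L v i < n
  zero : ∀ v < n, L v 0 = v
  inj : ∀ v < n, ∀ i < k, ∀ j < k, L v i = L v j → i = j
  dist : ∀ v < n, ∀ i < k, D v (L v i) = δ v (L v i)
  le : ∀ v < n, ∀ i < k, ∀ t < n, (∀ j < i, L v j ≠ t) → δ v (L v i) ≤ δ v t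
  parent : ∀ v < n, ∀ i < k, 0 < i → ∃ j < i, P v (L v i) = L v j ∧
    δ v (L v j) + W (L v j) (L v i) ≤ δ v (L v i)
  walk : ∀ v < n, ∀ i < k, EdgeWalk W E v (L v i) (δ v (L v i))
  edge : ∀ v u, E v u → v < n ∧ u < n ∧ v ≠ u ∧ Listed k L v u ∧ W v u = δ v u

/-- `t` is a new target of `v` that can be reached with length `c`, by an edge from `q`. -/
def Candidate (n : ℕ) (W δ : ℕ → ℕ → ℝ≥0∞) (k : ℕ) (L : ℕ → ℕ → ℕ) (E : ℕ → ℕ → Prop)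
    (v : ℕ) (c : ℝ≥0∞) (t q : ℕ) : Prop :=
  t < n ∧ ¬ Listed k L v t ∧ Listed k L v q ∧ δ v q + W q t ≤ c ∧
    (EdgeWalk W E v t c ∨ q = v)

namespace Closest

variable {n : ℕ} {W δ : ℕ → ℕ → ℝ≥0∞} {k : ℕ} {L P : ℕ → ℕ → ℕ} {D : ℕ → ℕ → ℝ≥0∞}
  {E : ℕ → ℕ → Prop}

theorem listed_lt (h : Closest n W δ k L P D E) {v x : ℕ} (hv : v < n) (hx : Listed k L v x) :
    x < n := by
  obtain ⟨i, hi, rfl⟩ := hx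
  exact h.lt v hv i hi

theorem listed_self (h : Closest n W δ k L P D E) (hk : 0 < k) {v : ℕ} (hv : v < n) :
    Listed k L v v := ⟨0, hk, h.zero v hv⟩

theorem card_image (h : Closest n W δ k L P D E) {v : ℕ} (hv : v < n) :
    ((Finset.range k).image (L v)).card = k := by
  rw [Finset.card_image_of_injOn, Finset.card_range]
  intro i hi j hj hij
  exact h.inj v hv i (by simpa using hi) j (by simpa using hj) hij

theorem mem_image {v x : ℕ} : x ∈ (Finset.range k).image (L v) ↔ Listed k L v x := by
  simp [Listed]

theorem exists_not_listed (h : Closest n W δ k L P D E) (hk : k < n) {v : ℕ} (hv : v < n) :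
    ∃ t < n, ¬ Listed k L v t := by
  by_contra! hc
  have : (Finset.range n) ⊆ (Finset.range k).image (L v) := by
    intro x hx
    exact mem_image.2 (hc x (by simpa using hx))
  have := Finset.card_le_card this
  rw [h.card_image hv, Finset.card_range] at this
  omega

/-- All lists have exactly k distinct entries, so an inclusion between two of them is an equality.
This is why a pointer that has run to the end certifies equal lists. -/
theorem listed_iff_of_subset (h : Closest n W δ k L P D E) {u v : ℕ} (hu : u < n) (hv : v < n)
    (hs : ∀ i < k, Listed k L v (L u i)) (x : ℕ) : Listed k L u x ↔ Listed k L v x := by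
  have hsub : (Finset.range k).image (L u) ⊆ (Finset.range k).image (L v) := by
    intro x hx
    obtain ⟨i, hi, rfl⟩ := mem_image.1 hx
    exact mem_image.2 (hs i hi)
  have := Finset.eq_of_subset_of_card_le hsub (by rw [h.card_image hu, h.card_image hv])
  rw [← mem_image, ← mem_image, this]

/-- The parent of the first new entry precedes that entry in the list of u, hence it is old for v;
so the parent known to u can be used by v as well. The position j is positive because the list of u
starts with u, which is listed for v. -/
theorem candidate_of_edge (h : Closest n W δ k L P D E) (hδ : IsDistance n W δ) {v u j : ℕ}
    (hvu : E v u) (hj : j < k) (hnew : ¬ Listed k L v (L u j))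
    (hold : ∀ i < j, Listed k L v (L u i)) :
    Candidate n W δ k L E v (W v u + δ u (L u j)) (L u j) (P u (L u j)) := by
  obtain ⟨hv, hu, _, hl, hw⟩ := h.edge v u hvu
  have hj0 : 0 < j := by
    rcases Nat.eq_zero_or_pos j with rfl | h0
    · rw [h.zero u hu] at hnew
      exact absurd hl hnew
    · exact h0
  obtain ⟨i, hi, hP, hle⟩ := h.parent u hu j hj hj0
  have hq := h.lt u hu i (hi.trans hj)
  refine ⟨h.lt u hu j hj, hnew, hP ▸ hold i hi, ?_, .inl (.cons _ _ _ _ hvu (h.walk u hu j hj))⟩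
  rw [hP]
  calc δ v (L u i) + W (L u i) (L u j)
      ≤ (W v u + δ u (L u i)) + W (L u i) (L u j) := by
        gcongr
        exact (hδ.triangle v hv u hu _ hq).trans (by rw [hw])
    _ ≤ W v u + δ u (L u j) := by
        rw [add_assoc]
        gcongr

/-- By the cut property it suffices to bound `hd v` by the length of an E-walk from v to a listed y
followed by an edge to an unlisted z. Induct along the walk. While the lists agree, z stays unlisted
and one edge is peeled off. At the first edge v → u with a new entry `L u j`, all earlier entries
are old for v, so z is not among them, and therefore `L u j` is at least as close to u as z. -/
theorem le_dist (h : Closest n W δ k L P D E) (hδ : IsDistance n W δ) (hk : 0 < k)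
    {cand hd : ℕ → ℝ≥0∞}
    (hdirect : ∀ v < n, ∀ z < n, ¬ Listed k L v z → cand v ≤ W v z)
    (hedge : ∀ v u, E v u → ((∀ i < k, Listed k L v (L u i)) ∧ hd v ≤ W v u + hd u) ∨
      ∃ j < k, (∀ i < j, Listed k L v (L u i)) ∧ cand v ≤ W v u + δ u (L u j))
    (hcand : ∀ v < n, hd v ≤ cand v) {v t : ℕ} (hv : v < n) (ht : t < n)
    (hvt : ¬ Listed k L v t) : hd v ≤ δ v t := by
  have key : ∀ v x d, EdgeWalk W E v x d → v < n → ∀ z < n, ¬ Listed k L v z →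
      hd v ≤ d + W x z := by
    intro v x d hw
    induction hw with
    | nil v =>
      intro hv z hz hvz
      rw [zero_add]
      exact (hcand v hv).trans (hdirect v hv z hz hvz)
    | cons v u x d hvu hw ih =>
      intro hv z hz hvz
      obtain ⟨_, hu, _, _, _⟩ := h.edge v u hvu
      have hx := hw.dist_le hδ (fun a b hab => ⟨(h.edge a b hab).1, (h.edge a b hab).2.1⟩) hu
      rw [add_assoc]
      rcases hedge v u hvu with ⟨hs, hle⟩ | ⟨j, hj, hs, hle⟩
      · have hz' : ¬ Listed k L u z := by
          rintro ⟨i, hi, rfl⟩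
          exact hvz (hs i hi)
        exact hle.trans (by gcongr; exact ih hu z hz hz')
      · refine (hcand v hv).trans (hle.trans ?_)
        gcongr
        refine (h.le u hu j hj z hz fun i hi hiz => hvz (hiz ▸ hs i hi)).trans ?_
        refine (hδ.triangle u hu x hx.1 z hz).trans ?_
        gcongr
        · exact hx.2
        · exact hδ.edge x hx.1 z hz
  refine hδ.cut (Listed k L v) v t _ hv ht (h.listed_self hk hv) hvt ?_
  rintro y hy z hz ⟨i, hi, rfl⟩ hvz
  exact key v _ _ (h.walk v hv i hi) hv z hz hvz

/-- Every vertex `v` gets the target of its root `rt v` as its next closest vertex. -/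
theorem step (h : Closest n W δ k L P D E) (hδ : IsDistance n W δ) (hk : 0 < k) (hkn : k < n)
    {cand hd : ℕ → ℝ≥0∞} {ct cq rt : ℕ → ℕ}
    (hlow : ∀ v < n, ∀ t < n, ¬ Listed k L v t → hd v ≤ δ v t)
    (hroot : ∀ v < n, rt v < n ∧ rt (rt v) = rt v ∧
      (∀ x, Listed k L (rt v) x ↔ Listed k L v x) ∧
      ∃ d, EdgeWalk W E v (rt v) d ∧ hd v = d + cand (rt v))
    (hc : ∀ v < n, cand v ≠ ∞ → Candidate n W δ k L E v (cand v) (ct v) (cq v))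
    {L' P' : ℕ → ℕ → ℕ} {D' : ℕ → ℕ → ℝ≥0∞} {E' : ℕ → ℕ → Prop}
    (hL : ∀ v < n, ∀ i < k, L' v i = L v i) (hLk : ∀ v < n, L' v k = ct (rt v))
    (hP : ∀ v < n, ∀ x < n, x ≠ ct (rt v) → P' v x = P v x)
    (hPt : ∀ v < n, P' v (ct (rt v)) = cq (rt v))
    (hD : ∀ v < n, ∀ x < n, x ≠ ct (rt v) → D' v x = D v x)
    (hDt : ∀ v < n, D' v (ct (rt v)) = hd v)
    (hE : ∀ v u, E' v u ↔ E v u ∨ (v < n ∧ u = ct (rt v) ∧ cq (rt v) = v)) :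
    Closest n W δ (k + 1) L' P' D' E' := by
  have hEE : ∀ a b, E a b → E' a b := fun a b hab => (hE a b).2 (.inl hab)
  have hElt : ∀ a b, E a b → a < n ∧ b < n :=
    fun a b hab => ⟨(h.edge a b hab).1, (h.edge a b hab).2.1⟩
  have key : ∀ v < n, ct (rt v) < n ∧ ¬ Listed k L v (ct (rt v)) ∧ Listed k L v (cq (rt v)) ∧
      hd v = δ v (ct (rt v)) ∧
      δ v (cq (rt v)) + W (cq (rt v)) (ct (rt v)) ≤ δ v (ct (rt v)) ∧
      EdgeWalk W E' v (ct (rt v)) (δ v (ct (rt v))) := by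
    intro v hv
    obtain ⟨hr, hrr, hS, d, hw, hhd⟩ := hroot v hv
    -- As k < n, some vertex is unlisted; its distance is finite and bounds `hd v` from above.
    have hfin : cand (rt v) ≠ ∞ := by
      obtain ⟨x, hx, hvx⟩ := h.exists_not_listed hkn hv
      intro hh
      have := (hlow v hv x hx hvx).trans_lt (hδ.ne_top v hv x hx).lt_top
      rw [hhd, hh] at this
      simp at this
    obtain ⟨ht, hnt, hq, hle, hor⟩ := hc _ hr hfin
    have hqn := h.listed_lt hr hq
    have hd' := hw.dist_le hδ hElt hv
    rw [hS] at hnt hq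
    have h1 := hlow v hv _ ht hnt
    -- The candidate was computed at the root; prefixing the walk from v to the root transfers its
    -- bound to v.
    have h2 : δ v (cq (rt v)) + W (cq (rt v)) (ct (rt v)) ≤ hd v := by
      rw [hhd]
      refine le_trans ?_ (add_le_add hd'.2 hle)
      rw [← add_assoc]
      gcongr
      exact hδ.triangle v hv _ hr _ hqn
    have h3 : δ v (ct (rt v)) ≤ δ v (cq (rt v)) + W (cq (rt v)) (ct (rt v)) :=
      (hδ.triangle v hv _ hqn _ ht).trans (by gcongr; exact hδ.edge _ hqn _ ht)
    have h4 : hd v = δ v (ct (rt v)) := le_antisymm h1 (h3.trans h2)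
    refine ⟨ht, hnt, hq, h4, h4 ▸ h2, ?_⟩
    -- Either the candidate comes with a walk along old known edges, or it is a direct edge out of
    -- the root. In the second case the root, being its own root, records this very edge in the same
    -- round, so the walk exists in `E'`.
    rcases hor with hor | hor
    · rw [← h4, hhd]
      exact (hw.trans hor).mono hEE
    · have hE1 : E' (rt v) (ct (rt v)) := (hE _ _).2 (.inr ⟨hr, by rw [hrr], by rw [hrr, hor]⟩)
      have hw' : EdgeWalk W E' v (ct (rt v)) (d + (W (rt v) (ct (rt v)) + 0)) :=
        (hw.mono hEE).trans (.cons _ _ _ _ hE1 (.nil _))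
      have h5 : d + (W (rt v) (ct (rt v)) + 0) = δ v (ct (rt v)) := by
        rw [add_zero]
        refine le_antisymm ?_ ?_
        · rw [← h4, hhd]
          gcongr
          rw [hor, hδ.self _ hr, zero_add] at hle
          exact hle
        · exact (hδ.triangle v hv _ hr _ ht).trans
            (add_le_add hd'.2 (hδ.edge _ hr _ ht))
      rwa [h5] at hw'
  have hne : ∀ v < n, ∀ i < k, L v i ≠ ct (rt v) :=
    fun v hv i hi hh => (key v hv).2.1 ⟨i, hi, hh⟩
  refine ⟨?_, ?_, ?_, ?_, ?_, ?_, ?_, ?_⟩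
  · intro v hv i hi
    rcases Nat.lt_succ_iff_lt_or_eq.1 hi with hi | rfl
    · rw [hL v hv i hi]
      exact h.lt v hv i hi
    · rw [hLk v hv]
      exact (key v hv).1
  · intro v hv
    rw [hL v hv 0 hk, h.zero v hv]
  · intro v hv i hi j hj hij
    rcases Nat.lt_succ_iff_lt_or_eq.1 hi with hi | rfl
    · rcases Nat.lt_succ_iff_lt_or_eq.1 hj with hj | rfl
      · rw [hL v hv i hi, hL v hv j hj] at hij
        exact h.inj v hv i hi j hj hij
      · rw [hL v hv i hi, hLk v hv] at hij
        exact absurd hij (hne v hv i hi)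
    · rcases Nat.lt_succ_iff_lt_or_eq.1 hj with hj | rfl
      · rw [hL v hv j hj, hLk v hv] at hij
        exact absurd hij.symm (hne v hv j hj)
      · rfl
  · intro v hv i hi
    rcases Nat.lt_succ_iff_lt_or_eq.1 hi with hi | rfl
    · rw [hL v hv i hi, hD v hv _ (h.lt v hv i hi) (hne v hv i hi), h.dist v hv i hi]
    · rw [hLk v hv, hDt v hv, (key v hv).2.2.2.1]
  · intro v hv i hi t ht hj
    rcases Nat.lt_succ_iff_lt_or_eq.1 hi with hi | rfl
    · rw [hL v hv i hi]
      exact h.le v hv i hi t ht fun j hji => hL v hv j (hji.trans hi) ▸ hj j hji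
    · rw [hLk v hv, ← (key v hv).2.2.2.1]
      refine hlow v hv t ht ?_
      rintro ⟨j, hji, rfl⟩
      exact hj j hji (hL v hv j hji)
  · intro v hv i hi hi0
    rcases Nat.lt_succ_iff_lt_or_eq.1 hi with hi | rfl
    · obtain ⟨j, hj, h1, h2⟩ := h.parent v hv i hi hi0
      refine ⟨j, hj, ?_⟩
      rw [hL v hv i hi, hL v hv j (hj.trans hi), hP v hv _ (h.lt v hv i hi) (hne v hv i hi)]
      exact ⟨h1, h2⟩
    · obtain ⟨_, _, ⟨j, hj, hq⟩, _, hle, _⟩ := key v hv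
      refine ⟨j, hj, ?_⟩
      rw [hLk v hv, hPt v hv, hL v hv j hj, hq]
      exact ⟨rfl, hle⟩
  · intro v hv i hi
    rcases Nat.lt_succ_iff_lt_or_eq.1 hi with hi | rfl
    · rw [hL v hv i hi]
      exact (h.walk v hv i hi).mono hEE
    · rw [hLk v hv]
      exact (key v hv).2.2.2.2.2
  · intro v u hvu
    rcases (hE v u).1 hvu with hvu | ⟨hv, rfl, hq⟩
    · obtain ⟨hv, hu, hne, ⟨i, hi, hl⟩, hw⟩ := h.edge v u hvu
      exact ⟨hv, hu, hne, ⟨i, hi.trans (Nat.lt_succ_self k), by rw [hL v hv i hi, hl]⟩, hw⟩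
    · obtain ⟨ht, hnt, _, _, hle, _⟩ := key v hv
      refine ⟨hv, ht, ?_, ⟨k, Nat.lt_succ_self k, hLk v hv⟩, ?_⟩
      · intro hh
        exact hnt (hh ▸ h.listed_self hk hv)
      · rw [hq, hδ.self v hv, zero_add] at hle
        exact le_antisymm hle (hδ.edge v hv _ ht)

end Closest

/-! ### Tournament trees and their repair. -/

namespace RAM

attribute [simp] wp IExp.ok IExp.val LExp.ok LExp.val Test.ok Test.val

variable {ψ : SSSPAlgorithm} {M B : ℕ}

/-- The scalar variable stored in the integer array `a`. -/
@[simp] def var (a : ℕ) : IExp := .get a (.const 0)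

/-- The number of vertices. -/
@[simp] def vertices : IExp := .get 0 (.const 0)

/-- The node `j` of a tournament tree holds a smallest of the keys of its children `2 j` and
`2 j + 1`, and the corresponding index. -/
def TreeNode (K : ℕ → ℝ≥0∞) (I : ℕ → ℕ) (j : ℕ) : Prop :=
  K j ≤ K (j + j) ∧ K j ≤ K (j + j + 1) ∧
    ((K j = K (j + j) ∧ I j = I (j + j)) ∨ (K j = K (j + j + 1) ∧ I j = I (j + j + 1)) ∨ K j = ∞)

/-- A tournament tree with the leaves `n, …, 2 n - 1` and the root `1`. -/
def IsTree (n : ℕ) (K : ℕ → ℝ≥0∞) (I : ℕ → ℕ) : Prop :=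
  (∀ j, 0 < j → j < n → TreeNode K I j) ∧ ∀ w < n, K (n + w) ≠ ∞ → I (n + w) = w

/-- Keys do not increase on the way from a node j to its parent j / 2. Nothing requires n to be a
power of two. -/
theorem IsTree.root_le {n : ℕ} {K : ℕ → ℝ≥0∞} {I : ℕ → ℕ} (h : IsTree n K I) (hn : 0 < n)
    {w : ℕ} (hw : w < n) : K 1 ≤ K (n + w) := by
  have : ∀ j, 0 < j → j < n + n → K 1 ≤ K j := by
    intro j
    induction j using Nat.strong_induction_on with
    | _ j ih =>
      intro h0 hj
      rcases Nat.lt_or_ge 1 j with h1 | h1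
      · have h2 := ih (j / 2) (by omega) (by omega) (by omega)
        have h3 := h.1 (j / 2) (by omega) (by omega)
        rcases Nat.mod_two_eq_zero_or_one j with h4 | h4
        · have : j / 2 + j / 2 = j := by omega
          exact h2.trans (by simpa only [this] using h3.1)
        · have : j / 2 + j / 2 + 1 = j := by omega
          exact h2.trans (by simpa only [this] using h3.2.1)
      · rw [show j = 1 by omega]
  exact this _ (by omega) (by omega)

/-- Descend from the root to the child that supplied key and index until a leaf is reached. Nodes
with key ∞ may carry any index, so the key must be finite. -/
theorem IsTree.root_eq {n : ℕ} {K : ℕ → ℝ≥0∞} {I : ℕ → ℕ} (h : IsTree n K I) (hn : 0 < n)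
    (h1 : K 1 ≠ ∞) : I 1 < n ∧ K (n + I 1) = K 1 := by
  have : ∀ i j, 0 < j → j + i = n + n → 0 < i → K j ≠ ∞ → I j < n ∧ K (n + I j) = K j := by
    intro i
    induction i using Nat.strong_induction_on with
    | _ i ih =>
      intro j h0 hj hi hK
      rcases Nat.lt_or_ge j n with hjn | hjn
      · rcases (h.1 j h0 hjn).2.2 with ⟨h2, h3⟩ | ⟨h2, h3⟩ | h2
        · rw [h2, h3]
          exact ih (i - j) (by omega) _ (by omega) (by omega) (by omega) (h2 ▸ hK)
        · rw [h2, h3]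
          exact ih (i - j - 1) (by omega) _ (by omega) (by omega) (by omega) (h2 ▸ hK)
        · exact absurd h2 hK
      · obtain ⟨w, rfl⟩ := Nat.exists_eq_add_of_le hjn
        have := h.2 w (by omega) hK
        rw [this]
        exact ⟨by omega, rfl⟩
  exact this (n + n - 1) 1 (by omega) (by omega) (by omega) h1

/-- Restore the tournament tree with base `int 27` from the node `int 28` upwards. -/
def repair : Cmd :=
  .while (.intLT (.const 0) (var 28))
    (.seq
      (.ite (.lenLT (.get 2 (.add (var 27) (.add (.add (var 28) (var 28)) (.const 1))))
          (.get 2 (.add (var 27) (.add (var 28) (var 28)))))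
        (.seq
          (.setInt 7 (.add (var 27) (var 28))
            (.get 7 (.add (var 27) (.add (.add (var 28) (var 28)) (.const 1)))))
          (.setLen 2 (.add (var 27) (var 28))
            (.get 2 (.add (var 27) (.add (.add (var 28) (var 28)) (.const 1))))))
        (.seq
          (.setInt 7 (.add (var 27) (var 28))
            (.get 7 (.add (var 27) (.add (var 28) (var 28)))))
          (.setLen 2 (.add (var 27) (var 28))
            (.get 2 (.add (var 27) (.add (var 28) (var 28)))))))
      (.setInt 28 (.const 0) (.get 8 (var 28))))

/-- Only the ancestors of the current node, itself included, may violate the tree condition. Each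
iteration repairs one of them at cost 5 and halves the node number, so Λ iterations suffice. Halves
are looked up in array 8, as the machine cannot divide. -/
theorem repair_spec {σ : State} {n b Λ : ℕ} (hσ : Bdd M σ) (hM : b + (n + n) ≤ M) (h2 : 2 ≤ n)
    (hhalf : ∀ j < n, σ.int 8 j = j / 2) (hb : σ.int 27 0 = b) (hj : σ.int 28 0 < n)
    (hΛ : n ≤ 2 ^ Λ)
    (ht : ∀ a, 0 < a → a < n → (¬ ∃ i, a = σ.int 28 0 / 2 ^ i) →
      TreeNode (fun i => σ.len 2 (b + i)) (fun i => σ.int 7 (b + i)) a) :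
    Ex ψ M B repair σ fun σ' t => t ≤ 5 * Λ + 1 ∧
      (∀ a, 0 < a → a < n →
        TreeNode (fun i => σ'.len 2 (b + i)) (fun i => σ'.int 7 (b + i)) a) ∧
      ∀ i, (i ≤ b ∨ b + n ≤ i) → σ'.len 2 i = σ.len 2 i ∧ σ'.int 7 i = σ.int 7 i := by
  refine Ex.loop (fun s σ' τ => σ'.int 28 0 < 2 ^ s ∧ σ'.int 28 0 < n ∧ τ + 5 * s ≤ 5 * Λ ∧
      (∀ a, 0 < a → a < n → (¬ ∃ i, a = σ'.int 28 0 / 2 ^ i) →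
        TreeNode (fun i => σ'.len 2 (b + i)) (fun i => σ'.int 7 (b + i)) a) ∧
      ∀ i, (i ≤ b ∨ b + n ≤ i) → σ'.len 2 i = σ.len 2 i ∧ σ'.int 7 i = σ.int 7 i)
    Λ hσ ⟨hj.trans_le hΛ, hj, by omega, ht, fun _ _ => ⟨rfl, rfl⟩⟩ ?_
  rintro s σ' τ hb' hf ⟨h1, hjn, hτ, hT, hU⟩
  have e8 : σ'.int 8 = σ.int 8 := hf.1 8 (by decide)
  have e27 : σ'.int 27 = σ.int 27 := hf.1 27 (by decide)
  set j := σ'.int 28 0 with hjdef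
  have hM0 : 0 < M := by omega
  refine ⟨by simp [hM0], fun hv => ?_, fun hv => ?_⟩
  · have hj0 : 0 < j := by simpa using hv
    have hs : 0 < s := by
      rcases Nat.eq_zero_or_pos s with rfl | h
      · simp at h1
        omega
      · exact h
    have hhj : σ.int 8 j = j / 2 := hhalf j hjn
    have hlt : j / 2 < 2 ^ (s - 1) := by
      obtain ⟨s, rfl⟩ := Nat.exists_eq_succ_of_ne_zero hs.ne'
      rw [pow_succ] at h1
      simp
      omega
    -- Writing to node j affects the conditions at j and at j / 2 only. Copying the smaller child
    -- restores the first; the second belongs to the nodes that are still exempt.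
    have main : ∀ c, (c = j + j ∨ c = j + j + 1) → σ'.len 2 (b + c) ≤ σ'.len 2 (b + (j + j)) →
        σ'.len 2 (b + c) ≤ σ'.len 2 (b + (j + j + 1)) →
        ∀ a, 0 < a → a < n → (¬ ∃ i, a = (j / 2) / 2 ^ i) →
        TreeNode (fun i => if i = j then σ'.len 2 (b + c) else σ'.len 2 (b + i))
          (fun i => if i = j then σ'.int 7 (b + c) else σ'.int 7 (b + i)) a := by
      intro c hc hc1 hc2 a ha0 han ha
      have hdiv : ∀ i, j / 2 / 2 ^ i = j / 2 ^ (i + 1) := fun i => by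
        rw [Nat.div_div_eq_div_mul, pow_succ, mul_comm]
      have ha1 : a ≠ j / 2 := fun h => ha ⟨0, by simpa using h⟩
      have n1 : a + a ≠ j := by omega
      have n2 : a + a + 1 ≠ j := by omega
      by_cases haj : a = j
      · subst haj
        have m1 : j + j ≠ j := by omega
        have m2 : j + j + 1 ≠ j := by omega
        simp only [TreeNode, m1, m2, if_true, if_false]
        refine ⟨hc1, hc2, ?_⟩
        rcases hc with rfl | rfl
        · exact .inl ⟨rfl, rfl⟩
        · exact .inr (.inl ⟨rfl, rfl⟩)
      · have := hT a ha0 han (by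
          rintro ⟨i, hi⟩
          rcases i with _ | i
          · simp at hi
            exact haj hi
          · exact ha ⟨i, by rw [hdiv]; exact hi⟩)
        simpa only [TreeNode, haj, n1, n2, if_false] using this
    have m1 : 1 < M := by omega
    have m2 : j + j < M := by omega
    have m3 : j + j + 1 < M := by omega
    have m4 : b + j < M := by omega
    have m5 : b + (j + j) < M := by omega
    have m6 : b + (j + j + 1) < M := by omega
    simp [← hjdef, e8, e27, hb, hhj, -not_exists, hM0, m1, m2, m3, m4, m5, m6]
    refine ⟨fun hlt' => ?_, fun hge => ?_⟩
    · refine ⟨s - 1, by omega, hlt, by omega, by omega, ?_, ?_⟩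
      · exact main (j + j + 1) (.inr rfl) hlt'.le le_rfl
      · intro i hi
        have : i ≠ b + j := by omega
        simpa [this] using hU i hi
    · refine ⟨s - 1, by omega, hlt, by omega, by omega, ?_, ?_⟩
      · exact main (j + j) (.inl rfl) le_rfl hge
      · intro i hi
        have : i ≠ b + j := by omega
        simpa [this] using hU i hi
  · have hj0 : j = 0 := by simpa using hv
    refine ⟨by omega, fun a ha0 han => hT a ha0 han ?_, hU⟩
    rintro ⟨i, hi⟩
    rw [hj0, Nat.zero_div] at hi
    omega

end RAM

namespace RAM

variable {ψ : SSSPAlgorithm} {M B : ℕ}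

theorem index_lt {n a v i : ℕ} (hv : v < n) (hi : i < a) : v * a + i < n * a := by
  calc v * a + i < v * a + a := by omega
    _ = (v + 1) * a := by ring
    _ ≤ n * a := Nat.mul_le_mul_right _ hv

theorem index_inj {a v i v' i' : ℕ} (hi : i < a) (hi' : i' < a)
    (h : v * a + i = v' * a + i') : v = v' ∧ i = i' := by
  have : v = v' := by
    rcases lt_trichotomy v v' with hv | hv | hv
    · have := index_lt (i := i) hv hi
      omega
    · exact hv
    · have := index_lt (i := i') hv hi'
      omega
  subst this
  exact ⟨rfl, by omega⟩

/-- The key of the leaf `w` in the tree of `v`. -/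
noncomputable def leaf (n : ℕ) (σ : State) (v w : ℕ) : ℝ≥0∞ := σ.len 2 (v * (n + n) + (n + w))

/-- The tournament tree of `v`. -/
def RowTree (n : ℕ) (σ : State) (v : ℕ) : Prop :=
  IsTree n (fun i => σ.len 2 (v * (n + n) + i)) (fun i => σ.int 7 (v * (n + n) + i))

/-- Set the key of the leaf `int 29` in the tree of `int 21` to `x`. -/
def updateLeaf (x : LExp) : Cmd :=
  .seq (.setInt 27 (.const 0) (.mul (var 21) (.add vertices vertices)))
    (.seq (.setLen 2 (.add (var 27) (.add vertices (var 29))) x)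
      (.seq (.setInt 7 (.add (var 27) (.add vertices (var 29))) (var 29))
        (.seq (.setInt 28 (.const 0) (.get 8 (.add vertices (var 29)))) repair)))

/-- The quantifier over y in `hx` is there because cell 0 of array 27 is overwritten by the base of
the tree before x is evaluated. Trees of different vertices occupy disjoint rows of length 2n, so
only one tree is touched. -/
theorem updateLeaf_spec {σ : State} {n Λ v t : ℕ} {x : LExp} {X : ℝ≥0∞}
    (hM : n * (n + n) ≤ M) (h2 : 2 ≤ n) (hΛ : n ≤ 2 ^ Λ) (hn : σ.int 0 0 = n)
    (hhalf : ∀ j < n + n, σ.int 8 j = j / 2) (hv : σ.int 21 0 = v) (ht : σ.int 29 0 = t)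
    (hvn : v < n) (htn : t < n)
    (hx : ∀ y, x.ok M (σ.setInt 27 0 y) ∧ x.val (σ.setInt 27 0 y) = X)
    (htree : ∀ v < n, RowTree n σ v) :
    wp ψ M B (updateLeaf x) (fun σ' τ => τ ≤ 5 * Λ + 5 ∧
      (∀ v < n, RowTree n σ' v) ∧
      ∀ u < n, ∀ w < n, leaf n σ' u w = if u = v ∧ w = t then X else leaf n σ u w) σ := by
  have hb : v * (n + n) + (n + n) ≤ n * (n + n) := by
    calc v * (n + n) + (n + n) = (v + 1) * (n + n) := by ring
      _ ≤ n * (n + n) := Nat.mul_le_mul_right _ hvn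
  have m0 : 0 < M := by omega
  have m1 : n + n < M := by
    have : 2 * (n + n) ≤ n * (n + n) := Nat.mul_le_mul_right _ h2
    omega
  have m2 : v * (n + n) < M := by omega
  have m3 : n + t < M := by omega
  have m4 : v * (n + n) + (n + t) < M := by omega
  simp [updateLeaf, hn, hv, ht, m0, m1, m2, m3, m4, hx, hhalf (n + t) (by omega)]
  set b := v * (n + n) with hbdef
  set σ₁ := (((σ.setInt 27 0 b).setLen 2 (b + (n + t)) X).setInt 7 (b + (n + t)) t).setInt 28 0
    ((n + t) / 2) with hσ₁
  have hlen : ∀ i, σ₁.len 2 i = if i = b + (n + t) then X else σ.len 2 i := by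
    intro i
    simp [hσ₁]
  have hint : ∀ i, σ₁.int 7 i = if i = b + (n + t) then t else σ.int 7 i := by
    intro i
    simp [hσ₁]
  have h8 : σ₁.int 8 = σ.int 8 := by
    funext i
    simp [hσ₁]
  have h28 : σ₁.int 28 0 = (n + t) / 2 := by simp [hσ₁]
  intro hb₁
  refine (repair_spec (n := n) (b := b) (Λ := Λ) hb₁ (by omega) h2 ?_ ?_ ?_ hΛ ?_).mono hb₁ ?_
  · intro j hj
    rw [h8, hhalf j (by omega)]
  · simp [hσ₁]
  · omega
  · intro a ha0 han ha
    rw [h28] at ha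
    -- The changed leaf is a child of (n + t) / 2 only, which is where the repair starts.
    have h1 : a ≠ (n + t) / 2 := fun h => ha ⟨0, by simpa using h⟩
    have h2 : a ≠ n + t := by omega
    have h3 : a + a ≠ n + t := by omega
    have h4 : a + a + 1 ≠ n + t := by omega
    have := (htree v hvn).1 a ha0 han
    simpa only [TreeNode, hlen, hint, Nat.add_left_cancel_iff, h2, h3, h4, if_false] using this
  · rintro σ' τ hb' hf ⟨hτ, hT, hU⟩
    have hother : ∀ u < n, u ≠ v → ∀ i < n + n, σ'.len 2 (u * (n + n) + i) =
        σ.len 2 (u * (n + n) + i) ∧ σ'.int 7 (u * (n + n) + i) = σ.int 7 (u * (n + n) + i) := by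
      intro u hu huv i hi
      have hne : u * (n + n) + i ≠ b + (n + t) :=
        fun h => huv (index_inj hi (by omega) h).1
      have := hU (u * (n + n) + i) (by
        rcases lt_or_gt_of_ne huv with h | h
        · have := index_lt (i := i) h hi
          omega
        · have := index_lt (i := n) (a := n + n) h (by omega)
          omega)
      rw [this.1, this.2, hlen, hint, if_neg hne, if_neg hne]
      exact ⟨rfl, rfl⟩
    have hleaf : ∀ w < n, σ'.len 2 (b + (n + w)) = (if w = t then X else σ.len 2 (b + (n + w))) ∧
        σ'.int 7 (b + (n + w)) = if w = t then t else σ.int 7 (b + (n + w)) := by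
      intro w hw
      have := hU (b + (n + w)) (by omega)
      rw [this.1, this.2, hlen, hint]
      simp
    refine ⟨by omega, ?_, ?_⟩
    · intro u hu
      by_cases huv : u = v
      · subst huv
        refine ⟨hT, fun w hw hne => ?_⟩
        have h1 := hleaf w hw
        simp only at hne ⊢
        rw [← hbdef] at hne ⊢
        rw [h1.2]
        rw [h1.1] at hne
        split
        · omega
        · next h =>
          rw [if_neg h] at hne
          exact (htree u hvn).2 w hw hne
      · obtain ⟨g1, g2⟩ := htree u hu
        refine ⟨fun j h0 hj => ?_, fun w hw => ?_⟩
        · have := g1 j h0 hj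
          simpa only [TreeNode, hother u hu huv j (by omega), hother u hu huv (j + j) (by omega),
            hother u hu huv (j + j + 1) (by omega)] using this
        · have := g2 w hw
          simpa only [hother u hu huv (n + w) (by omega)] using this
    · intro u hu w hw
      by_cases huv : u = v
      · subst huv
        simpa [leaf] using (hleaf w hw).1
      · simpa [leaf, huv] using (hother u hu huv (n + w) (by omega)).1

end RAM

/-! ### Initialization of the tables, lists and trees. -/

namespace RAM

variable {ψ : SSSPAlgorithm} {M B : ℕ}

/-- Tabulate halves, and let the list of `v` consist of `v`. -/
def initLists : Cmd :=
  .while (.intLT (var 21) vertices)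
    (.seq (.setInt 8 (.add (var 21) (var 21)) (var 21))
      (.seq (.setInt 8 (.add (.add (var 21) (var 21)) (.const 1)) (var 21))
        (.seq (.setInt 5 (.mul (var 21) vertices) (var 21))
          (.seq (.setInt 6 (.add (.mul (var 21) vertices) (var 21)) (.const 1))
            (.setInt 21 (.const 0) (.add (var 21) (.const 1)))))))

theorem initLists_spec {σ : State} {n : ℕ} (hσ : Bdd M σ) (hM : n * n + (n + n) + 2 ≤ M)
    (hn : σ.int 0 0 = n) (h21 : σ.int 21 0 = 0) (h5 : ∀ i, σ.int 5 i = 0)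
    (h6 : ∀ i, σ.int 6 i = 0) :
    Ex ψ M B initLists σ fun σ' τ => τ ≤ 6 * n + 1 ∧ (∀ j < n + n, σ'.int 8 j = j / 2) ∧
      (∀ v < n, σ'.int 5 (v * n) = v) ∧
      (∀ v < n, ∀ t < n, (σ'.int 6 (v * n + t) = 1 ↔ v = t)) ∧
      ∀ i < n * n, σ'.int 5 i < n := by
  refine Ex.count (fun i σ' τ => σ'.int 21 0 = i ∧ τ ≤ 6 * i ∧ (∀ j < i + i, σ'.int 8 j = j / 2) ∧
      (∀ v < i, σ'.int 5 (v * n) = v) ∧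
      (∀ v < n, ∀ t < n, (σ'.int 6 (v * n + t) = 1 ↔ v = t ∧ v < i)) ∧
      ∀ i < n * n, σ'.int 5 i < n) n 0 hσ (Nat.zero_le _)
      ⟨h21, by simp, by simp, by simp, by simp [h6], fun i hi => ?_⟩ ?_ ?_
  · rw [h5]
    exact Nat.pos_of_ne_zero fun h => by simp [h] at hi
  · rintro i σ' τ hb hf ⟨hi, hτ, g8, g5, g6, g7⟩ hin
    have e0 : σ'.int 0 = σ.int 0 := hf.1 0 (by decide)
    have m0 : 0 < M := by omega
    refine ⟨by simp [m0], by simp [hi, e0, hn], fun hlt => ?_⟩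
    have i1 : i * n < n * n := by
      have := index_lt (i := 0) hlt (show 0 < n by omega)
      omega
    have i2 : i * n + i < n * n := index_lt hlt hlt
    have m1 : 1 < M := by omega
    have m2 : i + i < M := by omega
    have m3 : i + i + 1 < M := by omega
    have m4 : i * n < M := by omega
    have m5 : i * n + i < M := by omega
    have m6 : i + 1 < M := by omega
    simp [e0, hn, hi, m0, m1, m2, m3, m4, m5, m6]
    refine ⟨by omega, ?_, ?_, ?_, ?_⟩
    · intro j hj
      split_ifs
      · omega
      · omega
      · exact g8 j (by omega)
    · intro v hv
      split_ifs with h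
      · exact (h.resolve_right (by omega)).symm
      · push Not at h
        exact g5 v (by omega)
    · intro v hv t ht
      by_cases h : v * n + t = i * n + i
      · have := index_inj ht hlt h
        simp [h]
        omega
      · simp only [h, not_false_eq_true, true_imp_iff]
        rw [g6 v hv t ht]
        constructor
        · omega
        · rintro ⟨rfl, h'⟩
          refine ⟨rfl, ?_⟩
          rcases Nat.lt_or_eq_of_le h' with h' | rfl
          · exact h'
          · exact absurd rfl h
    · intro j hj
      split_ifs
      · exact hlt
      · exact g7 j hj
  · rintro σ' τ hb hf ⟨hi, hτ, g8, g5, g6, g7⟩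
    exact ⟨by omega, g8, g5, fun v hv t ht => (g6 v hv t ht).trans ⟨fun h => h.1, fun h => ⟨h, hv⟩⟩,
      g7⟩

/-- Set the keys of all tournament trees to `∞`. -/
def clearTrees : Cmd :=
  .while (.intLT (var 22) (.mul vertices (.add vertices vertices)))
    (.seq (.setLen 2 (var 22) .infinity) (.setInt 22 (.const 0) (.add (var 22) (.const 1))))

theorem clearTrees_spec {σ : State} {n : ℕ} (hσ : Bdd M σ) (hM : n * (n + n) + (n + n) + 2 ≤ M)
    (hn : σ.int 0 0 = n) (h22 : σ.int 22 0 = 0) :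
    Ex ψ M B clearTrees σ fun σ' τ => τ ≤ 3 * (n * (n + n)) + 1 ∧
      ∀ i < n * (n + n), σ'.len 2 i = ∞ := by
  refine Ex.count (fun i σ' τ => σ'.int 22 0 = i ∧ τ ≤ 3 * i ∧ ∀ j < i, σ'.len 2 j = ∞)
      (n * (n + n)) 0 hσ (Nat.zero_le _) ⟨h22, by simp, by simp⟩ ?_ ?_
  · rintro i σ' τ hb hf ⟨hi, hτ, g⟩ hin
    have e0 : σ'.int 0 = σ.int 0 := hf.1 0 (by decide)
    have m0 : 0 < M := by omega
    have m1 : n + n < M := by omega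
    have m2 : n * (n + n) < M := by omega
    refine ⟨by simp [m0, e0, hn, m1, m2], by simp [hi, e0, hn], fun hlt => ?_⟩
    have m3 : 1 < M := by omega
    have m4 : i + 1 < M := by omega
    simp [hi, m0, m3, m4]
    refine ⟨by omega, fun j hj hji => g j (by omega)⟩
  · rintro σ' τ hb hf ⟨hi, hτ, g⟩
    exact ⟨by omega, g⟩

/-- Enter the edges of the input graph into the tournament trees. -/
def insertEdges : Cmd :=
  .while (.intLT (var 22) (.get 0 (.const 1)))
    (.seq (.setInt 21 (.const 0) (.get 1 (var 22)))
      (.seq (.setInt 29 (.const 0) (.get 2 (var 22)))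
        (.seq (.ite (.intEq (var 21) (var 29)) .skip (updateLeaf (.get 0 (var 22))))
          (.setInt 22 (.const 0) (.add (var 22) (.const 1))))))

/-- The leaves hold the lengths of the first `e` edges of the input, except for loops. -/
def LeavesHold (n e : ℕ) (σ σ' : State) : Prop :=
  (∀ v < n, ∀ w < n, leaf n σ' v w = ∞ ∨
    ∃ j < e, σ.int 1 j = v ∧ σ.int 2 j = w ∧ v ≠ w ∧ leaf n σ' v w = σ.len 0 j) ∧
  ∀ j < e, σ.int 1 j ≠ σ.int 2 j → leaf n σ' (σ.int 1 j) (σ.int 2 j) = σ.len 0 j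

/-- Loops are omitted because every vertex is listed for itself from the start. The graph is simple,
so no leaf is written by two different edges and each keeps the length of its edge. -/
theorem insertEdges_spec {σ : State} {n m Λ : ℕ} (hσ : Bdd M σ)
    (hM : n * (n + n) + (n + n) + 2 ≤ M) (hmM : m + 2 ≤ M) (h2 : 2 ≤ n) (hΛ : n ≤ 2 ^ Λ)
    (hn : σ.int 0 0 = n) (hm : σ.int 0 1 = m) (h22 : σ.int 22 0 = 0)
    (hhalf : ∀ j < n + n, σ.int 8 j = j / 2) (htop : ∀ i < n * (n + n), σ.len 2 i = ∞)
    (hlt : ∀ j < m, σ.int 1 j < n ∧ σ.int 2 j < n)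
    (hinj : ∀ i < m, ∀ j < m, σ.int 1 i = σ.int 1 j → σ.int 2 i = σ.int 2 j → i = j) :
    Ex ψ M B insertEdges σ fun σ' τ => τ ≤ m * (5 * Λ + 10) + 1 ∧
      (∀ v < n, RowTree n σ' v) ∧ LeavesHold n m σ σ' := by
  have hM2 : 2 * (n + n) ≤ n * (n + n) := Nat.mul_le_mul_right _ h2
  refine Ex.count (fun i σ' τ => σ'.int 22 0 = i ∧ τ ≤ i * (5 * Λ + 10) ∧
      (∀ v < n, RowTree n σ' v) ∧ LeavesHold n i σ σ') m 0 hσ (Nat.zero_le _)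
      ⟨h22, by simp, ?_, ?_, by simp⟩ ?_ ?_
  · intro v hv
    have hi : ∀ i < n + n, σ.len 2 (v * (n + n) + i) = ∞ := fun i hi => htop _ (index_lt hv hi)
    refine ⟨fun j h0 hj => ?_, fun w hw h => absurd (hi (n + w) (by omega)) h⟩
    simp [TreeNode, hi j (by omega), hi (j + j) (by omega), hi (j + j + 1) (by omega)]
  · exact fun v hv w hw => .inl (htop _ (index_lt hv (by omega)))
  · rintro i σ' τ hb hf ⟨hi, hτ, htree, hl1, hl2⟩ him
    have e0 : σ'.int 0 = σ.int 0 := hf.1 0 (by decide)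
    have e1 : σ'.int 1 = σ.int 1 := hf.1 1 (by decide)
    have e2 : σ'.int 2 = σ.int 2 := hf.1 2 (by decide)
    have e8 : σ'.int 8 = σ.int 8 := hf.1 8 (by decide)
    have el : σ'.len 0 = σ.len 0 := hf.2 0 (by decide)
    have m0 : 0 < M := by omega
    have m1 : 1 < M := by omega
    refine ⟨by simp [m0, m1], by simp [hi, e0, hm], fun him' => ?_⟩
    have m2 : i + 1 < M := by omega
    obtain ⟨hs, hd⟩ := hlt i him'
    set s := σ.int 1 i with hsdef
    set d := σ.int 2 i with hddef
    have htau : τ + (5 * Λ + 10) ≤ (i + 1) * (5 * Λ + 10) := by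
      rw [add_mul]
      omega
    simp [hi, m0, m1, m2, e1, e2, ← hsdef, ← hddef]
    have hbs : Bdd M ((σ'.setInt 21 0 s).setInt 29 0 d) :=
      (hb.setInt _ _ (by omega)).setInt _ _ (by omega)
    refine ⟨fun hsd => ⟨by omega, ?_, ?_, ?_⟩, fun hsd => ?_⟩
    · exact htree
    · intro v hv w hw
      refine (hl1 v hv w hw).imp_right ?_
      rintro ⟨j, hj, h⟩
      exact ⟨j, by omega, h⟩
    · intro j hj hne
      rcases Nat.lt_succ_iff_lt_or_eq.1 hj with hj | rfl
      · exact hl2 j hj hne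
      · exact absurd hsd hne
    · refine (updateLeaf_spec (n := n) (Λ := Λ) (v := s) (t := d) (X := σ.len 0 i) (by omega) h2 hΛ
        ?_ ?_ ?_ ?_ hs hd ?_ ?_).mono hbs ?_
      · simp [e0, hn]
      · simpa [e8] using hhalf
      · simp
      · simp
      · simp [m0, hi, el]
      · exact htree
      · rintro σ₁ t₁ hb₁ hf₁ ⟨ht₁, htr₁, hl₁⟩
        have f22 : σ₁.int 22 0 = i := by
          rw [hf₁.1 22 (by decide)]
          simpa using hi
        simp [f22, m2]
        refine ⟨by omega, htr₁, ?_, ?_⟩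
        · intro v hv w hw
          change leaf n σ₁ v w = ∞ ∨ ∃ j < i + 1, σ.int 1 j = v ∧ σ.int 2 j = w ∧ v ≠ w ∧
            leaf n σ₁ v w = σ.len 0 j
          rw [show leaf n σ₁ v w = if v = s ∧ w = d then σ.len 0 i else leaf n σ' v w from
            hl₁ v hv w hw]
          split_ifs with h
          · obtain ⟨rfl, rfl⟩ := h
            exact .inr ⟨i, by omega, rfl, rfl, hsd, rfl⟩
          · refine (hl1 v hv w hw).imp_right ?_
            rintro ⟨j, hj, h⟩
            exact ⟨j, by omega, h⟩
        · intro j hj hne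
          change leaf n σ₁ _ _ = _
          obtain ⟨hjs, hjd⟩ := hlt j (by omega)
          rw [show leaf n σ₁ (σ.int 1 j) (σ.int 2 j) = if σ.int 1 j = s ∧ σ.int 2 j = d then
            σ.len 0 i else leaf n σ' (σ.int 1 j) (σ.int 2 j) from hl₁ _ hjs _ hjd]
          split_ifs with h
          · rw [hinj j (by omega) i him' h.1 h.2]
          · refine hl2 j ?_ hne
            rcases Nat.lt_succ_iff_lt_or_eq.1 hj with hj | rfl
            · exact hj
            · exact absurd ⟨rfl, rfl⟩ h
  · rintro σ' τ hb hf ⟨hi, hτ, htree, hl⟩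
    exact ⟨by omega, htree, hl⟩

/-- Fill the tournament trees and the lists. -/
def setup : Cmd :=
  .seq initLists (.seq clearTrees (.seq (.setInt 22 (.const 0) (.const 0))
    (.seq insertEdges (.setInt 20 (.const 0) (.const 1)))))

theorem setup_spec {σ : State} {n m Λ : ℕ} (hσ : Bdd M σ)
    (hM : n * (n + n) + (n + n) + 2 ≤ M) (hmM : m + 2 ≤ M) (h2 : 2 ≤ n) (hΛ : n ≤ 2 ^ Λ)
    (hn : σ.int 0 0 = n) (hm : σ.int 0 1 = m) (h0 : ∀ a i, 2 < a → σ.int a i = 0)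
    (hlt : ∀ j < m, σ.int 1 j < n ∧ σ.int 2 j < n)
    (hinj : ∀ i < m, ∀ j < m, σ.int 1 i = σ.int 1 j → σ.int 2 i = σ.int 2 j → i = j) :
    wp ψ M B setup (fun σ' τ => τ ≤ m * (5 * Λ + 10) + 3 * (n * (n + n)) + 6 * n + 5 ∧
      (∀ j < n + n, σ'.int 8 j = j / 2) ∧ (∀ v < n, σ'.int 5 (v * n) = v) ∧
      (∀ v < n, ∀ t < n, (σ'.int 6 (v * n + t) = 1 ↔ v = t)) ∧
      (∀ i < n * n, σ'.int 5 i < n) ∧ σ'.int 20 0 = 1 ∧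
      (∀ v < n, RowTree n σ' v) ∧ LeavesHold n m σ σ') σ := by
  have hnn : n * n ≤ n * (n + n) := Nat.mul_le_mul_left _ (by omega)
  refine fun _ => (initLists_spec hσ (by omega) hn (h0 _ _ (by omega))
    (fun _ => h0 _ _ (by omega)) fun _ => h0 _ _ (by omega)).mono hσ ?_
  rintro σ₁ t₁ hb₁ hf₁ ⟨ht₁, g8, g5, g6, g7⟩
  refine fun _ => (clearTrees_spec hb₁ hM ?_ ?_).mono hb₁ ?_
  · rw [hf₁.1 0 (by decide), hn]
  · rw [hf₁.1 22 (by decide), h0 _ _ (by omega)]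
  rintro σ₂ t₂ hb₂ hf₂ ⟨ht₂, htop⟩
  have m0 : 0 < M := by omega
  have m1 : 1 < M := by omega
  have c0 : σ₂.int 0 = σ.int 0 := (hf₂.1 0 (by decide)).trans (hf₁.1 0 (by decide))
  have c1 : σ₂.int 1 = σ.int 1 := (hf₂.1 1 (by decide)).trans (hf₁.1 1 (by decide))
  have c2 : σ₂.int 2 = σ.int 2 := (hf₂.1 2 (by decide)).trans (hf₁.1 2 (by decide))
  have d0 : σ₂.len 0 = σ.len 0 := (hf₂.2 0 (by decide)).trans (hf₁.2 0 (by decide))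
  refine ⟨m0, m0, by omega, fun hb => (insertEdges_spec (m := m) (n := n) (Λ := Λ) hb hM hmM h2 hΛ
    ?_ ?_ ?_ ?_ htop ?_ ?_).mono hb ?_⟩
  · simp [c0, hn]
  · simp [c0, hm]
  · simp
  · simpa [hf₂.1 8 (by decide)] using g8
  · simpa [c1, c2] using hlt
  · simpa [c1, c2] using hinj
  rintro σ₃ t₃ hb₃ hf₃ ⟨ht₃, htr, hl⟩
  have e5 : σ₃.int 5 = σ₁.int 5 := (hf₃.1 5 (by decide)).trans (hf₂.1 5 (by decide))
  have e6 : σ₃.int 6 = σ₁.int 6 := (hf₃.1 6 (by decide)).trans (hf₂.1 6 (by decide))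
  have e8 : σ₃.int 8 = σ₁.int 8 := (hf₃.1 8 (by decide)).trans (hf₂.1 8 (by decide))
  simp [m0, m1, e5, e6, e8]
  refine ⟨by omega, g8, g5, g6, g7, htr, ?_⟩
  simpa [LeavesHold, leaf, c1, c2, d0] using hl

end RAM

/-! ### The knowledge kept between rounds, direct candidates and pointers. -/

namespace RAM

variable {ψ : SSSPAlgorithm} {M B : ℕ}

/-- What the program knows at the beginning of a round: the lists `L` of the `k` closest vertices
of every vertex, their distances `D` and parents `P`, and the `ec` edges from `ev i` to `eu i` that
have been found to be shortest paths. -/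
structure Knowledge where
  n : ℕ
  k : ℕ
  W : ℕ → ℕ → ℝ≥0∞
  δ : ℕ → ℕ → ℝ≥0∞
  L : ℕ → ℕ → ℕ
  P : ℕ → ℕ → ℕ
  D : ℕ → ℕ → ℝ≥0∞
  ec : ℕ
  ev : ℕ → ℕ
  eu : ℕ → ℕ

namespace Knowledge

/-- The known edges. -/
def E (g : Knowledge) (v u : ℕ) : Prop := ∃ i < g.ec, g.ev i = v ∧ g.eu i = u

/-- The knowledge is correct. -/
structure Valid (g : Knowledge) : Prop where
  two_le : 2 ≤ g.n
  pos : 0 < g.k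
  dist : IsDistance g.n g.W g.δ
  closest : Closest g.n g.W g.δ g.k g.L g.P g.D g.E
  inj : ∀ i < g.ec, ∀ j < g.ec, g.ev i = g.ev j → g.eu i = g.eu j → i = j

/-- The knowledge is stored in the arrays. -/
structure Holds (g : Knowledge) (σ : State) : Prop where
  n_eq : σ.int 0 0 = g.n
  k_eq : σ.int 20 0 = g.k
  ec_eq : σ.int 23 0 = g.ec
  half : ∀ j < g.n + g.n, σ.int 8 j = j / 2
  list_lt : ∀ i < g.n * g.n, σ.int 5 i < g.n
  list : ∀ v < g.n, ∀ i < g.k, σ.int 5 (v * g.n + i) = g.L v i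
  mark : ∀ v < g.n, ∀ t < g.n, (σ.int 6 (v * g.n + t) = 1 ↔ Listed g.k g.L v t)
  parent : ∀ v < g.n, ∀ t < g.n, σ.int 3 (v * g.n + t) = g.P v t
  dist : ∀ v < g.n, ∀ t < g.n, σ.len 1 (v * g.n + t) = g.D v t
  ev : ∀ i < g.ec, σ.int 9 i = g.ev i
  eu : ∀ i < g.ec, σ.int 10 i = g.eu i
  len : ∀ i < g.ec, σ.len 3 i = g.W (g.ev i) (g.eu i)

/-- The pointers into the lists of the heads of the known edges skip only old targets. -/
def Pointers (g : Knowledge) (σ : State) : Prop :=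
  ∀ i < g.ec, σ.int 11 i ≤ g.k ∧ ∀ j < σ.int 11 i, Listed g.k g.L (g.ev i) (g.L (g.eu i) j)

/-- The tournament trees hold the edges to new targets. -/
def Trees (g : Knowledge) (σ : State) : Prop :=
  (∀ v < g.n, RowTree g.n σ v) ∧ ∀ v < g.n, ∀ w < g.n,
    (Listed g.k g.L v w → leaf g.n σ v w = ∞) ∧
      (¬ Listed g.k g.L v w → leaf g.n σ v w = g.W v w)

variable {g : Knowledge} {σ σ' : State}

theorem Holds.congr (h : g.Holds σ) (hI : ∀ a ∈ [0, 20, 23, 8, 5, 6, 3, 9, 10], σ'.int a = σ.int a)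
    (hL : ∀ a ∈ [1, 3], σ'.len a = σ.len a) : g.Holds σ' := by
  constructor
  · rw [hI 0 (by decide), h.n_eq]
  · rw [hI 20 (by decide), h.k_eq]
  · rw [hI 23 (by decide), h.ec_eq]
  · rw [hI 8 (by decide)]
    exact h.half
  · rw [hI 5 (by decide)]
    exact h.list_lt
  · rw [hI 5 (by decide)]
    exact h.list
  · rw [hI 6 (by decide)]
    exact h.mark
  · rw [hI 3 (by decide)]
    exact h.parent
  · rw [hL 1 (by decide)]
    exact h.dist
  · rw [hI 9 (by decide)]
    exact h.ev
  · rw [hI 10 (by decide)]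
    exact h.eu
  · rw [hL 3 (by decide)]
    exact h.len

theorem Holds.frame {c : Cmd} (h : g.Holds σ) (hf : Frame c σ σ')
    (hI : ∀ a ∈ [0, 20, 23, 8, 5, 6, 3, 9, 10], a ∉ c.modI)
    (hL : ∀ a ∈ [1, 3], a ∉ c.modL) : g.Holds σ' :=
  h.congr (fun a ha => hf.1 a (hI a ha)) fun a ha => hf.2 a (hL a ha)

theorem Valid.edge (h : g.Valid) {i : ℕ} (hi : i < g.ec) :
    g.ev i < g.n ∧ g.eu i < g.n ∧ g.ev i ≠ g.eu i ∧ Listed g.k g.L (g.ev i) (g.eu i) ∧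
      g.W (g.ev i) (g.eu i) = g.δ (g.ev i) (g.eu i) :=
  h.closest.edge _ _ ⟨i, hi, rfl, rfl⟩

/-- The edges that are shortest paths. -/
noncomputable def star (g : Knowledge) : Finset (ℕ × ℕ) := by
  classical
  exact (Finset.range g.n ×ˢ Finset.range g.n).filter fun e =>
    e.1 ≠ e.2 ∧ g.W e.1 e.2 = g.δ e.1 e.2

/-- The known edges are pairwise distinct and each is a shortest path; this bounds the scanning work
and the size of the auxiliary graph. -/
theorem Valid.ec_le (h : g.Valid) : g.ec ≤ g.star.card := by
  rw [← Finset.card_range g.ec]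
  refine Finset.card_le_card_of_injOn (fun i => (g.ev i, g.eu i)) ?_ ?_
  · intro i hi
    have := h.edge (i := i) (by simpa using hi)
    simp [star, this]
  · intro i hi j hj hij
    simp only [Prod.mk.injEq] at hij
    exact h.inj i (by simpa using hi) j (by simpa using hj) hij.1 hij.2

theorem star_le (g : Knowledge) : g.star.card ≤ g.n * g.n := by
  refine (Finset.card_le_card (Finset.filter_subset _ _)).trans ?_
  simp

end Knowledge

/-- Let the candidate of every vertex be the winner of its tournament tree. -/
def loadRoots : Cmd :=
  .while (.intLT (var 21) vertices)
    (.seq (.setLen 6 (var 21)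
        (.get 2 (.add (.mul (var 21) (.add vertices vertices)) (.const 1))))
      (.seq (.setInt 16 (var 21)
          (.get 7 (.add (.mul (var 21) (.add vertices vertices)) (.const 1))))
        (.seq (.setInt 17 (var 21) (var 21))
          (.setInt 21 (.const 0) (.add (var 21) (.const 1))))))

theorem loadRoots_spec {σ : State} {n : ℕ} (hσ : Bdd M σ) (hM : n * (n + n) + (n + n) + 2 ≤ M)
    (hn : σ.int 0 0 = n) (h21 : σ.int 21 0 = 0) :
    Ex ψ M B loadRoots σ fun σ' τ => τ ≤ 5 * n + 1 ∧ ∀ v < n,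
      σ'.len 6 v = σ.len 2 (v * (n + n) + 1) ∧ σ'.int 16 v = σ.int 7 (v * (n + n) + 1) ∧
      σ'.int 17 v = v := by
  refine Ex.count (fun i σ' τ => σ'.int 21 0 = i ∧ τ ≤ 5 * i ∧ ∀ v < i,
      σ'.len 6 v = σ.len 2 (v * (n + n) + 1) ∧ σ'.int 16 v = σ.int 7 (v * (n + n) + 1) ∧
      σ'.int 17 v = v) n 0 hσ (Nat.zero_le _) ⟨h21, by simp, by simp⟩ ?_ ?_
  · rintro i σ' τ hb hf ⟨hi, hτ, g⟩ hin
    have e0 : σ'.int 0 = σ.int 0 := hf.1 0 (by decide)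
    have e7 : σ'.int 7 = σ.int 7 := hf.1 7 (by decide)
    have el : σ'.len 2 = σ.len 2 := hf.2 2 (by decide)
    have m0 : 0 < M := by omega
    refine ⟨by simp [m0], by simp [hi, e0, hn], fun hlt => ?_⟩
    have m1 : 1 < M := by omega
    have m2 : n + n < M := by omega
    have m3 := index_lt (i := 1) (a := n + n) hlt (by omega)
    have m4 : i * (n + n) < M := by omega
    have m5 : i * (n + n) + 1 < M := by omega
    have m6 : i + 1 < M := by omega
    simp [e0, hn, hi, m0, m1, m2, m4, m5, m6, e7, el]
    refine ⟨by omega, fun v hv => ?_⟩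
    rcases Nat.lt_or_eq_of_le hv with h | rfl
    · have := g v h
      simp [h.ne, this]
    · simp
  · rintro σ' τ hb hf ⟨hi, hτ, g⟩
    exact ⟨by omega, g⟩

/-- Move the pointer of the edge `int 22` from `int 21` to `int 30` past old targets. -/
def advance : Cmd :=
  .while (.and (.intLT (.get 11 (var 22)) (var 20))
      (.intEq (.get 6 (.add (.mul (var 21) vertices)
        (.get 5 (.add (.mul (var 30) vertices) (.get 11 (var 22)))))) (.const 1)))
    (.setInt 11 (var 22) (.add (.get 11 (var 22)) (.const 1)))

/-- An iteration costs two units and moves the pointer by one, so all but the final test is paid for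
by the growth of the pointer. -/
theorem advance_spec {σ : State} {g : Knowledge} {i : ℕ} (hσ : Bdd M σ) (hg : g.Valid)
    (hs : g.Holds σ) (hM : g.n * g.n + g.n + 2 ≤ M) (hk : g.k < g.n) (hi : i < g.ec)
    (h22 : σ.int 22 0 = i) (h21 : σ.int 21 0 = g.ev i) (h30 : σ.int 30 0 = g.eu i)
    (hp : g.Pointers σ) :
    Ex ψ M B advance σ fun σ' τ => σ.int 11 i ≤ σ'.int 11 i ∧
      τ + 2 * σ.int 11 i ≤ 2 * σ'.int 11 i + 1 ∧ (∀ j, j ≠ i → σ'.int 11 j = σ.int 11 j) ∧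
      σ'.int 11 i ≤ g.k ∧ (∀ j < σ'.int 11 i, Listed g.k g.L (g.ev i) (g.L (g.eu i) j)) ∧
      (σ'.int 11 i < g.k → ¬ Listed g.k g.L (g.ev i) (g.L (g.eu i) (σ'.int 11 i))) := by
  refine Ex.loop (fun s σ' τ => s = g.k - σ'.int 11 i ∧ σ.int 11 i ≤ σ'.int 11 i ∧
      τ + 2 * σ.int 11 i ≤ 2 * σ'.int 11 i ∧ (∀ j, j ≠ i → σ'.int 11 j = σ.int 11 j) ∧
      σ'.int 11 i ≤ g.k ∧ (∀ j < σ'.int 11 i, Listed g.k g.L (g.ev i) (g.L (g.eu i) j)))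
      _ hσ ⟨rfl, le_rfl, by omega, fun _ _ => rfl, (hp i hi).1, (hp i hi).2⟩ ?_
  rintro s σ' τ hb hf ⟨h1, h2, h3, h4, h5, h6⟩
  have e22 : σ'.int 22 0 = i := by rw [hf.1 22 (by decide), h22]
  have e21 : σ'.int 21 0 = g.ev i := by rw [hf.1 21 (by decide), h21]
  have e30 : σ'.int 30 0 = g.eu i := by rw [hf.1 30 (by decide), h30]
  have hs' := hs.frame hf (by decide) (by decide)
  obtain ⟨hv, hu, -⟩ := hg.edge hi
  have i1 := index_lt (i := σ'.int 11 i) hu (show _ < g.n by omega)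
  -- The conjunction evaluates both tests, so the mark is read even when the pointer has reached k,
  -- beyond the end of the list. That all list cells hold vertices keeps this read within bounds.
  have i2 := hs'.list_lt _ i1
  have i3 := index_lt hv i2
  have m0 : 0 < M := by omega
  have m1 : 1 < M := by omega
  have m2 : g.ev i * g.n < M := by omega
  have m3 : g.eu i * g.n < M := by omega
  have m4 : g.eu i * g.n + σ'.int 11 i < M := by omega
  have m5 : g.ev i * g.n + σ'.int 5 (g.eu i * g.n + σ'.int 11 i) < M := by omega
  refine ⟨by simp [e22, e21, e30, hs'.n_eq, m0, m1, m2, m3, m4, m5], fun hval => ?_,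
    fun hval => ?_⟩
  · simp only [Test.val, IExp.val, var, vertices, e22, e21, e30, hs'.n_eq, hs'.k_eq] at hval
    obtain ⟨hlt, hmark⟩ := hval
    rw [hs'.mark _ hv _ i2, hs'.list _ hu _ hlt] at hmark
    have m6 : σ'.int 11 i + 1 < M := by omega
    simp [e22, m0, m1, m6]
    refine ⟨by omega, by omega, by omega, ?_, by omega, ?_⟩
    · intro j hj
      simp [hj, h4 j hj]
    · intro j hj
      rcases Nat.lt_or_eq_of_le hj with h | rfl
      · exact h6 j h
      · exact hmark
  · refine ⟨h2, by omega, h4, h5, h6, fun hlt => ?_⟩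
    simp only [Test.val, IExp.val, var, vertices, e22, e21, e30, hs'.n_eq, hs'.k_eq] at hval
    rw [hs'.mark _ hv _ i2, hs'.list _ hu _ hlt] at hval
    exact fun h => hval ⟨hlt, h⟩

end RAM

/-! ### Candidates along known edges. -/

namespace RAM

variable {ψ : SSSPAlgorithm} {M B : ℕ}

/-- Improve the candidate of `int 21` by a target of `int 30`. -/
def relax : Cmd :=
  .seq (.setInt 29 (.const 0) (.get 5 (.add (.mul (var 30) vertices) (var 31))))
    (.ite (.lenLT (.add (.get 3 (var 22)) (.get 1 (.add (.mul (var 30) vertices) (var 29))))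
        (.get 6 (var 21)))
      (.seq (.setLen 6 (var 21)
          (.add (.get 3 (var 22)) (.get 1 (.add (.mul (var 30) vertices) (var 29)))))
        (.seq (.setInt 16 (var 21) (var 29))
          (.setInt 17 (var 21) (.get 3 (.add (.mul (var 30) vertices) (var 29))))))
      .skip)

/-- Add the reversal of the edge `int 22` to the auxiliary graph. -/
def addArc : Cmd :=
  .seq (.setInt 12 (var 24) (var 30))
    (.seq (.setInt 13 (var 24) (var 21))
      (.seq (.setLen 4 (var 24) (.get 3 (var 22)))
        (.setInt 24 (.const 0) (.add (var 24) (.const 1)))))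

/-- Find candidates along the known edges, and collect the edges of the auxiliary graph. -/
def scanEdges : Cmd :=
  .while (.intLT (var 22) (var 23))
    (.seq (.setInt 21 (.const 0) (.get 9 (var 22)))
      (.seq (.setInt 30 (.const 0) (.get 10 (var 22)))
        (.seq advance
          (.seq (.setInt 31 (.const 0) (.get 11 (var 22)))
            (.seq (.ite (.intLT (var 31) (var 20)) relax addArc)
              (.setInt 22 (.const 0) (.add (var 22) (.const 1))))))))

/-- An edge of the auxiliary graph, among the first `q` that are stored. -/
def Arc (σ : State) (q a b : ℕ) (x : ℝ≥0∞) : Prop :=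
  ∃ e < q, σ.int 12 e = a ∧ σ.int 13 e = b ∧ σ.len 4 e = x

namespace Knowledge

/-- Every vertex has a correct candidate, unless its key is `∞`. -/
structure Candidates (g : Knowledge) (σ : State) : Prop where
  candidate : ∀ v < g.n, σ.len 6 v ≠ ∞ →
    Candidate g.n g.W g.δ g.k g.L g.E v (σ.len 6 v) (σ.int 16 v) (σ.int 17 v)
  direct : ∀ v < g.n, ∀ z < g.n, ¬ Listed g.k g.L v z → σ.len 6 v ≤ g.W v z

/-- The first `i` known edges are taken care of, with `q` edges of the auxiliary graph. -/
structure Scanned (g : Knowledge) (i q : ℕ) (σ : State) : Prop where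
  le : q ≤ i
  pointers : g.Pointers σ
  candidates : g.Candidates σ
  complete : ∀ j < i,
    ((∀ s < g.k, Listed g.k g.L (g.ev j) (g.L (g.eu j) s)) ∧
      Arc σ q (g.eu j) (g.ev j) (g.W (g.ev j) (g.eu j))) ∨
    ∃ p < g.k, (∀ s < p, Listed g.k g.L (g.ev j) (g.L (g.eu j) s)) ∧
      σ.len 6 (g.ev j) ≤ g.W (g.ev j) (g.eu j) + g.δ (g.eu j) (g.L (g.eu j) p)
  sound : ∀ e < q, ∃ j < i, σ.int 12 e = g.eu j ∧ σ.int 13 e = g.ev j ∧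
    σ.len 4 e = g.W (g.ev j) (g.eu j) ∧ ∀ s < g.k, Listed g.k g.L (g.ev j) (g.L (g.eu j) s)
  inj : ∀ e < q, ∀ f < q, σ.int 12 e = σ.int 12 f → σ.int 13 e = σ.int 13 f → e = f

/-- The sum of the pointers. -/
def pointerSum (g : Knowledge) (σ : State) : ℕ := ∑ j ∈ Finset.range g.ec, σ.int 11 j

theorem pointerSum_add {g : Knowledge} {σ σ' : State} {i : ℕ} (hi : i < g.ec)
    (h : ∀ j, j ≠ i → σ'.int 11 j = σ.int 11 j) :
    g.pointerSum σ' + σ.int 11 i = g.pointerSum σ + σ'.int 11 i := by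
  have hm : i ∈ Finset.range g.ec := by simpa using hi
  rw [pointerSum, pointerSum, ← Finset.add_sum_erase _ _ hm, ← Finset.add_sum_erase _ _ hm,
    Finset.sum_congr rfl fun j hj => h j (Finset.ne_of_mem_erase hj)]
  ring

variable {g : Knowledge} {σ σ' : State} {i q : ℕ}

theorem Scanned.of_candidate (h : g.Scanned i q σ) (hp : g.Pointers σ') (hc : g.Candidates σ')
    (h12 : σ'.int 12 = σ.int 12) (h13 : σ'.int 13 = σ.int 13) (h4 : σ'.len 4 = σ.len 4)
    (hle : ∀ v, σ'.len 6 v ≤ σ.len 6 v)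
    (hnew : ∃ p < g.k, (∀ s < p, Listed g.k g.L (g.ev i) (g.L (g.eu i) s)) ∧
      σ'.len 6 (g.ev i) ≤ g.W (g.ev i) (g.eu i) + g.δ (g.eu i) (g.L (g.eu i) p)) :
    g.Scanned (i + 1) q σ' := by
  refine ⟨h.le.trans (Nat.le_succ i), hp, hc, fun j hj => ?_, fun e he => ?_, ?_⟩
  · rcases Nat.lt_succ_iff_lt_or_eq.1 hj with hj | rfl
    · refine (h.complete j hj).imp (fun h' => ?_) fun ⟨p, h1, h2, h3⟩ =>
        ⟨p, h1, h2, (hle _).trans h3⟩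
      simpa only [Arc, h12, h13, h4] using h'
    · exact .inr hnew
  · obtain ⟨j, hj, h'⟩ := h.sound e he
    exact ⟨j, hj.trans (Nat.lt_succ_self i), by simpa only [h12, h13, h4] using h'⟩
  · simpa only [h12, h13] using h.inj

theorem Scanned.of_arc (h : g.Scanned i q σ) (hg : g.Valid) (hi : i < g.ec)
    (hp : g.Pointers σ') (h6 : σ'.len 6 = σ.len 6) (h16 : σ'.int 16 = σ.int 16)
    (h17 : σ'.int 17 = σ.int 17)
    (hold : ∀ e < q, σ'.int 12 e = σ.int 12 e ∧ σ'.int 13 e = σ.int 13 e ∧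
      σ'.len 4 e = σ.len 4 e)
    (hnew : σ'.int 12 q = g.eu i ∧ σ'.int 13 q = g.ev i ∧
      σ'.len 4 q = g.W (g.ev i) (g.eu i))
    (hall : ∀ s < g.k, Listed g.k g.L (g.ev i) (g.L (g.eu i) s)) :
    g.Scanned (i + 1) (q + 1) σ' := by
  refine ⟨Nat.succ_le_succ h.le, hp, ?_, fun j hj => ?_, fun e he => ?_, ?_⟩
  · obtain ⟨h1, h2⟩ := h.candidates
    constructor
    · simpa only [h6, h16, h17] using h1
    · simpa only [h6] using h2
  · rcases Nat.lt_succ_iff_lt_or_eq.1 hj with hj | rfl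
    · rw [h6]
      refine (h.complete j hj).imp_left fun ⟨h1, e, he, h2⟩ =>
        ⟨h1, e, he.trans (Nat.lt_succ_self q), ?_⟩
      rwa [(hold e he).1, (hold e he).2.1, (hold e he).2.2]
    · exact .inl ⟨hall, q, Nat.lt_succ_self q, hnew⟩
  · rcases Nat.lt_succ_iff_lt_or_eq.1 he with he | rfl
    · obtain ⟨j, hj, h'⟩ := h.sound e he
      refine ⟨j, hj.trans (Nat.lt_succ_self i), ?_⟩
      rwa [(hold e he).1, (hold e he).2.1, (hold e he).2.2]
    · exact ⟨i, Nat.lt_succ_self i, hnew.1, hnew.2.1, hnew.2.2, hall⟩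
  · have key : ∀ e < q, σ.int 12 e = g.eu i → σ.int 13 e = g.ev i → False := by
      intro e he h1 h2
      obtain ⟨j, hj, h3, h4, -⟩ := h.sound e he
      have := hg.inj j (hj.trans hi) i hi (by omega) (by omega)
      omega
    intro e he e' he' h1 h2
    rcases Nat.lt_succ_iff_lt_or_eq.1 he with he | rfl
    · rcases Nat.lt_succ_iff_lt_or_eq.1 he' with he' | rfl
      · rw [(hold e he).1, (hold e' he').1] at h1
        rw [(hold e he).2.1, (hold e' he').2.1] at h2
        exact h.inj e he e' he' h1 h2
      · rw [(hold e he).1, hnew.1] at h1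
        rw [(hold e he).2.1, hnew.2.1] at h2
        exact (key e he h1 h2).elim
    · rcases Nat.lt_succ_iff_lt_or_eq.1 he' with he' | rfl
      · rw [(hold e' he').1, hnew.1] at h1
        rw [(hold e' he').2.1, hnew.2.1] at h2
        exact (key e' he' h1.symm h2.symm).elim
      · rfl

end Knowledge

open Knowledge

/-- Each known edge costs at most 12 units plus twice the advance of its pointer; summing the
advances gives the potential difference. -/
theorem scanEdges_spec {σ : State} {g : Knowledge} (hσ : Bdd M σ) (hg : g.Valid)
    (hs : g.Holds σ) (hM : g.n * (g.n + g.n) + (g.n + g.n) + 2 ≤ M) (hk : g.k < g.n)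
    (h22 : σ.int 22 0 = 0) (h24 : σ.int 24 0 = 0) (hp : g.Pointers σ) (hc : g.Candidates σ) :
    Ex ψ M B scanEdges σ fun σ' τ => τ + 2 * g.pointerSum σ ≤ 12 * g.ec + 2 * g.pointerSum σ' + 1 ∧
      g.Scanned g.ec (σ'.int 24 0) σ' := by
  refine Ex.count (fun i σ' τ => σ'.int 22 0 = i ∧
      τ + 2 * g.pointerSum σ ≤ 12 * i + 2 * g.pointerSum σ' ∧ g.Scanned i (σ'.int 24 0) σ')
      g.ec 0 hσ (Nat.zero_le _) ⟨h22, by simp, ?_⟩ ?_ ?_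
  · rw [h24]
    exact ⟨le_rfl, hp, hc, by simp, by simp, by simp⟩
  · rintro i σ' τ hb hf ⟨hi, hτ, hI⟩ him
    have hnn : g.n * g.n + g.n * g.n = g.n * (g.n + g.n) := by ring
    have hec := hg.ec_le.trans g.star_le
    have hs' := hs.frame hf (by decide) (by decide)
    have m0 : 0 < M := by omega
    have m1 : 1 < M := by omega
    refine ⟨by simp [m0], by simp [hi, hs'.ec_eq], fun him' => ?_⟩
    obtain ⟨hv, hu, hne, -, -⟩ := hg.edge him'
    have e9 := hs'.ev i him'
    have e10 := hs'.eu i him'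
    simp [hi, m0, e9, e10]
    set σ₀ := (σ'.setInt 21 0 (g.ev i)).setInt 30 0 (g.eu i) with hσ₀
    have hb₀ : Bdd M σ₀ := (hb.setInt _ _ (by omega)).setInt _ _ (by omega)
    have hs₀ : g.Holds σ₀ := hs'.congr (by simp [hσ₀]) (by simp [hσ₀])
    refine fun _ => (advance_spec hb₀ hg hs₀ (by omega) hk him' ?_ ?_ ?_ ?_).mono hb₀ ?_
    · simp [hσ₀, hi]
    · simp [hσ₀]
    · simp [hσ₀]
    · exact hI.pointers
    rintro σ₁ t₁ hb₁ hf₁ ⟨p1, p2, p3, p4, p5, p6⟩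
    have hs₁ := hs₀.frame hf₁ (by decide) (by decide)
    have hsum : g.pointerSum σ₁ + σ'.int 11 i = g.pointerSum σ' + σ₁.int 11 i :=
      pointerSum_add him' p3
    have q2 : t₁ + 2 * σ'.int 11 i ≤ 2 * σ₁.int 11 i + 1 := p2
    have f22 : σ₁.int 22 0 = i := by rw [hf₁.1 22 (by decide), ← hi]; rfl
    have f21 : σ₁.int 21 0 = g.ev i := by rw [hf₁.1 21 (by decide)]; rfl
    have f30 : σ₁.int 30 0 = g.eu i := by rw [hf₁.1 30 (by decide)]; rfl
    have f24 : σ₁.int 24 = σ'.int 24 := by rw [hf₁.1 24 (by decide)]; rfl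
    have f12 : σ₁.int 12 = σ'.int 12 := by rw [hf₁.1 12 (by decide)]; rfl
    have f13 : σ₁.int 13 = σ'.int 13 := by rw [hf₁.1 13 (by decide)]; rfl
    have f16 : σ₁.int 16 = σ'.int 16 := by rw [hf₁.1 16 (by decide)]; rfl
    have f17 : σ₁.int 17 = σ'.int 17 := by rw [hf₁.1 17 (by decide)]; rfl
    have f4 : σ₁.len 4 = σ'.len 4 := by rw [hf₁.2 4 (by decide)]; rfl
    have f6 : σ₁.len 6 = σ'.len 6 := by rw [hf₁.2 6 (by decide)]; rfl
    set p := σ₁.int 11 i with hpdef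
    set q := σ'.int 24 0 with hqdef
    have hp₁ : g.Pointers σ₁ := by
      intro j hj
      by_cases hji : j = i
      · subst hji
        exact ⟨p4, p5⟩
      · rw [p3 j hji]
        exact hI.pointers j hj
    have hqi := hI.le
    have i1 := index_lt (i := p) hu (show _ < g.n by omega)
    have i2 := hs₁.list_lt _ i1
    have i3 := index_lt hu i2
    have m2 : i + 1 < M := by omega
    have m3 : g.eu i * g.n < M := by omega
    have m4 : g.eu i * g.n + p < M := by omega
    have m5 : g.eu i * g.n + σ₁.int 5 (g.eu i * g.n + p) < M := by omega
    have m6 : q + 1 < M := by omega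
    simp only [wp, IExp.ok, IExp.val, LExp.ok, LExp.val, Test.ok, Test.val, relax, addArc]
    simp [f21, f22, f24, f30, ← hpdef, ← hqdef, m0, m1, m2, m3, m4, m5, m6, hs₁.k_eq, hs₁.n_eq,
      hs₁.len i him']
    refine ⟨fun hlt => ?_, fun hge => ?_⟩
    · rw [hs₁.list _ hu _ hlt]
      have hnew := p6 hlt
      have hlu := hg.closest.lt _ hu _ hlt
      have hcand := hg.closest.candidate_of_edge hg.dist ⟨i, him', rfl, rfl⟩ hlt hnew p5
      rw [hs₁.parent _ hu _ hlu, hs₁.dist _ hu _ hlu, hg.closest.dist _ hu _ hlt]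
      set x := g.W (g.ev i) (g.eu i) + g.δ (g.eu i) (g.L (g.eu i) p) with hx
      refine ⟨fun hx6 => ?_, fun hx6 => ?_⟩
      · set σ₂ := (((((σ₁.setInt 31 0 p).setInt 29 0 (g.L (g.eu i) p)).setLen 6 (g.ev i) x).setInt
          16 (g.ev i) (g.L (g.eu i) p)).setInt 17 (g.ev i) (g.P (g.eu i) (g.L (g.eu i) p))).setInt
            22 0 (i + 1) with hσ₂
        have c11 : σ₂.int 11 = σ₁.int 11 := by simp [hσ₂]
        have s2 : g.pointerSum σ₂ = g.pointerSum σ₁ := by simp only [pointerSum, c11]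
        have c6 : ∀ v, σ₂.len 6 v = if v = g.ev i then x else σ'.len 6 v := by
          intro v
          simp [hσ₂, f6]
        have c16 : ∀ v, σ₂.int 16 v = if v = g.ev i then g.L (g.eu i) p else σ'.int 16 v := by
          intro v
          simp [hσ₂, f16]
        have c17 : ∀ v, σ₂.int 17 v =
            if v = g.ev i then g.P (g.eu i) (g.L (g.eu i) p) else σ'.int 17 v := by
          intro v
          simp [hσ₂, f17]
        have hle : ∀ v, σ₂.len 6 v ≤ σ'.len 6 v := by
          intro v
          rw [c6]
          split_ifs with h
          · rw [h, ← f6]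
            exact hx6.le
          · exact le_rfl
        refine ⟨by omega, hI.of_candidate ?_ ⟨?_, ?_⟩ ?_ ?_ ?_ hle ⟨p, hlt, p5, ?_⟩⟩
        · simpa only [Pointers, c11] using hp₁
        · intro v hv' hfin
          rw [c6, c16, c17]
          rw [c6] at hfin
          split_ifs with h
          · rw [h]
            exact hcand
          · rw [if_neg h] at hfin
            exact hI.candidates.candidate v hv' hfin
        · exact fun v hv' z hz hvz => (hle v).trans (hI.candidates.direct v hv' z hz hvz)
        · simp [hσ₂, f12]
        · simp [hσ₂, f13]
        · simp [hσ₂, f4]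
        · rw [c6, if_pos rfl]
      · set σ₂ := ((σ₁.setInt 31 0 p).setInt 29 0 (g.L (g.eu i) p)).setInt 22 0 (i + 1) with hσ₂
        have c11 : σ₂.int 11 = σ₁.int 11 := by simp [hσ₂]
        have s2 : g.pointerSum σ₂ = g.pointerSum σ₁ := by simp only [pointerSum, c11]
        have c6 : σ₂.len 6 = σ'.len 6 := by simp [hσ₂, f6]
        have c16 : σ₂.int 16 = σ'.int 16 := by simp [hσ₂, f16]
        have c17 : σ₂.int 17 = σ'.int 17 := by simp [hσ₂, f17]
        refine ⟨by omega, hI.of_candidate ?_ ⟨?_, ?_⟩ ?_ ?_ ?_ (fun v => by rw [c6])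
          ⟨p, hlt, p5, ?_⟩⟩
        · simpa only [Pointers, c11] using hp₁
        · simpa only [c6, c16, c17] using hI.candidates.candidate
        · simpa only [c6] using hI.candidates.direct
        · simp [hσ₂, f12]
        · simp [hσ₂, f13]
        · simp [hσ₂, f4]
        · rw [c6, ← f6]
          exact hx6
    -- The pointer has passed the entire list of the head, so every entry is old for the tail; the
    -- lists agree and the reversed edge enters the auxiliary graph.
    · have hpk : p = g.k := by omega
      set σ₂ := (((((σ₁.setInt 31 0 p).setInt 12 q (g.eu i)).setInt 13 q (g.ev i)).setLen 4 q
        (g.W (g.ev i) (g.eu i))).setInt 24 0 (q + 1)).setInt 22 0 (i + 1) with hσ₂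
      have c11 : σ₂.int 11 = σ₁.int 11 := by simp [hσ₂]
      have s2 : g.pointerSum σ₂ = g.pointerSum σ₁ := by simp only [pointerSum, c11]
      refine ⟨by omega, hI.of_arc hg him' ?_ ?_ ?_ ?_ (fun e he => ?_) ?_ (hpk ▸ p5)⟩
      · simpa only [Pointers, c11] using hp₁
      · simp [hσ₂, f6]
      · simp [hσ₂, f16]
      · simp [hσ₂, f17]
      · simp [hσ₂, f12, f13, f4, he.ne]
      · simp [hσ₂]
  · rintro σ' τ hb hf ⟨hi, hτ, hI⟩
    exact ⟨by omega, hI⟩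

end RAM

/-! ### Basic properties of distances in a digraph. -/

namespace WDigraph

variable {n : ℕ} {G : WDigraph n}

theorem IsWalk.append {s u t : Fin n} {p q : List (Fin n × Fin n × ℝ≥0)} (hp : G.IsWalk u s p)
    (hq : G.IsWalk t u q) : G.IsWalk t s (p ++ q) := by
  induction p generalizing s with
  | nil =>
    obtain rfl : s = u := hp
    exact hq
  | cons e p ih => exact ⟨hp.1, hp.2.1, ih hp.2.2⟩

theorem pathLength_append (p q : List (Fin n × Fin n × ℝ≥0)) :
    pathLength (p ++ q) = pathLength p + pathLength q := by
  simp [pathLength]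

theorem dist_le_of_isWalk {s t : Fin n} {p : List (Fin n × Fin n × ℝ≥0)} (hp : G.IsWalk t s p) :
    G.dist s t ≤ pathLength p :=
  iInf₂_le p hp

theorem dist_self (s : Fin n) : G.dist s s = 0 :=
  le_antisymm ((dist_le_of_isWalk (p := []) rfl).trans (by simp [pathLength])) (zero_le)

theorem dist_triangle (s u t : Fin n) : G.dist s t ≤ G.dist s u + G.dist u t := by
  rw [dist, dist, dist, ENNReal.iInf_add]
  refine le_iInf fun p => ?_
  rw [ENNReal.iInf_add]
  refine le_iInf fun hp => ?_
  rw [ENNReal.add_iInf]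
  refine le_iInf fun q => ?_
  rw [ENNReal.add_iInf]
  refine le_iInf fun hq => ?_
  refine (dist_le_of_isWalk (hp.append hq)).trans ?_
  rw [pathLength_append]
  push_cast
  exact le_rfl

theorem dist_edge {u v : Fin n} {w : ℝ≥0} (h : (u, v, w) ∈ G.edges) : G.dist u v ≤ w := by
  refine (dist_le_of_isWalk (p := [(u, v, w)]) ⟨h, rfl, rfl⟩).trans ?_
  simp [pathLength]

end WDigraph

/-! ### The auxiliary graph and the call of the algorithm. -/

namespace RAM

variable {ψ : SSSPAlgorithm} {M B : ℕ}

open Knowledge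

/-- Connect the source of the auxiliary graph with all vertices that have a candidate. -/
def addSources : Cmd :=
  .while (.intLT (var 21) vertices)
    (.seq (.ite (.lenLT (.get 6 (var 21)) .infinity)
        (.seq (.setInt 12 (var 24) vertices)
          (.seq (.setInt 13 (var 24) (var 21))
            (.seq (.setLen 4 (var 24) (.get 6 (var 21)))
              (.setInt 24 (.const 0) (.add (var 24) (.const 1))))))
        .skip)
      (.setInt 21 (.const 0) (.add (var 21) (.const 1))))

namespace Knowledge

/-- The auxiliary graph with `q` edges contains the edges from the source to the first `i`
vertices. -/
structure Built (g : Knowledge) (i q : ℕ) (σ : State) : Prop where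
  le : q ≤ g.ec + i
  pointers : g.Pointers σ
  candidates : g.Candidates σ
  source : ∀ v < i, σ.len 6 v ≠ ∞ → Arc σ q g.n v (σ.len 6 v)
  complete : ∀ j < g.ec,
    ((∀ s < g.k, Listed g.k g.L (g.ev j) (g.L (g.eu j) s)) ∧
      Arc σ q (g.eu j) (g.ev j) (g.W (g.ev j) (g.eu j))) ∨
    ∃ p < g.k, (∀ s < p, Listed g.k g.L (g.ev j) (g.L (g.eu j) s)) ∧
      σ.len 6 (g.ev j) ≤ g.W (g.ev j) (g.eu j) + g.δ (g.eu j) (g.L (g.eu j) p)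
  sound : ∀ e < q, (∃ j < g.ec, σ.int 12 e = g.eu j ∧ σ.int 13 e = g.ev j ∧
      σ.len 4 e = g.W (g.ev j) (g.eu j) ∧ ∀ s < g.k, Listed g.k g.L (g.ev j) (g.L (g.eu j) s)) ∨
    (σ.int 12 e = g.n ∧ σ.int 13 e < i ∧ σ.len 4 e = σ.len 6 (σ.int 13 e) ∧ σ.len 4 e ≠ ∞)
  inj : ∀ e < q, ∀ e' < q, σ.int 12 e = σ.int 12 e' → σ.int 13 e = σ.int 13 e' → e = e'

variable {g : Knowledge} {σ σ' : State} {i q : ℕ}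

theorem Built.congr (h : g.Built i q σ) (hI : ∀ a ∈ [11, 12, 13, 16, 17], σ'.int a = σ.int a)
    (hL : ∀ a ∈ [4, 6], σ'.len a = σ.len a) : g.Built i q σ' := by
  have h11 := hI 11 (by decide)
  have h12 := hI 12 (by decide)
  have h13 := hI 13 (by decide)
  have h16 := hI 16 (by decide)
  have h17 := hI 17 (by decide)
  have h4 := hL 4 (by decide)
  have h6 := hL 6 (by decide)
  obtain ⟨a1, a2, ⟨a3, a3'⟩, a4, a5, a6, a7⟩ := h
  refine ⟨a1, ?_, ⟨?_, ?_⟩, ?_, ?_, ?_, ?_⟩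
  · simpa only [Pointers, h11] using a2
  · simpa only [h6, h16, h17] using a3
  · simpa only [h6] using a3'
  · simpa only [Arc, h6, h4, h12, h13] using a4
  · simpa only [Arc, h6, h4, h12, h13] using a5
  · simpa only [h6, h4, h12, h13] using a6
  · simpa only [h12, h13] using a7

/-- Edge lengths passed to ψ must be finite, so a vertex without a candidate gets no edge from the
source. -/
theorem Built.skip (h : g.Built i q σ) (hi : σ.len 6 i = ∞) : g.Built (i + 1) q σ := by
  refine ⟨h.le.trans (by omega), h.pointers, h.candidates, fun v hv hfin => ?_, h.complete,
    fun e he => (h.sound e he).imp_right ?_, h.inj⟩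
  · rcases Nat.lt_succ_iff_lt_or_eq.1 hv with hv | rfl
    · exact h.source v hv hfin
    · exact absurd hi hfin
  · rintro ⟨h1, h2, h3⟩
    exact ⟨h1, by omega, h3⟩

theorem Built.add (h : g.Built i q σ) (hg : g.Valid) (hi : σ.len 6 i ≠ ∞)
    (hI : ∀ a ∈ [11, 16, 17], σ'.int a = σ.int a) (h6 : σ'.len 6 = σ.len 6)
    (hold : ∀ e < q, σ'.int 12 e = σ.int 12 e ∧ σ'.int 13 e = σ.int 13 e ∧
      σ'.len 4 e = σ.len 4 e)
    (hnew : σ'.int 12 q = g.n ∧ σ'.int 13 q = i ∧ σ'.len 4 q = σ.len 6 i) :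
    g.Built (i + 1) (q + 1) σ' := by
  have h11 := hI 11 (by decide)
  have h16 := hI 16 (by decide)
  have h17 := hI 17 (by decide)
  have harc : ∀ a b x, Arc σ q a b x → Arc σ' (q + 1) a b x := by
    rintro a b x ⟨e, he, h'⟩
    refine ⟨e, by omega, ?_⟩
    rwa [(hold e he).1, (hold e he).2.1, (hold e he).2.2]
  refine ⟨by have := h.le; omega, ?_, ⟨?_, ?_⟩, fun v hv hfin => ?_, fun j hj => ?_,
    fun e he => ?_, ?_⟩
  · simpa only [Pointers, h11] using h.pointers
  · simpa only [h6, h16, h17] using h.candidates.candidate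
  · simpa only [h6] using h.candidates.direct
  · rw [h6] at hfin ⊢
    rcases Nat.lt_succ_iff_lt_or_eq.1 hv with hv | rfl
    · exact harc _ _ _ (h.source v hv hfin)
    · exact ⟨q, by omega, hnew⟩
  · rw [h6]
    exact (h.complete j hj).imp_left fun ⟨h1, h2⟩ => ⟨h1, harc _ _ _ h2⟩
  · rcases Nat.lt_succ_iff_lt_or_eq.1 he with he | rfl
    · rw [(hold e he).1, (hold e he).2.1, (hold e he).2.2, h6]
      refine (h.sound e he).imp_right ?_
      rintro ⟨h1, h2, h3⟩
      exact ⟨h1, by omega, h3⟩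
    · rw [hnew.1, hnew.2.1, hnew.2.2, h6]
      exact .inr ⟨rfl, by omega, rfl, hi⟩
  -- Reversed known edges start at vertices below n, and earlier edges from the source end at
  -- vertices below i.
  · have key : ∀ e < q, σ.int 12 e = g.n → σ.int 13 e = i → False := by
      intro e he h1 h2
      rcases h.sound e he with ⟨j, hj, h3, -⟩ | ⟨-, h3, -⟩
      · have := (hg.edge hj).2.1
        omega
      · omega
    intro e he e' he' h1 h2
    rcases Nat.lt_succ_iff_lt_or_eq.1 he with he | rfl
    · rcases Nat.lt_succ_iff_lt_or_eq.1 he' with he' | rfl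
      · rw [(hold e he).1, (hold e' he').1] at h1
        rw [(hold e he).2.1, (hold e' he').2.1] at h2
        exact h.inj e he e' he' h1 h2
      · rw [(hold e he).1, hnew.1] at h1
        rw [(hold e he).2.1, hnew.2.1] at h2
        exact (key e he h1 h2).elim
    · rcases Nat.lt_succ_iff_lt_or_eq.1 he' with he' | rfl
      · rw [(hold e' he').1, hnew.1] at h1
        rw [(hold e' he').2.1, hnew.2.1] at h2
        exact (key e' he' h1.symm h2.symm).elim
      · rfl

end Knowledge

theorem addSources_spec {σ : State} {g : Knowledge} (hσ : Bdd M σ) (hg : g.Valid)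
    (hn : σ.int 0 0 = g.n) (hM : g.n * (g.n + g.n) + (g.n + g.n) + 2 ≤ M)
    (h21 : σ.int 21 0 = 0) (h : g.Scanned g.ec (σ.int 24 0) σ) :
    Ex ψ M B addSources σ fun σ' τ => τ ≤ 7 * g.n + 1 ∧ g.Built g.n (σ'.int 24 0) σ' := by
  refine Ex.count (fun i σ' τ => σ'.int 21 0 = i ∧ τ ≤ 7 * i ∧ g.Built i (σ'.int 24 0) σ')
      g.n 0 hσ (Nat.zero_le _) ⟨h21, by simp, ?_⟩ ?_ ?_
  · exact ⟨h.le, h.pointers, h.candidates, by simp, h.complete, fun e he => .inl (h.sound e he),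
      h.inj⟩
  · rintro i σ' τ hb hf ⟨hi, hτ, hI⟩ him
    have e0 : σ'.int 0 0 = g.n := by rw [hf.1 0 (by decide), hn]
    have hnn : g.n * g.n + g.n * g.n = g.n * (g.n + g.n) := by ring
    have hec := hg.ec_le.trans g.star_le
    have hle := hI.le
    have m0 : 0 < M := by omega
    refine ⟨by simp [m0], by simp [hi, e0], fun hlt => ?_⟩
    have m1 : 1 < M := by omega
    have m2 : i + 1 < M := by omega
    set q := σ'.int 24 0 with hqdef
    have m3 : q + 1 < M := by
      have : 2 * g.n ≤ g.n * g.n := Nat.mul_le_mul_right _ hg.two_le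
      omega
    simp [hi, e0, ← hqdef, m0, m1, m2, m3]
    refine ⟨fun hfin => ⟨by omega, ?_⟩, fun hfin => ⟨by omega, ?_⟩⟩
    · refine hI.add hg hfin.ne (by simp) (by simp) (fun e he => ?_) ?_
      · simp [he.ne]
      · simp
    · exact (hI.skip hfin).congr (by simp) (by simp)
  · rintro σ' τ hb hf ⟨hi, hτ, hI⟩
    exact ⟨by omega, hI⟩

/-- The graph with `q` edges that is stored in the arrays. -/
theorem exists_stored_graph {σ : State} {N q : ℕ}
    (hlt : ∀ e < q, σ.int 12 e < N ∧ σ.int 13 e < N ∧ σ.len 4 e ≠ ∞)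
    (hinj : ∀ e < q, ∀ e' < q, σ.int 12 e = σ.int 12 e' → σ.int 13 e = σ.int 13 e' → e = e') :
    ∃ H : WDigraph N, H.size = q ∧ σ.Stores 12 13 4 H ∧
      ∀ (a b : Fin N) (w : ℝ≥0), (a, b, w) ∈ H.edges ↔ Arc σ q a b w := by
  let f : Fin q → Fin N × Fin N × ℝ≥0 := fun e =>
    (⟨σ.int 12 e, (hlt e e.2).1⟩, ⟨σ.int 13 e, (hlt e e.2).2.1⟩, (σ.len 4 e).toNNReal)
  refine ⟨⟨List.ofFn f, ?_⟩, ?_, ?_, ?_⟩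
  · rw [List.map_ofFn, List.nodup_ofFn]
    intro e e' h
    simp only [f, Function.comp, Prod.mk.injEq, Fin.mk.injEq] at h
    exact Fin.ext (hinj e e.2 e' e'.2 h.1 h.2)
  · simp [WDigraph.size]
  · rintro ⟨j, hj⟩
    simp only [List.length_ofFn] at hj
    simp [f, ENNReal.coe_toNNReal (hlt j hj).2.2]
  · intro a b w
    simp only [List.mem_ofFn, f, Prod.mk.injEq, Fin.ext_iff, Arc]
    constructor
    · rintro ⟨e, h1, h2, rfl⟩
      exact ⟨e, e.2, h1, h2, (ENNReal.coe_toNNReal (hlt e e.2).2.2).symm⟩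
    · rintro ⟨e, he, h1, h2, h3⟩
      exact ⟨⟨e, he⟩, h1, h2, by simp [h3]⟩

/-- `Root p n v r h`: following the parents `p` from `v`, after `h` steps one comes to `r`, whose
parent is `n`. -/
inductive Root (p : ℕ → ℕ) (n : ℕ) : ℕ → ℕ → ℕ → Prop where
  | base (v : ℕ) : p v = n → Root p n v v 0
  | step (v r h : ℕ) : p v ≠ n → Root p n (p v) r h → Root p n v r (h + 1)

/-- Call the algorithm on the auxiliary graph with `n + 1` vertices. -/
def callAlgorithm : Cmd :=
  .call (.add vertices (.const 1)) (var 24) vertices 12 13 4 5 14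

/-- What later steps need from ψ is that no arc is violated, that the arc from the parent is tight,
and that tracing parents leads to the source n, the last vertex of the auxiliary graph. The additive
cost n + q + 2 is the charge for n + 1 vertices, q edges and the call. -/
theorem callAlgorithm_spec {T S : ℕ → ℕ → ℕ} {σ : State} {n q : ℕ} (hσ : Bdd M σ) (hM : n + 1 < M)
    (hn : σ.int 0 0 = n) (hq : σ.int 24 0 = q) (hT : ψ.TimeBound T) (hS : ψ.SpaceBound S)
    (hB : S q (n + 1) ≤ B)
    (hlt : ∀ e < q, σ.int 12 e < n + 1 ∧ σ.int 13 e < n + 1 ∧ σ.len 4 e ≠ ∞)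
    (hinj : ∀ e < q, ∀ e' < q, σ.int 12 e = σ.int 12 e' → σ.int 13 e = σ.int 13 e' → e = e') :
    Ex ψ M B callAlgorithm σ fun σ' τ => τ ≤ T q (n + 1) + n + q + 2 ∧ σ'.len 5 n = 0 ∧
      (∀ v < n, σ'.int 14 v ≤ n) ∧
      (∀ a b x, Arc σ q a b x → σ'.len 5 b ≤ σ'.len 5 a + x) ∧
      ∀ v < n, σ'.len 5 v ≠ ∞ →
        (∃ x, Arc σ q (σ'.int 14 v) v x ∧ σ'.len 5 v = σ'.len 5 (σ'.int 14 v) + x) ∧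
        ∃ r h, Root (σ'.int 14) n v r h := by
  obtain ⟨H, hsize, hst, hmem⟩ := exists_stored_graph hlt hinj
  have hs := ψ.correct H (Fin.last n)
  have m0 : 0 < M := by omega
  have e1 := (IExp.eval_of_ok hσ (e := .add vertices (.const 1))
    (by simp [m0, hn, hM]; omega)).1
  have e2 := (IExp.eval_of_ok hσ (e := var 24) (by simp [m0])).1
  have e3 := (IExp.eval_of_ok hσ (e := vertices) (by simp [m0])).1
  simp only [IExp.val, var, vertices, hn, hq] at e1 e2 e3
  refine ⟨_, _, _, .call σ _ _ _ 12 13 4 5 14 (n + 1) H (Fin.last n) e1 (by rw [hsize]; exact e2)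
    (by simpa using e3) (by omega) (by omega) (by omega) (by omega) (by omega) hst,
    (hS _ _).trans (by rw [hsize]; exact hB), ?_⟩
  set σ' := σ.writeResult 5 14 (ψ.dist H (Fin.last n)) (ψ.parent H (Fin.last n)) with hσ'
  have hd : ∀ v : Fin (n + 1), σ'.len 5 v = ψ.dist H (Fin.last n) v := by
    intro v
    simp only [hσ', State.writeResult, dif_pos v.2, if_true]
  have hp : ∀ v : Fin (n + 1), σ'.int 14 v = ψ.parent H (Fin.last n) v := by
    intro v
    simp only [hσ', State.writeResult, dif_pos v.2, if_true]
  -- The iterates of the parent map from v reach the source; the vertex just before the first visit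
  -- to it is the root.
  have hroot : ∀ (j : ℕ) (v : Fin (n + 1)), v ≠ Fin.last n →
      (ψ.parent H (Fin.last n))^[j] v = Fin.last n → ∃ r h, Root (σ'.int 14) n v r h := by
    intro j
    induction j with
    | zero => exact fun v hv h => absurd h hv
    | succ j ih =>
      intro v hv h
      by_cases hpv : ψ.parent H (Fin.last n) v = Fin.last n
      · exact ⟨v, 0, .base _ (by rw [hp, hpv]; rfl)⟩
      · obtain ⟨r, h', hr⟩ := ih _ hpv (by simpa using h)
        refine ⟨r, h' + 1, .step _ _ _ ?_ ?_⟩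
        · rw [hp]
          exact fun h'' => hpv (Fin.ext h'')
        · rw [hp]
          exact hr
  refine ⟨?_, ?_, ?_, ?_, ?_⟩
  · have := hT H (Fin.last n)
    rw [hsize] at this ⊢
    omega
  · have := hd (Fin.last n)
    rw [hs.dist_eq, WDigraph.dist_self] at this
    simpa using this
  · intro v hv
    have := hp ⟨v, by omega⟩
    simp only at this
    rw [this]
    exact Nat.lt_succ_iff.1 (Fin.isLt _)
  · rintro a b x ⟨e, he, rfl, rfl, rfl⟩
    obtain ⟨h1, h2, h3⟩ := hlt e he
    have hedge := (hmem ⟨_, h1⟩ ⟨_, h2⟩ (σ.len 4 e).toNNReal).2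
      ⟨e, he, rfl, rfl, (ENNReal.coe_toNNReal h3).symm⟩
    have g1 := hd ⟨_, h1⟩
    have g2 := hd ⟨_, h2⟩
    simp only at g1 g2
    rw [g1, g2, hs.dist_eq, hs.dist_eq]
    refine (WDigraph.dist_triangle _ _ _).trans (add_le_add le_rfl ?_)
    exact (WDigraph.dist_edge hedge).trans (by rw [ENNReal.coe_toNNReal h3])
  · intro v hv hfin
    have g1 := hd ⟨v, by omega⟩
    have g2 := hp ⟨v, by omega⟩
    simp only at g1 g2
    have hne : (⟨v, by omega⟩ : Fin (n + 1)) ≠ Fin.last n := by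
      intro h
      have := congrArg Fin.val h
      simp at this
      omega
    rw [g1] at hfin
    constructor
    · obtain ⟨w, hw, hdw⟩ := hs.parent_edge ⟨v, by omega⟩ hne hfin
      refine ⟨w, ?_, ?_⟩
      · rw [g2]
        exact (hmem _ _ _).1 hw
      · rw [g2, hd, g1]
        exact hdw
    · obtain ⟨j, hj⟩ := hs.reaches_source ⟨v, by omega⟩ hfin
      exact hroot j _ hne hj

end RAM

/-! ### Roots in the shortest path tree, found in linear time. -/

namespace RAM

variable {ψ : SSSPAlgorithm} {M B : ℕ}

open Knowledge

theorem Root.parent_eq {p : ℕ → ℕ} {n v r h : ℕ} (hr : Root p n v r h) : p r = n := by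
  induction hr with
  | base v hv => exact hv
  | step v r h _ _ ih => exact ih

theorem Root.unique {p : ℕ → ℕ} {n v r h r' h' : ℕ} (hr : Root p n v r h)
    (hr' : Root p n v r' h') : r = r' ∧ h = h' := by
  induction hr generalizing h' with
  | base v hv =>
    cases hr' with
    | base => exact ⟨rfl, rfl⟩
    | step _ _ _ h' => exact absurd hv h'
  | step v r h hv _ ih =>
    cases hr' with
    | base _ h' => exact absurd h' hv
    | step _ _ _ _ h' =>
      obtain ⟨h1, h2⟩ := ih h'
      exact ⟨h1, by rw [h2]⟩

/-- Mark the vertices whose parent is the source as their own roots. -/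
def findRoots : Cmd :=
  .while (.intLT (var 21) vertices)
    (.seq (.ite (.intEq (.get 14 (var 21)) vertices) (.setInt 15 (var 21) (var 21))
        (.setInt 15 (var 21) vertices))
      (.setInt 21 (.const 0) (.add (var 21) (.const 1))))

theorem findRoots_spec {σ : State} {n : ℕ} (hσ : Bdd M σ) (hM : n + 1 < M)
    (hn : σ.int 0 0 = n) (h21 : σ.int 21 0 = 0) :
    Ex ψ M B findRoots σ fun σ' τ => τ ≤ 4 * n + 1 ∧
      ∀ v < n, σ'.int 15 v = if σ.int 14 v = n then v else n := by
  refine Ex.count (fun i σ' τ => σ'.int 21 0 = i ∧ τ ≤ 4 * i ∧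
      ∀ v < i, σ'.int 15 v = if σ.int 14 v = n then v else n) n 0 hσ (Nat.zero_le _)
      ⟨h21, by simp, by simp⟩ ?_ ?_
  · rintro i σ' τ hb hf ⟨hi, hτ, hI⟩ him
    have e0 : σ'.int 0 0 = n := by rw [hf.1 0 (by decide), hn]
    have e14 : σ'.int 14 = σ.int 14 := hf.1 14 (by decide)
    have m0 : 0 < M := by omega
    refine ⟨by simp [m0], by simp [hi, e0], fun hlt => ?_⟩
    have m1 : 1 < M := by omega
    have m2 : i + 1 < M := by omega
    simp [hi, e0, e14, m0, m1, m2]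
    refine ⟨fun h => ⟨by omega, fun v hv => ?_⟩, fun h => ⟨by omega, fun v hv => ?_⟩⟩
    · rcases Nat.lt_or_eq_of_le hv with h' | rfl
      · rw [if_neg h'.ne, hI v h']
      · simp [h]
    · rcases Nat.lt_or_eq_of_le hv with h' | rfl
      · rw [if_neg h'.ne, hI v h']
      · simp [h]
  · rintro σ' τ hb hf ⟨hi, hτ, hI⟩
    exact ⟨by omega, hI⟩

/-- `Chain p n rt x y s`: starting from `x`, the first vertex that has a root is `y`, after `s`
steps. -/
inductive Chain (p : ℕ → ℕ) (n : ℕ) (rt : ℕ → ℕ) : ℕ → ℕ → ℕ → Prop where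
  | base (x : ℕ) : rt x ≠ n → Chain p n rt x x 0
  | step (x y s : ℕ) : rt x = n → p x ≠ n → Chain p n rt (p x) y s → Chain p n rt x y (s + 1)

/-- The vertices whose roots are known have correct roots; the roots themselves are among them. -/
def RootsOK (p : ℕ → ℕ) (n : ℕ) (rt : ℕ → ℕ) : Prop :=
  ∀ v < n, (rt v = n ∧ p v ≠ n) ∨ (rt v < n ∧ ∃ h, Root p n v (rt v) h)

theorem Chain.exists_succ {p : ℕ → ℕ} {n : ℕ} {rt : ℕ → ℕ} {x y s : ℕ}
    (hc : Chain p n rt x y s) (hx : rt x = n) :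
    ∃ k, s = k + 1 ∧ p x ≠ n ∧ Chain p n rt (p x) y k := by
  cases hc with
  | base _ h => exact absurd hx h
  | step _ _ k _ hp h => exact ⟨k, rfl, hp, h⟩

theorem Root.exists_succ {p : ℕ → ℕ} {n v r h : ℕ} (hr : Root p n v r h) (hv : p v ≠ n) :
    ∃ k, h = k + 1 ∧ Root p n (p v) r k := by
  cases hr with
  | base _ h => exact absurd h hv
  | step _ _ k _ h => exact ⟨k, rfl, h⟩

/-- The path from v to its root ends at a vertex whose parent is n, and such a vertex is never open;
so a vertex with an assigned root is met, and uniqueness of roots identifies that root with r. -/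
theorem Chain.exists {p : ℕ → ℕ} {n : ℕ} {rt : ℕ → ℕ} (hp : ∀ v < n, p v ≤ n)
    (hrt : RootsOK p n rt) {v r h : ℕ} (hv : v < n) (hr : Root p n v r h) :
    ∃ y s, Chain p n rt v y s ∧ y < n ∧ rt y = r ∧ r < n := by
  by_cases hvn : rt v = n
  · induction hr with
    | base v hpv =>
      rcases hrt v hv with h' | h'
      · exact absurd hpv h'.2
      · exact absurd hvn h'.1.ne
    | step v r h hpv hr ih =>
      have hlt : p v < n := lt_of_le_of_ne (hp v hv) hpv
      by_cases h' : rt (p v) = n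
      · obtain ⟨y, s, h1, h2⟩ := ih hlt h'
        exact ⟨y, s + 1, .step _ _ _ hvn hpv h1, h2⟩
      · rcases hrt _ hlt with h'' | ⟨h1, h2, h3⟩
        · exact absurd h''.1 h'
        · have := (h3.unique hr).1
          exact ⟨p v, 1, .step _ _ _ hvn hpv (.base _ h'), hlt, this, this ▸ h1⟩
  · rcases hrt v hv with h' | ⟨h1, h2, h3⟩
    · exact absurd h'.1 hvn
    · have := (h3.unique hr).1
      exact ⟨v, 0, .base _ hvn, hv, this, this ▸ h1⟩

/-- Heights decrease along the chain, so x, which is higher than z, does not occur on it. -/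
theorem Chain.update {p : ℕ → ℕ} {n : ℕ} {rt rt' : ℕ → ℕ} {x y z s r h h' : ℕ}
    (hc : Chain p n rt z y s) (hx : Root p n x r h) (hz : Root p n z r h') (hlt : h' < h)
    (hrt : ∀ w, w ≠ x → rt' w = rt w) : Chain p n rt' z y s := by
  induction hc generalizing h' with
  | base z hn =>
    have : z ≠ x := fun e => by
      subst e
      have := (hx.unique hz).2
      omega
    exact .base _ (by rwa [hrt z this])
  | step z y s hn hpz _ ih =>
    have : z ≠ x := fun e => by
      subst e
      have := (hx.unique hz).2
      omega
    refine .step _ _ _ (by rwa [hrt z this]) hpz ?_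
    cases hz with
    | base _ hp => exact absurd hp hpz
    | step _ _ k _ hz' => exact ih hz' (by omega)

/-- The number of vertices without a root. -/
def openRoots (n : ℕ) (rt : ℕ → ℕ) : ℕ := ((Finset.range n).filter fun v => rt v = n).card

theorem openRoots_update {n x r : ℕ} {rt rt' : ℕ → ℕ} (hx : x < n) (hxn : rt x = n) (hr : r < n)
    (hrt : ∀ w, rt' w = if w = x then r else rt w) : openRoots n rt' + 1 = openRoots n rt := by
  have hm : x ∈ (Finset.range n).filter fun v => rt v = n := by simp [hx, hxn]
  rw [openRoots, openRoots, ← Finset.card_erase_add_one hm]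
  congr 2
  ext w
  simp only [Finset.mem_filter, Finset.mem_range, Finset.mem_erase, hrt]
  split_ifs with h
  · simp [h]
    omega
  · simp [h]

/-- Go to the next vertex with a root. -/
def climb : Cmd :=
  .while (.intEq (.get 15 (var 25)) vertices) (.setInt 25 (.const 0) (.get 14 (var 25)))

theorem climb_spec {σ : State} {n y s : ℕ} (hσ : Bdd M σ) (hM : 0 < M) (hn : σ.int 0 0 = n)
    (hc : Chain (σ.int 14) n (σ.int 15) (σ.int 25 0) y s) :
    Ex ψ M B climb σ fun σ' τ => τ ≤ 2 * s + 1 ∧ σ'.int 25 0 = y := by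
  refine Ex.loop (fun j σ' τ => τ + 2 * j ≤ 2 * s ∧
    Chain (σ.int 14) n (σ.int 15) (σ'.int 25 0) y j) s hσ ⟨by omega, hc⟩ ?_
  rintro j σ' τ hb hf ⟨hτ, hI⟩
  have e0 : σ'.int 0 0 = n := by rw [hf.1 0 (by decide), hn]
  have e14 : σ'.int 14 = σ.int 14 := hf.1 14 (by decide)
  have e15 : σ'.int 15 = σ.int 15 := hf.1 15 (by decide)
  refine ⟨by simp [hM], fun hv => ?_, fun hv => ?_⟩
  · simp [e0, e15] at hv
    simp [e14, hM]
    cases hI with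
    | base _ h => exact absurd hv h
    | step _ _ k _ _ h => exact ⟨k, by omega, by omega, h⟩
  · simp [e0, e15] at hv
    cases hI with
    | base _ h => exact ⟨by omega, rfl⟩
    | step _ _ k h => exact absurd h hv

/-- Assign the root `int 26` to all vertices on the way to the next vertex with a root. -/
def assignRoot : Cmd :=
  .while (.intEq (.get 15 (var 25)) vertices)
    (.seq (.setInt 15 (var 25) (var 26)) (.setInt 25 (.const 0) (.get 14 (var 25))))

/-- Each of the s steps closes one open vertex, so the length of the chain equals the decrease of
`openRoots`. -/
theorem assignRoot_spec {σ : State} {n x y r h s : ℕ} (hσ : Bdd M σ) (hM : 0 < M)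
    (hn : σ.int 0 0 = n) (hp : ∀ v < n, σ.int 14 v ≤ n) (hx : x < n) (hrn : r < n)
    (h25 : σ.int 25 0 = x) (h26 : σ.int 26 0 = r)
    (hrt : RootsOK (σ.int 14) n (σ.int 15)) (hr : Root (σ.int 14) n x r h)
    (hc : Chain (σ.int 14) n (σ.int 15) x y s) :
    Ex ψ M B assignRoot σ fun σ' τ => τ ≤ 3 * s + 1 ∧ RootsOK (σ.int 14) n (σ'.int 15) ∧
      openRoots n (σ'.int 15) + s = openRoots n (σ.int 15) ∧
      (∀ z, σ.int 15 z ≠ n → σ'.int 15 z ≠ n) ∧ σ'.int 15 x ≠ n := by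
  refine Ex.loop (fun j σ' τ => τ + 3 * j ≤ 3 * s ∧ RootsOK (σ.int 14) n (σ'.int 15) ∧
      openRoots n (σ'.int 15) + s = openRoots n (σ.int 15) + j ∧
      (∀ z, σ.int 15 z ≠ n → σ'.int 15 z ≠ n) ∧ (σ'.int 15 x ≠ n ∨ σ'.int 25 0 = x) ∧
      σ'.int 25 0 < n ∧ (∃ h, Root (σ.int 14) n (σ'.int 25 0) r h) ∧
      Chain (σ.int 14) n (σ'.int 15) (σ'.int 25 0) y j) s hσ
      ⟨by omega, hrt, rfl, fun _ h => h, .inr h25, by omega, ⟨h, by rwa [h25]⟩,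
        by rwa [h25]⟩ ?_
  rintro j σ' τ hb hf ⟨hτ, hok, hsum, hmono, hxr, hlt, ⟨h', hr'⟩, hc'⟩
  have e0 : σ'.int 0 0 = n := by rw [hf.1 0 (by decide), hn]
  have e14 : σ'.int 14 = σ.int 14 := hf.1 14 (by decide)
  have e26 : σ'.int 26 0 = r := by rw [hf.1 26 (by decide), h26]
  refine ⟨by simp [hM], fun hv => ?_, fun hv => ?_⟩
  · simp [e0] at hv
    set z := σ'.int 25 0 with hz
    simp only [wp, IExp.ok, IExp.val, var]
    simp [e14, hM, e26, ← hz]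
    set σ₁ := σ'.setInt 15 z r with hσ₁
    have c15 : ∀ w, σ₁.int 15 w = if w = z then r else σ'.int 15 w := by
      intro w
      simp [hσ₁]
    obtain ⟨k, rfl, hpz, hc'⟩ := hc'.exists_succ hv
    obtain ⟨h'', rfl, hr''⟩ := hr'.exists_succ hpz
    have hcard := openRoots_update hlt hv hrn c15
    have hpn := hp z hlt
    refine ⟨k, by omega, by omega, ?_, by omega, ?_, ?_, by omega, ⟨h'', hr''⟩, ?_⟩
    · intro v hv'
      rw [c15]
      split_ifs with hvz
      · subst hvz
        exact .inr ⟨hrn, _, .step _ _ _ hpz hr''⟩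
      · exact hok v hv'
    · intro w hw
      split_ifs
      · omega
      · exact hmono w hw
    · rcases hxr with hxr | hxr
      · left
        split_ifs
        · omega
        · exact hxr
      · left
        rw [if_pos hxr.symm]
        omega
    · exact hc'.update (x := z) (.step _ _ _ hpz hr'') hr'' (Nat.lt_succ_self _)
        fun w hw => by rw [c15, if_neg hw]
  · simp [e0] at hv
    cases hc' with
    | base _ h =>
      refine ⟨by omega, hok, by omega, hmono, ?_⟩
      rcases hxr with hxr | hxr
      · exact hxr
      · rwa [← hxr]
    | step _ _ k h => exact absurd h hv

/-- Find the roots of all vertices. -/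
def resolve : Cmd :=
  .while (.intLT (var 21) vertices)
    (.seq (.setInt 25 (.const 0) (var 21))
      (.seq climb
        (.seq (.setInt 26 (.const 0) (.get 15 (var 25)))
          (.seq (.setInt 25 (.const 0) (var 21))
            (.seq assignRoot (.setInt 21 (.const 0) (.add (var 21) (.const 1))))))))

/-- A chain of length s is traversed once to find the root and once to assign it, at cost 2s + 3s.
Since it closes s open vertices, all chains together cost at most 5n, in addition to 7 units per
vertex. -/
theorem resolve_spec {σ : State} {n : ℕ} (hσ : Bdd M σ) (hM : n + 1 < M) (hn : σ.int 0 0 = n)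
    (h21 : σ.int 21 0 = 0) (hp : ∀ v < n, σ.int 14 v ≤ n)
    (hroot : ∀ v < n, ∃ r h, Root (σ.int 14) n v r h)
    (h15 : ∀ v < n, σ.int 15 v = if σ.int 14 v = n then v else n) :
    Ex ψ M B resolve σ fun σ' τ => τ ≤ 12 * n + 1 ∧
      ∀ v < n, σ'.int 15 v < n ∧ ∃ h, Root (σ.int 14) n v (σ'.int 15 v) h := by
  refine Ex.count (fun i σ' τ => σ'.int 21 0 = i ∧ τ + 5 * openRoots n (σ'.int 15) ≤ 7 * i + 5 * n ∧
      RootsOK (σ.int 14) n (σ'.int 15) ∧ ∀ v < i, σ'.int 15 v ≠ n) n 0 hσ (Nat.zero_le _)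
      ⟨h21, ?_, ?_, by simp⟩ ?_ ?_
  · have : openRoots n (σ.int 15) ≤ n := by
      refine (Finset.card_le_card (Finset.filter_subset _ _)).trans ?_
      simp
    omega
  · intro v hv
    rw [h15 v hv]
    split_ifs with h
    · exact .inr ⟨hv, 0, .base _ h⟩
    · exact .inl ⟨rfl, h⟩
  · rintro i σ' τ hb hf ⟨hi, hτ, hok, hI⟩ him
    have e0 : σ'.int 0 0 = n := by rw [hf.1 0 (by decide), hn]
    have e14 : σ'.int 14 = σ.int 14 := hf.1 14 (by decide)
    have m0 : 0 < M := by omega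
    refine ⟨by simp [m0], by simp [hi, e0], fun hlt => ?_⟩
    have m1 : 1 < M := by omega
    have m2 : i + 1 < M := by omega
    obtain ⟨r, h, hr⟩ := hroot i hlt
    obtain ⟨y, s, hc, hy, hyr, hrn⟩ := Chain.exists hp hok hlt hr
    simp [hi, m0]
    have hb₀ : Bdd M (σ'.setInt 25 0 i) := hb.setInt _ _ (by omega)
    refine fun _ => (climb_spec (n := n) (y := y) (s := s) hb₀ m0 ?_ ?_).mono hb₀ ?_
    · simp [e0]
    · simpa [e14] using hc
    rintro σ₁ t₁ hb₁ hf₁ ⟨ht₁, hy₁⟩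
    have f0 : σ₁.int 0 0 = n := by rw [hf₁.1 0 (by decide)]; exact e0
    have f14 : σ₁.int 14 = σ.int 14 := by rw [hf₁.1 14 (by decide), ← e14]; rfl
    have f15 : σ₁.int 15 = σ'.int 15 := by rw [hf₁.1 15 (by decide)]; rfl
    have f21 : σ₁.int 21 0 = i := by rw [hf₁.1 21 (by decide)]; exact hi
    simp [hy₁, f15, hyr, f21]
    set σ₂ := (σ₁.setInt 26 0 r).setInt 25 0 i with hσ₂
    have hb₂ : Bdd M σ₂ := (hb₁.setInt _ _ (by omega)).setInt _ _ (by omega)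
    have c14 : σ₂.int 14 = σ.int 14 := by simp [hσ₂, f14]
    have c15 : σ₂.int 15 = σ'.int 15 := by simp [hσ₂, f15]
    refine fun _ => (assignRoot_spec (n := n) (x := i) (y := y) (r := r) (h := h) (s := s) hb₂ m0
      ?_ ?_ hlt hrn ?_ ?_ ?_ ?_ ?_).mono hb₂ ?_
    · simp [hσ₂, f0]
    · rwa [c14]
    · simp [hσ₂]
    · simp [hσ₂]
    · rwa [c14, c15]
    · rwa [c14]
    · rwa [c14, c15]
    rintro σ₃ t₃ hb₃ hf₃ ⟨ht₃, hok₃, hsum₃, hmono₃, hx₃⟩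
    rw [c15] at hsum₃ hmono₃
    rw [c14] at hok₃
    have g21 : σ₃.int 21 0 = i := by
      rw [hf₃.1 21 (by decide)]
      simp [hσ₂, f21]
    simp [g21, m1, m2]
    refine ⟨by omega, hok₃, fun v hv => ?_⟩
    rcases Nat.lt_or_eq_of_le hv with h | rfl
    · exact hmono₃ v (hI v h)
    · exact hx₃
  · rintro σ' τ hb hf ⟨hi, hτ, hok, hI⟩
    refine ⟨by omega, fun v hv => ?_⟩
    rcases hok v hv with h | h
    · exact absurd h.1 (hI v hv)
    · exact h

end RAM

/-! ### Appending the new targets and recording new edges. -/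

namespace RAM

variable {ψ : SSSPAlgorithm} {M B : ℕ}

open Knowledge

/-- Arcs between vertices are reversed known edges, so tracing parents from v follows known edges
forwards, always between vertices with equal lists. The final arc, from the source to the root,
contributes the candidate of the root. -/
theorem Knowledge.Built.root_walk {g : Knowledge} {q : ℕ} {σ : State} {hd : ℕ → ℝ≥0∞} {p : ℕ → ℕ}
    (hb : g.Built g.n q σ) (hg : g.Valid) (h0 : hd g.n = 0)
    (htree : ∀ v < g.n, hd v ≠ ∞ → ∃ x, Arc σ q (p v) v x ∧ hd v = hd (p v) + x) {v r h : ℕ}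
    (hr : Root p g.n v r h) (hv : v < g.n) (hfin : hd v ≠ ∞) :
    r < g.n ∧ (∀ x, Listed g.k g.L r x ↔ Listed g.k g.L v x) ∧
      ∃ d, EdgeWalk g.W g.E v r d ∧ hd v = d + σ.len 6 r := by
  induction hr with
  | base v hp =>
    refine ⟨hv, fun _ => Iff.rfl, 0, .nil v, ?_⟩
    obtain ⟨x, ⟨e, he, h1, h2, h3⟩, h4⟩ := htree v hv hfin
    rw [h4, hp, h0]
    rcases hb.sound e he with ⟨j, hj, h5, -⟩ | ⟨-, -, h5, -⟩
    · have := (hg.edge hj).2.1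
      omega
    · rw [← h3, h5, h2]
  | step v r h hp hr ih =>
    obtain ⟨x, ⟨e, he, h1, h2, h3⟩, h4⟩ := htree v hv hfin
    rcases hb.sound e he with ⟨j, hj, h5, h6, h7, h8⟩ | ⟨h5, -⟩
    · obtain ⟨-, hu, -⟩ := hg.edge hj
      rw [← h5, h1] at hu h7 h8
      rw [← h6, h2] at h7 h8
      rw [h3] at h7
      have hfin' : hd (p v) ≠ ∞ := by
        intro h
        rw [h4, h] at hfin
        simp at hfin
      obtain ⟨i1, i2, d, i3, i4⟩ := ih hu hfin'
      have hE : g.E v (p v) := ⟨j, hj, by omega, by omega⟩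
      refine ⟨i1, fun x => (i2 x).trans (hg.closest.listed_iff_of_subset hu hv h8 x), _,
        .cons _ _ _ _ hE i3, ?_⟩
      rw [h4, i4, h7, add_comm, add_assoc]
    · exact absurd (h1.symm.trans h5) hp

/-- Record that the edge from `int 21` to `int 29` is a shortest path. -/
def recordEdge : Cmd :=
  .seq (.setInt 9 (var 23) (var 21))
    (.seq (.setInt 10 (var 23) (var 29))
      (.seq (.setLen 3 (var 23)
          (.get 2 (.add (.mul (var 21) (.add vertices vertices)) (.add vertices (var 29)))))
        (.seq (.setInt 11 (var 23) (.const 0))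
          (.setInt 23 (.const 0) (.add (var 23) (.const 1))))))

/-- Append the target of its root to the list of `int 21`. -/
def enterTarget : Cmd :=
  .seq (.setInt 29 (.const 0) (.get 16 (.get 15 (var 21))))
    (.seq (.setInt 31 (.const 0) (.get 17 (.get 15 (var 21))))
      (.seq (.setInt 5 (.add (.mul (var 21) vertices) (var 20)) (var 29))
        (.seq (.setInt 6 (.add (.mul (var 21) vertices) (var 29)) (.const 1))
          (.seq (.setInt 3 (.add (.mul (var 21) vertices) (var 29)) (var 31))
            (.seq (.setLen 1 (.add (.mul (var 21) vertices) (var 29)) (.get 5 (var 21)))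
              (.ite (.intEq (var 31) (var 21)) recordEdge .skip))))))

/-- Delete the leaf `int 29` from the tree of `int 21`, if its key is finite. -/
def deleteTarget : Cmd :=
  .ite (.lenLT (.get 2 (.add (.mul (var 21) (.add vertices vertices))
      (.add vertices (var 29)))) .infinity) (updateLeaf .infinity) .skip

/-- Append the target of its root to the list of every vertex. -/
def appendTargets : Cmd :=
  .while (.intLT (var 21) vertices)
    (.seq enterTarget (.seq deleteTarget (.setInt 21 (.const 0) (.add (var 21) (.const 1)))))

namespace Knowledge

/-- The new targets `t v` with their distances `d v` and parents `p v` have been entered for the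
first `i` vertices. -/
structure ListsAppended (g : Knowledge) (t p : ℕ → ℕ) (d : ℕ → ℝ≥0∞) (i : ℕ) (σ : State) :
    Prop where
  list_lt : ∀ j < g.n * g.n, σ.int 5 j < g.n
  old : ∀ v < g.n, ∀ j < g.k, σ.int 5 (v * g.n + j) = g.L v j
  new : ∀ v < i, σ.int 5 (v * g.n + g.k) = t v
  mark : ∀ v < g.n, ∀ x < g.n,
    (σ.int 6 (v * g.n + x) = 1 ↔ Listed g.k g.L v x ∨ v < i ∧ x = t v)
  parent : ∀ v < g.n, ∀ x < g.n,
    σ.int 3 (v * g.n + x) = if v < i ∧ x = t v then p v else g.P v x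
  dist : ∀ v < g.n, ∀ x < g.n,
    σ.len 1 (v * g.n + x) = if v < i ∧ x = t v then d v else g.D v x

/-- The new edges of the first `i` vertices have been recorded. -/
structure EdgesAppended (g : Knowledge) (t p : ℕ → ℕ) (ptr : ℕ → ℕ) (i : ℕ) (σ : State) :
    Prop where
  le : g.ec ≤ σ.int 23 0
  le_add : σ.int 23 0 ≤ g.ec + i
  old : ∀ e < g.ec, σ.int 9 e = g.ev e ∧ σ.int 10 e = g.eu e ∧ σ.int 11 e = ptr e
  new : ∀ e < σ.int 23 0, g.ec ≤ e → σ.int 9 e < i ∧ σ.int 10 e = t (σ.int 9 e) ∧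
    p (σ.int 9 e) = σ.int 9 e ∧ σ.int 11 e = 0
  complete : ∀ v < i, p v = v → ∃ e < σ.int 23 0, σ.int 9 e = v ∧ σ.int 10 e = t v
  inj : ∀ e < σ.int 23 0, ∀ e' < σ.int 23 0, σ.int 9 e = σ.int 9 e' → σ.int 10 e = σ.int 10 e' →
    e = e'
  len : ∀ e < σ.int 23 0, σ.len 3 e = g.W (σ.int 9 e) (σ.int 10 e)

variable {g : Knowledge} {t p ptr : ℕ → ℕ} {d : ℕ → ℝ≥0∞} {i : ℕ} {σ σ' : State}

theorem ListsAppended.congr (h : g.ListsAppended t p d i σ)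
    (hI : ∀ a ∈ [5, 6, 3], σ'.int a = σ.int a) (hL : ∀ a ∈ [1], σ'.len a = σ.len a) :
    g.ListsAppended t p d i σ' := by
  have h5 := hI 5 (by decide)
  have h6 := hI 6 (by decide)
  have h3 := hI 3 (by decide)
  have h1 := hL 1 (by decide)
  obtain ⟨a1, a2, a3, a4, a5, a6⟩ := h
  refine ⟨?_, ?_, ?_, ?_, ?_, ?_⟩
  · simpa only [h5] using a1
  · simpa only [h5] using a2
  · simpa only [h5] using a3
  · simpa only [h6] using a4
  · simpa only [h3] using a5
  · simpa only [h1] using a6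

theorem EdgesAppended.congr (h : g.EdgesAppended t p ptr i σ)
    (hI : ∀ a ∈ [9, 10, 11, 23], σ'.int a = σ.int a) (hL : ∀ a ∈ [3], σ'.len a = σ.len a) :
    g.EdgesAppended t p ptr i σ' := by
  have h9 := hI 9 (by decide)
  have h10 := hI 10 (by decide)
  have h11 := hI 11 (by decide)
  have h23 := hI 23 (by decide)
  have h3 := hL 3 (by decide)
  obtain ⟨a1, a2, a3, a4, a5, a6, a7⟩ := h
  refine ⟨?_, ?_, ?_, ?_, ?_, ?_, ?_⟩
  · simpa only [h23] using a1
  · simpa only [h23] using a2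
  · simpa only [h9, h10, h11] using a3
  · simpa only [h9, h10, h11, h23] using a4
  · simpa only [h9, h10, h23] using a5
  · simpa only [h9, h10, h23] using a6
  · simpa only [h9, h10, h23, h3] using a7

theorem ListsAppended.succ (h : g.ListsAppended t p d i σ) (hi : i < g.n) (hk : g.k < g.n)
    (ht : t i < g.n)
    (h5 : ∀ j, σ'.int 5 j = if j = i * g.n + g.k then t i else σ.int 5 j)
    (h6 : ∀ j, σ'.int 6 j = if j = i * g.n + t i then 1 else σ.int 6 j)
    (h3 : ∀ j, σ'.int 3 j = if j = i * g.n + t i then p i else σ.int 3 j)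
    (h1 : ∀ j, σ'.len 1 j = if j = i * g.n + t i then d i else σ.len 1 j) :
    g.ListsAppended t p d (i + 1) σ' := by
  have key : ∀ v x, x < g.n → (v * g.n + x = i * g.n + t i ↔ v = i ∧ x = t i) := by
    intro v x hx
    constructor
    · exact fun h => index_inj hx ht h
    · rintro ⟨rfl, rfl⟩
      rfl
  refine ⟨fun j hj => ?_, fun v hv j hj => ?_, fun v hv => ?_, fun v hv x hx => ?_,
    fun v hv x hx => ?_, fun v hv x hx => ?_⟩
  · rw [h5]
    split_ifs
    · exact ht
    · exact h.list_lt j hj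
  · rw [h5, if_neg, h.old v hv j hj]
    intro e
    have := (index_inj (by omega) hk e).2
    omega
  · rw [h5]
    rcases Nat.lt_succ_iff_lt_or_eq.1 hv with hv | rfl
    · rw [if_neg, h.new v hv]
      intro e
      have := (index_inj hk hk e).1
      omega
    · rw [if_pos rfl]
  · rw [h6]
    by_cases hvx : v = i ∧ x = t i
    · rw [if_pos ((key v x hx).2 hvx)]
      obtain ⟨rfl, rfl⟩ := hvx
      simp
    · rw [if_neg (fun e => hvx ((key v x hx).1 e)), h.mark v hv x hx]
      refine or_congr_right ⟨fun e => ⟨by omega, e.2⟩, fun e => ⟨?_, e.2⟩⟩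
      rcases Nat.lt_succ_iff_lt_or_eq.1 e.1 with h' | rfl
      · exact h'
      · exact absurd ⟨rfl, e.2⟩ hvx
  · rw [h3]
    by_cases hvx : v = i ∧ x = t i
    · rw [if_pos ((key v x hx).2 hvx)]
      obtain ⟨rfl, rfl⟩ := hvx
      simp
    · rw [if_neg (fun e => hvx ((key v x hx).1 e)), h.parent v hv x hx]
      refine if_congr ⟨fun e => ⟨by omega, e.2⟩, fun e => ⟨?_, e.2⟩⟩ rfl rfl
      rcases Nat.lt_succ_iff_lt_or_eq.1 e.1 with h' | rfl
      · exact h'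
      · exact absurd ⟨rfl, e.2⟩ hvx
  · rw [h1]
    by_cases hvx : v = i ∧ x = t i
    · rw [if_pos ((key v x hx).2 hvx)]
      obtain ⟨rfl, rfl⟩ := hvx
      simp
    · rw [if_neg (fun e => hvx ((key v x hx).1 e)), h.dist v hv x hx]
      refine if_congr ⟨fun e => ⟨by omega, e.2⟩, fun e => ⟨?_, e.2⟩⟩ rfl rfl
      rcases Nat.lt_succ_iff_lt_or_eq.1 e.1 with h' | rfl
      · exact h'
      · exact absurd ⟨rfl, e.2⟩ hvx

theorem EdgesAppended.skip (h : g.EdgesAppended t p ptr i σ) (hi : p i ≠ i) :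
    g.EdgesAppended t p ptr (i + 1) σ := by
  refine ⟨h.le, by have := h.le_add; omega, h.old, fun e he hge => ?_, fun v hv hpv => ?_, h.inj,
    h.len⟩
  · obtain ⟨h1, h2⟩ := h.new e he hge
    exact ⟨by omega, h2⟩
  · rcases Nat.lt_succ_iff_lt_or_eq.1 hv with hv | rfl
    · exact h.complete v hv hpv
    · exact absurd hpv hi

theorem EdgesAppended.add (h : g.EdgesAppended t p ptr i σ) (hg : g.Valid) (hi : p i = i)
    (hnew : ¬ Listed g.k g.L i (t i)) (h23 : σ'.int 23 0 = σ.int 23 0 + 1)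
    (h9 : ∀ j, σ'.int 9 j = if j = σ.int 23 0 then i else σ.int 9 j)
    (h10 : ∀ j, σ'.int 10 j = if j = σ.int 23 0 then t i else σ.int 10 j)
    (h11 : ∀ j, σ'.int 11 j = if j = σ.int 23 0 then 0 else σ.int 11 j)
    (h3 : ∀ j, σ'.len 3 j = if j = σ.int 23 0 then g.W i (t i) else σ.len 3 j) :
    g.EdgesAppended t p ptr (i + 1) σ' := by
  have hle := h.le
  have hadd := h.le_add
  refine ⟨by omega, by omega, fun e he => ?_, fun e he hge => ?_, fun v hv hpv => ?_, ?_,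
    fun e he => ?_⟩
  · have : e ≠ σ.int 23 0 := by omega
    rw [h9, h10, h11, if_neg this, if_neg this, if_neg this]
    exact h.old e he
  · rw [h9, h10, h11]
    by_cases hee : e = σ.int 23 0
    · simp [hee, hi]
    · simp only [if_neg hee]
      obtain ⟨h1, h2⟩ := h.new e (by omega) hge
      exact ⟨by omega, h2⟩
  · rcases Nat.lt_succ_iff_lt_or_eq.1 hv with hv | rfl
    · obtain ⟨e, he, h1, h2⟩ := h.complete v hv hpv
      refine ⟨e, by omega, ?_⟩
      rw [h9, h10, if_neg he.ne, if_neg he.ne]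
      exact ⟨h1, h2⟩
    · refine ⟨σ.int 23 0, by omega, ?_⟩
      rw [h9, h10, if_pos rfl, if_pos rfl]
      exact ⟨rfl, rfl⟩
  -- The head of a previously known edge is listed for its tail, whereas `t i` is new for i; edges
  -- recorded in this round have tails below i.
  · have key : ∀ e < σ.int 23 0, σ.int 9 e = i → σ.int 10 e = t i → False := by
      intro e he h1 h2
      rcases Nat.lt_or_ge e g.ec with h3 | h3
      · have := (hg.edge h3).2.2.2.1
        obtain ⟨h4, h5, -⟩ := h.old e h3
        rw [← h4, ← h5, h1, h2] at this
        exact hnew this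
      · have := (h.new e he h3).1
        omega
    intro e he e' he'
    rw [h9, h9, h10, h10]
    split_ifs with h1 h2 h2
    · intros
      omega
    · exact fun a b => (key e' (by omega) a.symm b.symm).elim
    · exact fun a b => (key e (by omega) a b).elim
    · exact h.inj e (by omega) e' (by omega)
  · rw [h9, h10, h3]
    split_ifs with h1
    · rfl
    · exact h.len e (by omega)

end Knowledge

/-- The number of leaves with a finite key. -/
noncomputable def finiteLeaves (n : ℕ) (σ : State) : ℕ := by
  classical
  exact ((Finset.range n ×ˢ Finset.range n).filter fun e => leaf n σ e.1 e.2 ≠ ∞).card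

theorem finiteLeaves_congr {n : ℕ} {σ σ' : State}
    (h : ∀ u < n, ∀ w < n, leaf n σ' u w = leaf n σ u w) :
    finiteLeaves n σ' = finiteLeaves n σ := by
  rw [finiteLeaves, finiteLeaves]
  congr 1
  refine Finset.filter_congr fun e he => ?_
  simp only [Finset.mem_product, Finset.mem_range] at he
  rw [h _ he.1 _ he.2]

theorem finiteLeaves_delete {n v t : ℕ} {σ σ' : State} (hv : v < n) (ht : t < n)
    (hfin : leaf n σ v t ≠ ∞)
    (h : ∀ u < n, ∀ w < n, leaf n σ' u w = if u = v ∧ w = t then ∞ else leaf n σ u w) :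
    finiteLeaves n σ' + 1 = finiteLeaves n σ := by
  classical
  rw [finiteLeaves, finiteLeaves]
  have hm : (v, t) ∈ (Finset.range n ×ˢ Finset.range n).filter
      fun e => leaf n σ e.1 e.2 ≠ ∞ := by simp [hv, ht, hfin]
  rw [← Finset.card_erase_add_one hm]
  congr 2
  ext ⟨u, w⟩
  simp only [Finset.mem_filter, Finset.mem_product, Finset.mem_range, Finset.mem_erase,
    Prod.mk.injEq, ne_eq]
  constructor
  · rintro ⟨⟨hu, hw⟩, h'⟩
    rw [h u hu w hw] at h'
    split_ifs at h' with h''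
    · exact absurd rfl h'
    · exact ⟨h'', ⟨hu, hw⟩, h'⟩
  · rintro ⟨h'', ⟨hu, hw⟩, h'⟩
    refine ⟨⟨hu, hw⟩, ?_⟩
    rwa [h u hu w hw, if_neg h'']

end RAM

namespace RAM

variable {ψ : SSSPAlgorithm} {M B : ℕ}

open Knowledge

/-- The length of a newly recorded edge is read from the leaf of its target, which has not yet been
deleted at this point; this is the purpose of `hl`. -/
theorem enterTarget_spec {σ : State} {g : Knowledge} {t p ptr : ℕ → ℕ} {d : ℕ → ℝ≥0∞} {i : ℕ}
    (hg : g.Valid) (hM : g.n * (g.n + g.n) + (g.n + g.n) + 2 ≤ M) (hk : g.k < g.n)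
    (hi : i < g.n) (e0 : σ.int 0 0 = g.n) (e20 : σ.int 20 0 = g.k) (e21 : σ.int 21 0 = i)
    (e16 : σ.int 16 (σ.int 15 i) = t i) (e17 : σ.int 17 (σ.int 15 i) = p i)
    (el5 : σ.len 5 i = d i) (ht : t i < g.n) (htnew : ¬ Listed g.k g.L i (t i))
    (hl : leaf g.n σ i (t i) = g.W i (t i)) (hlists : g.ListsAppended t p d i σ)
    (hedges : g.EdgesAppended t p ptr i σ) :
    wp ψ M B enterTarget (fun σ' τ => τ ≤ 12 ∧ σ'.int 29 0 = t i ∧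
      g.ListsAppended t p d (i + 1) σ' ∧ g.EdgesAppended t p ptr (i + 1) σ') σ := by
  have hnn : g.n * g.n + g.n * g.n = g.n * (g.n + g.n) := by ring
  have hec := hg.ec_le.trans g.star_le
  have hle := hedges.le_add
  set c := σ.int 23 0 with hcdef
  have i1 := index_lt hi hk
  have i2 := index_lt hi ht
  have i3 := index_lt (a := g.n + g.n) (i := g.n + t i) hi (by omega)
  have m0 : 0 < M := by omega
  have m1 : 1 < M := by omega
  have m3 : i * g.n < M := by omega
  have m4 : i * g.n + g.k < M := by omega
  have m5 : i * g.n + t i < M := by omega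
  have m6 : g.n + g.n < M := by omega
  have m7 : i * (g.n + g.n) < M := by omega
  have m8 : g.n + t i < M := by omega
  have m9 : i * (g.n + g.n) + (g.n + t i) < M := by omega
  have m10 : c + 1 < M := by omega
  rw [leaf] at hl
  simp [enterTarget, recordEdge, e0, e16, e17, e20, e21, el5, ← hcdef, m0, m1, m3, m4, m5, m6, m7,
    m8, m9, m10, hl]
  refine ⟨fun hpi => ⟨?_, ?_⟩, fun hpi => ⟨?_, ?_⟩⟩
  · refine ListsAppended.succ hlists hi hk ht ?_ ?_ ?_ ?_ <;> simp
  · refine EdgesAppended.add hedges hg hpi htnew ?_ ?_ ?_ ?_ ?_ <;> simp [← hcdef]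
  · refine ListsAppended.succ hlists hi hk ht ?_ ?_ ?_ ?_ <;> simp
  · exact (hedges.skip hpi).congr (by simp) (by simp)

/-- The repair of the tree is performed only if a finite leaf disappears, and it is paid for by that
leaf. -/
theorem deleteTarget_spec {σ : State} {n Λ v t : ℕ} (hσ : Bdd M σ)
    (hM : n * (n + n) + (n + n) + 2 ≤ M) (h2 : 2 ≤ n) (hΛ : n ≤ 2 ^ Λ) (hn : σ.int 0 0 = n)
    (hhalf : ∀ j < n + n, σ.int 8 j = j / 2) (hv : σ.int 21 0 = v) (ht : σ.int 29 0 = t)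
    (hvn : v < n) (htn : t < n) (htree : ∀ v < n, RowTree n σ v) :
    wp ψ M B deleteTarget (fun σ' τ =>
      τ + (5 * Λ + 5) * finiteLeaves n σ' ≤ 2 + (5 * Λ + 5) * finiteLeaves n σ ∧
      (∀ v < n, RowTree n σ' v) ∧
      ∀ u < n, ∀ w < n, leaf n σ' u w = if u = v ∧ w = t then ∞ else leaf n σ u w) σ := by
  have i3 := index_lt (a := n + n) (i := n + t) hvn (by omega)
  have m0 : 0 < M := by omega
  have m6 : n + n < M := by omega
  have m7 : v * (n + n) < M := by omega
  have m8 : n + t < M := by omega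
  have m9 : v * (n + n) + (n + t) < M := by omega
  simp only [deleteTarget, wp]
  refine ⟨by simp [m0, hn, hv, ht, m6, m7, m8, m9], fun hfin => ?_, fun hinf => ?_⟩
  · refine (updateLeaf_spec (n := n) (Λ := Λ) (v := v) (t := t) (X := ∞) (by omega) h2 hΛ hn hhalf
      hv ht hvn htn (by simp) htree).mono hσ ?_
    rintro σ₁ t₁ hb₁ hf₁ ⟨ht₁, htr₁, hl₁⟩
    have hfin' : leaf n σ v t ≠ ∞ := by
      simpa [hn, hv, ht, leaf, lt_top_iff_ne_top] using hfin
    have := finiteLeaves_delete hvn htn hfin' hl₁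
    refine ⟨?_, htr₁, hl₁⟩
    rw [← this, mul_add]
    omega
  · have hinf' : leaf n σ v t = ∞ := by
      simpa [hn, hv, ht, leaf] using hinf
    refine ⟨by omega, htree, fun u hu w hw => ?_⟩
    split_ifs with h
    · rw [h.1, h.2, hinf']
    · rfl

theorem appendTargets_spec {σ : State} {g : Knowledge} {Λ : ℕ} (hσ : Bdd M σ) (hg : g.Valid)
    (hs : g.Holds σ) (htrees : g.Trees σ) (hM : g.n * (g.n + g.n) + (g.n + g.n) + 2 ≤ M)
    (hk : g.k < g.n) (hΛ : g.n ≤ 2 ^ Λ) (h21 : σ.int 21 0 = 0)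
    (ht : ∀ v < g.n, σ.int 16 (σ.int 15 v) < g.n ∧
      ¬ Listed g.k g.L v (σ.int 16 (σ.int 15 v))) :
    Ex ψ M B appendTargets σ fun σ' τ =>
      τ + (5 * Λ + 5) * finiteLeaves g.n σ' ≤ 16 * g.n + (5 * Λ + 5) * finiteLeaves g.n σ + 1 ∧
      g.ListsAppended (fun v => σ.int 16 (σ.int 15 v)) (fun v => σ.int 17 (σ.int 15 v)) (σ.len 5)
        g.n σ' ∧
      g.EdgesAppended (fun v => σ.int 16 (σ.int 15 v)) (fun v => σ.int 17 (σ.int 15 v))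
        (σ.int 11) g.n σ' ∧
      (∀ v < g.n, RowTree g.n σ' v) ∧ ∀ u < g.n, ∀ w < g.n,
        leaf g.n σ' u w = if w = σ.int 16 (σ.int 15 u) then ∞ else leaf g.n σ u w := by
  set t : ℕ → ℕ := fun v => σ.int 16 (σ.int 15 v) with htdef
  set p : ℕ → ℕ := fun v => σ.int 17 (σ.int 15 v) with hpdef
  have ht' : ∀ v < g.n, t v < g.n ∧ ¬ Listed g.k g.L v (t v) := ht
  refine Ex.count (fun i σ' τ => σ'.int 21 0 = i ∧
      τ + (5 * Λ + 5) * finiteLeaves g.n σ' ≤ 16 * i + (5 * Λ + 5) * finiteLeaves g.n σ ∧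
      g.ListsAppended t p (σ.len 5) i σ' ∧ g.EdgesAppended t p (σ.int 11) i σ' ∧
      (∀ v < g.n, RowTree g.n σ' v) ∧ ∀ u < g.n, ∀ w < g.n,
        leaf g.n σ' u w = if u < i ∧ w = t u then ∞ else leaf g.n σ u w) g.n 0 hσ
      (Nat.zero_le _) ⟨h21, by simp, ?_, ?_, htrees.1, by simp⟩ ?_ ?_
  · refine ⟨hs.list_lt, hs.list, by simp, by simpa using hs.mark, by simpa using hs.parent,
      by simpa using hs.dist⟩
  · have he := hs.ec_eq
    refine ⟨he.ge, by omega, fun e h => ⟨hs.ev e h, hs.eu e h, rfl⟩, fun e h h' => by omega,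
      by simp, fun e h e' h' h1 h2 => ?_, fun e h => ?_⟩
    · rw [he] at h h'
      rw [hs.ev e h, hs.ev e' h'] at h1
      rw [hs.eu e h, hs.eu e' h'] at h2
      exact hg.inj e h e' h' h1 h2
    · rw [he] at h
      rw [hs.len e h, hs.ev e h, hs.eu e h]
  · rintro i σ' τ hb hf ⟨hi, hτ, hlists, hedges, htr, hleaf⟩ him
    have e0 : σ'.int 0 0 = g.n := by rw [hf.1 0 (by decide), hs.n_eq]
    have e8 : σ'.int 8 = σ.int 8 := hf.1 8 (by decide)
    have e20 : σ'.int 20 0 = g.k := by rw [hf.1 20 (by decide), hs.k_eq]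
    have e15 : σ'.int 15 = σ.int 15 := hf.1 15 (by decide)
    have e16 : σ'.int 16 (σ.int 15 i) = t i := by rw [hf.1 16 (by decide)]
    have e17 : σ'.int 17 (σ.int 15 i) = p i := by rw [hf.1 17 (by decide)]
    have el5 : σ'.len 5 = σ.len 5 := hf.2 5 (by decide)
    have m0 : 0 < M := by omega
    refine ⟨by simp [m0], by simp [hi, e0], fun hlt => ?_⟩
    obtain ⟨htn, htnew⟩ := ht' i hlt
    have m1 : 1 < M := by omega
    have m2 : i + 1 < M := by omega
    -- So far only leaves in the rows below i have been deleted.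
    have hl : leaf g.n σ' i (t i) = g.W i (t i) := by
      rw [hleaf i hlt (t i) htn, if_neg (by omega), (htrees.2 i hlt _ htn).2 htnew]
    rw [wp]
    refine (enterTarget_spec hg hM hk hlt e0 e20 hi (by rw [e15, e16]) (by rw [e15, e17])
      (by rw [el5]) htn htnew hl hlists hedges).mono hb ?_
    rintro σ₁ t₁ hb₁ hf₁ ⟨ht₁, h29, hlists₁, hedges₁⟩
    have f2 : σ₁.len 2 = σ'.len 2 := hf₁.2 2 (by decide)
    have f7 : σ₁.int 7 = σ'.int 7 := hf₁.1 7 (by decide)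
    have hleq : ∀ u w, leaf g.n σ₁ u w = leaf g.n σ' u w := by
      intro u w
      rw [leaf, leaf, f2]
    rw [wp]
    refine (deleteTarget_spec (n := g.n) (Λ := Λ) (v := i) (t := t i) hb₁ hM hg.two_le hΛ ?_ ?_ ?_
      h29 hlt htn ?_).mono hb₁ ?_
    · rw [hf₁.1 0 (by decide), e0]
    · rw [hf₁.1 8 (by decide), e8]
      exact hs.half
    · rw [hf₁.1 21 (by decide), hi]
    · simpa only [RowTree, f2, f7] using htr
    rintro σ₂ t₂ hb₂ hf₂ ⟨ht₂, htr₂, hl₂⟩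
    have hlists₂ : g.ListsAppended t p (σ.len 5) (i + 1) σ₂ :=
      hlists₁.congr (fun a ha => hf₂.1 a (by revert a; decide))
        (fun a ha => hf₂.2 a (by revert a; decide))
    have hedges₂ : g.EdgesAppended t p (σ.int 11) (i + 1) σ₂ :=
      hedges₁.congr (fun a ha => hf₂.1 a (by revert a; decide))
        (fun a ha => hf₂.2 a (by revert a; decide))
    have f21 : σ₂.int 21 0 = i := by rw [hf₂.1 21 (by decide), hf₁.1 21 (by decide), hi]
    rw [finiteLeaves_congr fun u _ w _ => hleq u w] at ht₂
    simp only [wp, IExp.ok, IExp.val, var, f21]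
    refine ⟨m0, ⟨⟨m0, by decide⟩, m1, m2⟩, by decide, by simp, ?_,
      hlists₂.congr (by simp) (by simp), hedges₂.congr (by simp) (by simp),
      by simpa [RowTree] using htr₂, fun u hu w hw => ?_⟩
    · rw [finiteLeaves_congr (σ' := σ₂.setInt 21 0 (i + 1)) (σ := σ₂) fun _ _ _ _ => rfl]
      omega
    · change leaf g.n σ₂ u w = _
      rw [hl₂ u hu w hw, hleq, hleaf u hu w hw]
      by_cases hui : u = i
      · subst hui
        simp
      · have : u < i + 1 ↔ u < i := by omega
        simp [hui, this]
  · rintro σ' τ hb hf ⟨hi, hτ, h1, h2, h3, h4⟩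
    refine ⟨by omega, h1, h2, h3, fun u hu w hw => ?_⟩
    rw [h4 u hu w hw]
    simp [hu, htdef]

end RAM

/-! ### One full round. -/

namespace RAM

variable {ψ : SSSPAlgorithm} {M B : ℕ}

open Knowledge

namespace Knowledge

/-- The knowledge after the targets `t v`, with parents `p v` and distances `d v`, have been
appended; the known edges are those stored in `σ`. -/
noncomputable def extend (g : Knowledge) (t p : ℕ → ℕ) (d : ℕ → ℝ≥0∞) (σ : State) : Knowledge where
  n := g.n
  k := g.k + 1
  W := g.W
  δ := g.δ
  L v i := if i = g.k then t v else g.L v i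
  P v x := if x = t v then p v else g.P v x
  D v x := if x = t v then d v else g.D v x
  ec := σ.int 23 0
  ev := σ.int 9
  eu := σ.int 10

variable {g : Knowledge} {t p ptr : ℕ → ℕ} {d : ℕ → ℝ≥0∞} {σ σ₁ : State}

theorem listed_extend {v x : ℕ} : Listed (g.extend t p d σ).k (g.extend t p d σ).L v x ↔
    Listed g.k g.L v x ∨ x = t v := by
  simp only [Listed, extend]
  constructor
  · rintro ⟨i, hi, h⟩
    split_ifs at h with hik
    · exact .inr h.symm
    · exact .inl ⟨i, by omega, h⟩
  · rintro (⟨i, hi, h⟩ | h)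
    · exact ⟨i, by omega, by rw [if_neg hi.ne, h]⟩
    · exact ⟨g.k, by omega, by rw [if_pos rfl, h]⟩

theorem EdgesAppended.extend_E (h : g.EdgesAppended t p ptr g.n σ) (v u : ℕ) :
    (g.extend t p d σ).E v u ↔ g.E v u ∨ (v < g.n ∧ u = t v ∧ p v = v) := by
  constructor
  · rintro ⟨e, he, rfl, rfl⟩
    simp only [extend] at he ⊢
    rcases Nat.lt_or_ge e g.ec with hlt | hge
    · obtain ⟨h1, h2, -⟩ := h.old e hlt
      exact .inl ⟨e, hlt, h1.symm, h2.symm⟩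
    · obtain ⟨h1, h2, h3, -⟩ := h.new e he hge
      exact .inr ⟨h1, h2, h3⟩
  · rintro (⟨e, he, rfl, rfl⟩ | ⟨hv, rfl, hp⟩)
    · obtain ⟨h1, h2, -⟩ := h.old e he
      exact ⟨e, he.trans_le h.le, h1, h2⟩
    · obtain ⟨e, he, h1, h2⟩ := h.complete v hv hp
      exact ⟨e, he, h1, h2⟩

theorem ListsAppended.holds (hl : g.ListsAppended t p d g.n σ) (he : g.EdgesAppended t p ptr g.n σ)
    (h0 : σ.int 0 0 = g.n) (h20 : σ.int 20 0 = g.k + 1)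
    (h8 : ∀ j < g.n + g.n, σ.int 8 j = j / 2) : (g.extend t p d σ).Holds σ := by
  refine ⟨h0, h20, rfl, h8, hl.list_lt, fun v hv i hi => ?_, fun v hv x hx => ?_,
    fun v hv x hx => ?_, fun v hv x hx => ?_, fun _ _ => rfl, fun _ _ => rfl, he.len⟩
  · simp only [extend] at hi hv ⊢
    split_ifs with h
    · rw [h, hl.new v hv]
    · exact hl.old v hv i (by omega)
  · rw [listed_extend]
    refine (hl.mark v hv x hx).trans (or_congr_right ?_)
    exact ⟨fun h => h.2, fun h => ⟨hv, h⟩⟩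
  · simp only [extend] at hv hx ⊢
    rw [hl.parent v hv x hx]
    simp [hv]
  · simp only [extend] at hv hx ⊢
    rw [hl.dist v hv x hx]
    simp [hv]

/-- Lists only grow at their ends, so what an old pointer has skipped remains old; new edges start
with the pointer 0, which also leaves the sum of the pointers unchanged. -/
theorem EdgesAppended.pointers (h : g.EdgesAppended t p (σ₁.int 11) g.n σ) (hp : g.Pointers σ₁) :
    (g.extend t p d σ).Pointers σ := by
  intro e he
  simp only [listed_extend]
  simp only [extend] at he ⊢
  rcases Nat.lt_or_ge e g.ec with hlt | hge
  · obtain ⟨h1, h2, h3⟩ := h.old e hlt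
    obtain ⟨h4, h5⟩ := hp e hlt
    rw [h1, h2, h3]
    refine ⟨by omega, fun j hj => ?_⟩
    rw [if_neg (by omega)]
    exact .inl (h5 j hj)
  · obtain ⟨-, -, -, h4⟩ := h.new e he hge
    simp [h4]

theorem EdgesAppended.pointerSum_eq (h : g.EdgesAppended t p (σ₁.int 11) g.n σ) :
    (g.extend t p d σ).pointerSum σ = g.pointerSum σ₁ := by
  simp only [pointerSum, extend]
  rw [← Finset.sum_range_add_sum_Ico _ h.le, Finset.sum_congr rfl fun e he =>
    (h.old e (by simpa using he)).2.2, Finset.sum_eq_zero (s := Finset.Ico _ _), add_zero]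
  intro e he
  rw [Finset.mem_Ico] at he
  exact (h.new e he.2 he.1).2.2.2

theorem Trees.congr (h : g.Trees σ) (h7 : σ₁.int 7 = σ.int 7) (h2 : σ₁.len 2 = σ.len 2) :
    g.Trees σ₁ := by
  simpa only [Trees, RowTree, leaf, h7, h2] using h

theorem Pointers.congr (h : g.Pointers σ) (h11 : σ₁.int 11 = σ.int 11) : g.Pointers σ₁ := by
  simpa only [Pointers, h11] using h

theorem Candidates.congr (h : g.Candidates σ) (h16 : σ₁.int 16 = σ.int 16)
    (h17 : σ₁.int 17 = σ.int 17) (h6 : σ₁.len 6 = σ.len 6) : g.Candidates σ₁ :=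
  ⟨by simpa only [h16, h17, h6] using h.candidate, by simpa only [h6] using h.direct⟩

theorem Scanned.congr {i q : ℕ} (h : g.Scanned i q σ)
    (hI : ∀ a ∈ [11, 12, 13, 16, 17], σ₁.int a = σ.int a)
    (hL : ∀ a ∈ [4, 6], σ₁.len a = σ.len a) : g.Scanned i q σ₁ := by
  have h12 := hI 12 (by decide)
  have h13 := hI 13 (by decide)
  have h4 := hL 4 (by decide)
  have h6 := hL 6 (by decide)
  obtain ⟨a1, a2, a3, a4, a5, a6⟩ := h
  refine ⟨a1, a2.congr (hI 11 (by decide)),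
    a3.congr (hI 16 (by decide)) (hI 17 (by decide)) h6, ?_, ?_, ?_⟩
  · simpa only [Arc, h6, h4, h12, h13] using a4
  · simpa only [h4, h12, h13] using a5
  · simpa only [h12, h13] using a6

theorem Trees.extend (h : g.Trees σ₁) (htr : ∀ v < g.n, RowTree g.n σ v)
    (hl : ∀ u < g.n, ∀ w < g.n, leaf g.n σ u w = if w = t u then ∞ else leaf g.n σ₁ u w) :
    (g.extend t p d σ).Trees σ := by
  refine ⟨htr, fun v hv w hw => ?_⟩
  rw [listed_extend]
  change (_ → leaf g.n σ v w = ∞) ∧ (_ → leaf g.n σ v w = g.W v w)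
  rw [hl v hv w hw]
  obtain ⟨h1, h2⟩ := h.2 v hv w hw
  constructor
  · rintro (h' | h')
    · simp [h1 h']
    · simp [h']
  · intro h'
    push Not at h'
    rw [if_neg h'.2, h2 h'.1]

/-- Leaves of listed vertices have key ∞, so a finite winner is a shortest edge to a new target,
with v itself as the parent. -/
theorem Trees.candidates (h : g.Trees σ) (hg : g.Valid)
    (hc : ∀ v < g.n, σ₁.len 6 v = σ.len 2 (v * (g.n + g.n) + 1) ∧
      σ₁.int 16 v = σ.int 7 (v * (g.n + g.n) + 1) ∧ σ₁.int 17 v = v) : g.Candidates σ₁ := by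
  have hn : 0 < g.n := by have := hg.two_le; omega
  refine ⟨fun v hv hfin => ?_, fun v hv z hz hvz => ?_⟩
  · obtain ⟨h1, h2, h3⟩ := hc v hv
    rw [h1] at hfin
    obtain ⟨h4, h5⟩ := (h.1 v hv).root_eq hn hfin
    rw [h1, h2, h3]
    set x := σ.int 7 (v * (g.n + g.n) + 1) with hx
    have h5' : leaf g.n σ v x = σ.len 2 (v * (g.n + g.n) + 1) := h5
    have hnl : ¬ Listed g.k g.L v x := fun hl => hfin (h5' ▸ (h.2 v hv x h4).1 hl)
    refine ⟨h4, hnl, hg.closest.listed_self hg.pos hv, ?_, .inr rfl⟩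
    rw [hg.dist.self v hv, zero_add, ← h5', (h.2 v hv x h4).2 hnl]
  · rw [(hc v hv).1, ← (h.2 v hv z hz).2 hvz]
    exact (h.1 v hv).root_le hn hz

theorem Valid.extend {cand hd : ℕ → ℝ≥0∞} {ct cq rt : ℕ → ℕ} (hg : g.Valid) (hk : g.k < g.n)
    (hlow : ∀ v < g.n, ∀ t < g.n, ¬ Listed g.k g.L v t → hd v ≤ g.δ v t)
    (hroot : ∀ v < g.n, rt v < g.n ∧ rt (rt v) = rt v ∧
      (∀ x, Listed g.k g.L (rt v) x ↔ Listed g.k g.L v x) ∧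
      ∃ d, EdgeWalk g.W g.E v (rt v) d ∧ hd v = d + cand (rt v))
    (hc : ∀ v < g.n, cand v ≠ ∞ →
      Candidate g.n g.W g.δ g.k g.L g.E v (cand v) (ct v) (cq v))
    (he : g.EdgesAppended (fun v => ct (rt v)) (fun v => cq (rt v)) ptr g.n σ) :
    (g.extend (fun v => ct (rt v)) (fun v => cq (rt v)) hd σ).Valid := by
  refine ⟨hg.two_le, Nat.succ_pos _, hg.dist, ?_, he.inj⟩
  refine hg.closest.step hg.dist hg.pos hk hlow hroot hc ?_ ?_ ?_ ?_ ?_ ?_ he.extend_E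
  · exact fun v _ i hi => if_neg hi.ne
  · exact fun v _ => if_pos rfl
  · exact fun v _ x _ hx => if_neg hx
  · exact fun v _ => if_pos rfl
  · exact fun v _ x _ hx => if_neg hx
  · exact fun v _ => if_pos rfl

/-- The arc inequalities are the hypotheses of `Closest.le_dist`: a reversed known edge v → u yields
`hd v ≤ W v u + hd u`, and an edge from the source bounds `hd v` by the candidate. Where that edge
is absent, the candidate is ∞. -/
theorem Built.lower {q : ℕ} {hd : ℕ → ℝ≥0∞} (hb : g.Built g.n q σ) (hg : g.Valid)
    (h0 : hd g.n = 0) (harc : ∀ a b x, Arc σ q a b x → hd b ≤ hd a + x) {v t : ℕ} (hv : v < g.n)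
    (ht : t < g.n) (hvt : ¬ Listed g.k g.L v t) : hd v ≤ g.δ v t := by
  refine hg.closest.le_dist hg.dist hg.pos (cand := σ.len 6) hb.candidates.direct ?_ ?_ hv ht hvt
  · rintro _ _ ⟨j, hj, rfl, rfl⟩
    rcases hb.complete j hj with ⟨h1, h2⟩ | h
    · refine .inl ⟨h1, ?_⟩
      rw [add_comm]
      exact harc _ _ _ h2
    · exact .inr h
  · intro v hv
    by_cases hfin : σ.len 6 v = ∞
    · simp [hfin]
    · have := harc _ _ _ (hb.source v hv hfin)
      rwa [h0, zero_add] at this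

theorem Built.hd_ne_top {q : ℕ} {hd : ℕ → ℝ≥0∞} (hb : g.Built g.n q σ) (hg : g.Valid)
    (hk : g.k < g.n) (h0 : hd g.n = 0) (harc : ∀ a b x, Arc σ q a b x → hd b ≤ hd a + x) {v : ℕ}
    (hv : v < g.n) : hd v ≠ ∞ := by
  obtain ⟨x, hx, hvx⟩ := hg.closest.exists_not_listed hk hv
  exact ((hb.lower hg h0 harc hv hx hvx).trans_lt (hg.dist.ne_top v hv x hx).lt_top).ne

theorem Built.arc_lt {q e : ℕ} (hb : g.Built g.n q σ) (hg : g.Valid) (he : e < q) :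
    σ.int 12 e < g.n + 1 ∧ σ.int 13 e < g.n + 1 ∧ σ.len 4 e ≠ ∞ := by
  rcases hb.sound e he with ⟨j, hj, h1, h2, h3, -⟩ | ⟨h1, h2, -, h3⟩
  · obtain ⟨hv, hu, -, -, hw⟩ := hg.edge hj
    exact ⟨by omega, by omega, by rw [h3, hw]; exact hg.dist.ne_top _ hv _ hu⟩
  · exact ⟨by omega, by omega, h3⟩

end Knowledge

/-- One round: append one vertex to the list of every vertex. -/
def round : Cmd :=
  .seq (.setInt 21 (.const 0) (.const 0)) (.seq loadRoots
    (.seq (.setInt 22 (.const 0) (.const 0)) (.seq (.setInt 24 (.const 0) (.const 0))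
      (.seq scanEdges (.seq (.setInt 21 (.const 0) (.const 0)) (.seq addSources
        (.seq callAlgorithm (.seq (.setInt 21 (.const 0) (.const 0)) (.seq findRoots
          (.seq (.setInt 21 (.const 0) (.const 0)) (.seq resolve
            (.seq (.setInt 21 (.const 0) (.const 0)) (.seq appendTargets
              (.setInt 20 (.const 0) (.add (var 20) (.const 1))))))))))))))))

/-- Of the 13 units per known edge, 12 come from scanning and one from passing an arc to ψ. Pointer
moves and leaf deletions are charged to the two potentials, so that they telescope over the rounds.
-/
theorem round_spec {T S : ℕ → ℕ → ℕ} {σ : State} {g : Knowledge} {Λ TT : ℕ}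
    (hg : g.Valid) (hs : g.Holds σ) (hp : g.Pointers σ) (htr : g.Trees σ)
    (hM : g.n * (g.n + g.n) + (g.n + g.n) + 2 ≤ M) (hk : g.k < g.n) (hΛ : g.n ≤ 2 ^ Λ)
    (hT : ψ.TimeBound T) (hS : ψ.SpaceBound S)
    (hTT : ∀ q ≤ g.star.card + g.n, T q (g.n + 1) ≤ TT)
    (hB : ∀ q ≤ g.star.card + g.n, S q (g.n + 1) ≤ B) :
    wp ψ M B round (fun σ' τ => ∃ g' : Knowledge, g'.n = g.n ∧ g'.k = g.k + 1 ∧ g'.W = g.W ∧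
      g'.δ = g.δ ∧ (∀ v < g.n, g'.P v v = g.P v v) ∧ g'.Valid ∧ g'.Holds σ' ∧
      g'.Pointers σ' ∧ g'.Trees σ' ∧
      τ + 2 * g.pointerSum σ + (5 * Λ + 5) * finiteLeaves g.n σ' ≤
        46 * g.n + 13 * g.ec + TT + 20 + 2 * g'.pointerSum σ' +
          (5 * Λ + 5) * finiteLeaves g.n σ) σ := by
  have h2 := hg.two_le
  have m0 : 0 < M := by omega
  have m1 : 1 < M := by omega
  refine ⟨m0, m0, by decide, fun hb => (loadRoots_spec (n := g.n) hb hM ?_ ?_).mono hb ?_⟩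
  · simp [hs.n_eq]
  · simp
  rintro σ₁ t₁ hb₁ hf₁ ⟨ht₁, hc₁⟩
  have hs₁ : g.Holds σ₁ := (hs.congr (by simp) (by simp)).frame hf₁ (by decide) (by decide)
  have hcand₁ : g.Candidates σ₁ := htr.candidates hg (by simpa using hc₁)
  have e11 : σ₁.int 11 = σ.int 11 := by rw [hf₁.1 11 (by decide)]; simp
  have e7 : σ₁.int 7 = σ.int 7 := by rw [hf₁.1 7 (by decide)]; simp
  have l2 : σ₁.len 2 = σ.len 2 := by rw [hf₁.2 2 (by decide)]; simp
  refine ⟨m0, m0, by decide, m0, m0, by decide, fun hb => (scanEdges_spec hb hg ?_ hM hk ?_ ?_ ?_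
    ?_).mono hb ?_⟩
  · exact hs₁.congr (by simp) (by simp)
  · simp
  · simp
  · simpa [Pointers, e11] using hp
  · exact ⟨by simpa using hcand₁.candidate, by simpa using hcand₁.direct⟩
  rintro σ₂ t₂ hb₂ hf₂ ⟨ht₂, hsc⟩
  have hs₂ : g.Holds σ₂ := (hs₁.congr (by simp) (by simp)).frame hf₂ (by decide) (by decide)
  refine ⟨m0, m0, by decide, fun hb => ?_⟩
  refine (addSources_spec hb hg (by simp [hs₂.n_eq]) hM (by simp)
    (by simpa using hsc.congr (by simp) (by simp))).mono hb ?_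
  rintro σ₃ t₃ hb₃ hf₃ ⟨ht₃, hbt⟩
  have hs₃ : g.Holds σ₃ := (hs₂.congr (by simp) (by simp)).frame hf₃ (by decide) (by decide)
  set q := σ₃.int 24 0 with hq
  have hqle : q ≤ g.star.card + g.n := hbt.le.trans (Nat.add_le_add_right hg.ec_le _)
  rw [wp]
  refine fun hb => (callAlgorithm_spec hb (by omega) hs₃.n_eq rfl hT hS (hB q hqle)
    (fun e he => hbt.arc_lt hg he) hbt.inj).mono hb ?_
  rintro σ₄ t₄ hb₄ hf₄ ⟨ht₄, h0, h14, harc, htree⟩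
  have hlow := fun v hv t ht hvt => hbt.lower hg h0 harc (v := v) (t := t) hv ht hvt
  have hfin := fun v hv => hbt.hd_ne_top hg hk h0 harc (v := v) hv
  have hs₄ : g.Holds σ₄ := hs₃.frame hf₄ (by decide) (by decide)
  refine ⟨m0, m0, by decide, fun hb => ?_⟩
  refine (findRoots_spec (n := g.n) hb (by omega) (by simp [hs₄.n_eq]) (by simp)).mono hb ?_
  rintro σ₅ t₅ hb₅ hf₅ ⟨ht₅, h15⟩
  have hs₅ : g.Holds σ₅ := (hs₄.congr (by simp) (by simp)).frame hf₅ (by decide) (by decide)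
  have e14 : σ₅.int 14 = σ₄.int 14 := by rw [hf₅.1 14 (by decide)]; simp
  refine ⟨m0, m0, by decide, fun hb => ?_⟩
  refine (resolve_spec (n := g.n) hb (by omega) (by simp [hs₅.n_eq]) (by simp)
    (by simpa [e14] using h14)
    ?_ (by simpa [e14] using h15)).mono hb ?_
  · intro v hv
    simpa [e14] using (htree v hv (hfin v hv)).2
  rintro σ₆ t₆ hb₆ hf₆ ⟨ht₆, hrt⟩
  have hs₆ : g.Holds σ₆ := (hs₅.congr (by simp) (by simp)).frame hf₆ (by decide) (by decide)
  have hroot : ∀ v < g.n, σ₆.int 15 v < g.n ∧ σ₆.int 15 (σ₆.int 15 v) = σ₆.int 15 v ∧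
      (∀ x, Listed g.k g.L (σ₆.int 15 v) x ↔ Listed g.k g.L v x) ∧
      ∃ d, EdgeWalk g.W g.E v (σ₆.int 15 v) d ∧ σ₄.len 5 v = d + σ₃.len 6 (σ₆.int 15 v) := by
    intro v hv
    obtain ⟨hr, h, hR⟩ := hrt v hv
    obtain ⟨h', hR'⟩ := (hrt _ hr).2
    rw [State.int_setInt_ne _ _ _ _ (by decide), e14] at hR hR'
    obtain ⟨-, i2, i3⟩ := hbt.root_walk hg h0 (fun v hv hf => (htree v hv hf).1) hR hv (hfin v hv)
    exact ⟨hr, (hR'.unique (.base _ hR.parent_eq)).1, i2, i3⟩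
  have e16 : σ₆.int 16 = σ₃.int 16 := by
    rw [hf₆.1 16 (by decide)]; simp [hf₅.1 16 (by decide), hf₄.1 16 (by decide)]
  have e17 : σ₆.int 17 = σ₃.int 17 := by
    rw [hf₆.1 17 (by decide)]; simp [hf₅.1 17 (by decide), hf₄.1 17 (by decide)]
  have e11' : σ₆.int 11 = σ₂.int 11 := by
    rw [hf₆.1 11 (by decide)]
    simp [hf₅.1 11 (by decide), hf₄.1 11 (by decide), hf₃.1 11 (by decide)]
  have e7' : σ₆.int 7 = σ.int 7 := by
    rw [hf₆.1 7 (by decide)]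
    simp [hf₅.1 7 (by decide), hf₄.1 7 (by decide), hf₃.1 7 (by decide), hf₂.1 7 (by decide), e7]
  have l2' : σ₆.len 2 = σ.len 2 := by
    rw [hf₆.2 2 (by decide)]
    simp [hf₅.2 2 (by decide), hf₄.2 2 (by decide), hf₃.2 2 (by decide), hf₂.2 2 (by decide), l2]
  have l5 : σ₆.len 5 = σ₄.len 5 := by
    rw [hf₆.2 5 (by decide)]; simp [hf₅.2 5 (by decide)]
  have hcand := hbt.candidates.candidate
  have hnew : ∀ v < g.n, σ₃.int 16 (σ₆.int 15 v) < g.n ∧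
      ¬ Listed g.k g.L v (σ₃.int 16 (σ₆.int 15 v)) := by
    intro v hv
    obtain ⟨hr, hrr, hl, d, hw, hd⟩ := hroot v hv
    have hcf : σ₃.len 6 (σ₆.int 15 v) ≠ ∞ := by
      intro h
      exact hfin v hv (by rw [hd, h]; simp)
    obtain ⟨i1, i2, -⟩ := hcand _ hr hcf
    exact ⟨i1, fun h => i2 ((hl _).2 h)⟩
  have htr₆ : g.Trees σ₆ := htr.congr e7' l2'
  refine ⟨m0, m0, by decide, fun hb => ?_⟩
  refine (appendTargets_spec (Λ := Λ) hb hg (hs₆.congr (by simp) (by simp))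
    (htr₆.congr (by simp) (by simp)) hM hk hΛ (by simp) (by simpa [e16] using hnew)).mono hb ?_
  rintro σ₇ t₇ hb₇ hf₇ ⟨ht₇, hla, hea, hrows, hleaf⟩
  simp only [State.int_setInt_ne, State.len_setInt, ne_eq, Nat.reduceEqDiff,
    not_false_eq_true, e16, e17, e11', l5] at hla hea hleaf
  have e0 : σ₇.int 0 0 = g.n := by rw [hf₇.1 0 (by decide)]; simp [hs₆.n_eq]
  have e20 : σ₇.int 20 0 = g.k := by rw [hf₇.1 20 (by decide)]; simp [hs₆.k_eq]
  have e8 : σ₇.int 8 = σ₆.int 8 := by rw [hf₇.1 8 (by decide)]; simp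
  have m2 : g.k + 1 < M := by omega
  refine ⟨m0, by simp [e20, m0, m1, m2], by decide, ?_⟩
  set σ₈ := σ₇.setInt 20 (IExp.val σ₇ (.const 0)) (IExp.val σ₇ (.add (var 20) (.const 1)))
    with hσ₈
  have hea' : g.EdgesAppended (fun v => σ₃.int 16 (σ₆.int 15 v)) (fun v => σ₃.int 17 (σ₆.int 15 v))
      (σ₂.int 11) g.n σ₈ := hea.congr (by simp [hσ₈]) (by simp [hσ₈])
  have hla' := hla.congr (σ' := σ₈) (by simp [hσ₈]) (by simp [hσ₈])
  refine ⟨g.extend (fun v => σ₃.int 16 (σ₆.int 15 v)) (fun v => σ₃.int 17 (σ₆.int 15 v))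
      (σ₄.len 5) σ₈,
    rfl, rfl, rfl, rfl, fun v hv => if_neg fun h => (hnew v hv).2 ?_,
    hg.extend hk hlow hroot hcand hea', hla'.holds hea' ?_ ?_ ?_,
    hea'.pointers hsc.pointers, htr₆.extend ?_ ?_, ?_⟩
  -- A new target is not listed, while v is listed for itself; hence `P v v` keeps its value.
  · rw [show σ₃.int 16 (σ₆.int 15 v) = v from h.symm]
    exact hg.closest.listed_self hg.pos hv
  · simp [hσ₈, e0]
  · simp [hσ₈, e20]
  · simpa [hσ₈, e8] using hs₆.half
  · simpa [hσ₈, RowTree] using hrows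
  · simpa [hσ₈, leaf] using hleaf
  · have f1 : finiteLeaves g.n σ₈ = finiteLeaves g.n σ₇ := finiteLeaves_congr fun _ _ _ _ => rfl
    have f2 := finiteLeaves_congr (n := g.n) (σ := σ) (σ' := σ₆.setInt 21
      (IExp.val σ₆ (.const 0)) (IExp.val σ₆ (.const 0))) fun _ _ _ _ => by simp [leaf, l2']
    have f3 := hTT _ hqle
    have f4 := hbt.le
    rw [hea'.pointerSum_eq, f1]
    rw [f2] at ht₇
    rw [← hq] at ht₄
    have f5 : ∀ τ : State, τ.int 11 = σ.int 11 → g.pointerSum τ = g.pointerSum σ := by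
      intro τ h
      simp [pointerSum, h]
    rw [f5 _ (by simp [e11])] at ht₂
    omega

end RAM

/-! ### The whole program. -/

namespace RAM

variable {ψ : SSSPAlgorithm} {M B : ℕ}

open Knowledge

namespace Knowledge

/-- The knowledge before the first round: every vertex is the only one in its list. -/
noncomputable def initial (n : ℕ) (W δ : ℕ → ℕ → ℝ≥0∞) (σ : State) : Knowledge where
  n := n
  k := 1
  W := W
  δ := δ
  L v i := σ.int 5 (v * n + i)
  P v t := σ.int 3 (v * n + t)
  D v t := σ.len 1 (v * n + t)
  ec := 0
  ev := fun _ => 0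
  eu := fun _ => 0

variable {n : ℕ} {W δ : ℕ → ℕ → ℝ≥0∞} {σ : State}

theorem listed_initial (h5 : ∀ v < n, σ.int 5 (v * n) = v) {v x : ℕ} (hv : v < n) :
    Listed (initial n W δ σ).k (initial n W δ σ).L v x ↔ v = x := by
  simp [Listed, initial, h5 v hv]

theorem initial_valid (h2 : 2 ≤ n) (hδ : IsDistance n W δ) (h5 : ∀ v < n, σ.int 5 (v * n) = v)
    (hlt : ∀ i < n * n, σ.int 5 i < n) (hD : ∀ v < n, σ.len 1 (v * n + v) = 0) :
    (initial n W δ σ).Valid := by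
  refine ⟨h2, Nat.one_pos, hδ, ⟨?_, h5, ?_, ?_, ?_, ?_, ?_, ?_⟩, by simp [initial]⟩
  · intro v hv i hi
    exact hlt _ (index_lt hv (show i < n from lt_of_lt_of_le hi (by simp [initial]; omega)))
  · intro v hv i hi j hj _
    simp only [initial] at hi hj
    omega
  · intro v hv i hi
    obtain rfl : i = 0 := by simp only [initial] at hi; omega
    simp [initial, h5 v hv, hD v hv, hδ.self v hv]
  · intro v hv i hi
    obtain rfl : i = 0 := by simp only [initial] at hi; omega
    simp [initial, h5 v hv, hδ.self v hv]
  · intro v hv i hi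
    simp only [initial] at hi
    omega
  · intro v hv i hi
    obtain rfl : i = 0 := by simp only [initial] at hi; omega
    have : EdgeWalk W (initial n W δ σ).E v v 0 := .nil v
    simpa [initial, h5 v hv, hδ.self v hv] using this
  · rintro v u ⟨j, hj, -⟩
    exact absurd hj (Nat.not_lt_zero _)

end Knowledge

/-- The program for the all-pairs shortest path problem. -/
def allPairs : Cmd := .seq setup (.while (.intLT (var 20) vertices) round)

theorem rounds_spec {T S : ℕ → ℕ → ℕ} {σ : State} {g : Knowledge} {Λ TT : ℕ} (hσ : Bdd M σ)
    (hg : g.Valid) (hs : g.Holds σ) (hp : g.Pointers σ) (htr : g.Trees σ)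
    (hM : g.n * (g.n + g.n) + (g.n + g.n) + 2 ≤ M) (hk : g.k ≤ g.n) (hΛ : g.n ≤ 2 ^ Λ)
    (hT : ψ.TimeBound T) (hS : ψ.SpaceBound S)
    (hTT : ∀ q ≤ g.star.card + g.n, T q (g.n + 1) ≤ TT)
    (hB : ∀ q ≤ g.star.card + g.n, S q (g.n + 1) ≤ B) :
    Ex ψ M B (.while (.intLT (var 20) vertices) round) σ fun σ' τ =>
      ∃ g' : Knowledge, g'.n = g.n ∧ g'.k = g.n ∧ g'.W = g.W ∧ g'.δ = g.δ ∧
      (∀ v < g.n, g'.P v v = g.P v v) ∧ g'.Valid ∧ g'.Holds σ' ∧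
      τ ≤ g.n * (46 * g.n + 15 * g.star.card + TT + 21) +
          (5 * Λ + 5) * finiteLeaves g.n σ + 1 := by
  refine Ex.count (fun k σ' τ => ∃ g' : Knowledge, g'.n = g.n ∧ g'.k = k ∧ g'.W = g.W ∧
      g'.δ = g.δ ∧ (∀ v < g.n, g'.P v v = g.P v v) ∧ g'.Valid ∧ g'.Holds σ' ∧ g'.Pointers σ' ∧
      g'.Trees σ' ∧ τ + (5 * Λ + 5) * finiteLeaves g.n σ' ≤
        k * (46 * g.n + 13 * g.star.card + TT + 21) + 2 * g'.pointerSum σ' +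
          (5 * Λ + 5) * finiteLeaves g.n σ) g.n g.k hσ hk
    ⟨g, rfl, rfl, rfl, rfl, fun _ _ => rfl, hg, hs, hp, htr, by omega⟩ ?_ ?_
  · rintro k σ' τ hb hf ⟨g', hn, rfl, hW, hδ, hP, hg', hs', hp', htr', hτ⟩ hkn
    have m0 : 0 < M := by omega
    have hstar : g'.star = g.star := by simp only [Knowledge.star, hn, hW, hδ]
    refine ⟨by simp [m0], by simp [hs'.k_eq, hs'.n_eq, hn], fun hlt => ?_⟩
    refine (round_spec (Λ := Λ) (TT := TT) hg' hs' hp' htr' (by rwa [hn]) (by rwa [hn])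
      (by rwa [hn]) hT hS (by rwa [hstar, hn]) (by rwa [hstar, hn])).mono hb ?_
    rintro σ'' t hb' hf' ⟨g'', hn', hk', hW', hδ', hP', i1, i2, i3, i4, ht⟩
    refine ⟨g'', hn'.trans hn, hk', hW'.trans hW, hδ'.trans hδ, fun v hv => ?_, i1, i2, i3, i4, ?_⟩
    · rw [hP' v (by rwa [hn]), hP v hv]
    · have := hg'.ec_le
      rw [hstar] at this
      rw [hn] at ht
      rw [add_mul (g'.k) 1]
      omega
  · rintro σ' τ hb hf ⟨g', hn, hk', hW, hδ, hP, hg', hs', hp', htr', hτ⟩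
    refine ⟨g', hn, hk', hW, hδ, hP, hg', hs', ?_⟩
    have hstar : g'.star = g.star := by simp only [Knowledge.star, hn, hW, hδ]
    -- At the end no pointer exceeds n and there are at most as many pointers as edges that are
    -- shortest paths. Twice this sum, spread over n rounds, turns the coefficient 13 into 15.
    have h1 : g'.pointerSum σ' ≤ g.star.card * g.n := by
      rw [pointerSum, ← hstar]
      refine (Finset.sum_le_card_nsmul _ _ g.n fun j hj => ?_).trans ?_
      · exact hk' ▸ (hp' j (by simpa using hj)).1
      · rw [Finset.card_range, smul_eq_mul]
        exact Nat.mul_le_mul_right _ hg'.ec_le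
    have h2 : g.n * (46 * g.n + 15 * g.star.card + TT + 21) =
        g.n * (46 * g.n + 13 * g.star.card + TT + 21) + 2 * (g.star.card * g.n) := by ring
    omega

theorem finiteLeaves_le {n m : ℕ} {σ σ' : State} (h : LeavesHold n m σ σ') :
    finiteLeaves n σ' ≤ m := by
  classical
  rw [finiteLeaves]
  refine (Finset.card_le_card (t := (Finset.range m).image fun j => (σ.int 1 j, σ.int 2 j))
    ?_).trans (Finset.card_image_le.trans (by simp))
  rintro ⟨v, w⟩ hvw
  simp only [Finset.mem_filter, Finset.mem_product, Finset.mem_range] at hvw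
  obtain ⟨⟨hv, hw⟩, hfin⟩ := hvw
  obtain ⟨j, hj, h1, h2, -⟩ := (h.1 v hv w hw).resolve_left hfin
  exact Finset.mem_image.2 ⟨j, by simpa using hj, by rw [h1, h2]⟩

theorem allPairs_spec {T S : ℕ → ℕ → ℕ} {σ : State} {n m Λ TT : ℕ} {W δ : ℕ → ℕ → ℝ≥0∞}
    (hσ : Bdd M σ) (hM : n * (n + n) + (n + n) + 2 ≤ M) (hmM : m + 2 ≤ M) (h2 : 2 ≤ n)
    (hΛ : n ≤ 2 ^ Λ) (hn : σ.int 0 0 = n) (hm : σ.int 0 1 = m)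
    (h0 : ∀ a i, 2 < a → σ.int a i = 0) (hl0 : ∀ i, σ.len 1 i = 0)
    (hlt : ∀ j < m, σ.int 1 j < n ∧ σ.int 2 j < n)
    (hinj : ∀ i < m, ∀ j < m, σ.int 1 i = σ.int 1 j → σ.int 2 i = σ.int 2 j → i = j)
    (hδ : IsDistance n W δ)
    (hW : ∀ v < n, ∀ w < n, W v w = ∞ ∨
      ∃ j < m, σ.int 1 j = v ∧ σ.int 2 j = w ∧ v ≠ w ∧ W v w = σ.len 0 j)
    (hW' : ∀ j < m, σ.int 1 j ≠ σ.int 2 j → W (σ.int 1 j) (σ.int 2 j) = σ.len 0 j)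
    (hT : ψ.TimeBound T) (hS : ψ.SpaceBound S)
    (hTT : ∀ q ≤ (initial n W δ σ).star.card + n, T q (n + 1) ≤ TT)
    (hB : ∀ q ≤ (initial n W δ σ).star.card + n, S q (n + 1) ≤ B) :
    Ex ψ M B allPairs σ fun σ' τ => ∃ g : Knowledge, g.n = n ∧ g.k = n ∧ g.W = W ∧ g.δ = δ ∧
      (∀ v < n, g.P v v = 0) ∧ g.Valid ∧ g.Holds σ' ∧
      τ ≤ m * (5 * Λ + 10) + 3 * (n * (n + n)) + 6 * n + 6 +
        n * (46 * n + 15 * g.star.card + TT + 21) + (5 * Λ + 5) * m := by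
  refine Ex.of_wp ?_ hσ
  rw [allPairs, wp]
  refine (setup_spec hσ hM hmM h2 hΛ hn hm h0 hlt hinj).mono hσ ?_
  rintro σ₁ t₁ hb₁ hf₁ ⟨ht₁, g8, g5, g6, g7, g20, gtr, gl⟩
  have l1 : σ₁.len 1 = σ.len 1 := hf₁.2 1 (by decide)
  have e0 : σ₁.int 0 = σ.int 0 := hf₁.1 0 (by decide)
  have e3 : σ₁.int 3 = σ.int 3 := hf₁.1 3 (by decide)
  have e23 : σ₁.int 23 = σ.int 23 := hf₁.1 23 (by decide)
  have hleaf : ∀ v < n, ∀ w < n, leaf n σ₁ v w = W v w := by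
    intro v hv w hw
    rcases gl.1 v hv w hw with h | ⟨j, hj, rfl, rfl, hne, h⟩
    · rcases hW v hv w hw with h' | ⟨j, hj, rfl, rfl, hne, h'⟩
      · rw [h, h']
      · rw [h', gl.2 j hj hne]
    · rw [h, hW' j hj hne]
  -- Every vertex is already listed for itself, and leaves of listed vertices must have key ∞;
  -- omitting the loops guarantees it.
  have hdiag : ∀ v < n, leaf n σ₁ v v = ∞ := by
    intro v hv
    rcases gl.1 v hv v hv with h | ⟨j, hj, -, -, hne, -⟩
    · exact h
    · exact absurd rfl hne
  have hg : (initial n W δ σ₁).Valid :=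
    initial_valid h2 hδ g5 g7 fun v hv => by rw [l1, hl0]
  have hs : (initial n W δ σ₁).Holds σ₁ := by
    refine ⟨by rw [e0, hn]; rfl, g20, by rw [e23, h0 _ _ (by omega)]; rfl, g8, g7,
      fun _ _ _ _ => rfl, fun v hv t ht => ?_, fun _ _ _ _ => rfl, fun _ _ _ _ => rfl, ?_, ?_, ?_⟩
    · rw [listed_initial g5 hv]
      exact g6 v hv t ht
    all_goals exact fun i hi => absurd hi (Nat.not_lt_zero _)
  have hp : (initial n W δ σ₁).Pointers σ₁ := fun i hi => absurd hi (Nat.not_lt_zero _)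
  have htr : (initial n W δ σ₁).Trees σ₁ := by
    refine ⟨gtr, fun v hv w hw => ?_⟩
    rw [listed_initial g5 hv]
    refine ⟨?_, fun _ => hleaf v hv w hw⟩
    rintro rfl
    exact hdiag v hv
  refine fun hb => (rounds_spec (Λ := Λ) (TT := TT) hb hg hs hp htr hM (show 1 ≤ n by omega) hΛ
    hT hS hTT hB).mono hb ?_
  rintro σ₂ t₂ hb₂ hf₂ ⟨g, hn', hk', hW₂, hδ₂, hP, i1, i2, ht₂⟩
  refine ⟨g, hn', hk', hW₂, hδ₂, fun v hv => ?_, i1, i2, ?_⟩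
  · rw [hP v hv]
    simp [initial, e3, h0]
  · have h1 : (5 * Λ + 5) * finiteLeaves n σ₁ ≤ (5 * Λ + 5) * m :=
      Nat.mul_le_mul_left _ (finiteLeaves_le gl)
    have h2 : g.star = (initial n W δ σ₁).star := by simp only [Knowledge.star, hn', hW₂, hδ₂]
    rw [h2]
    change t₂ ≤ n * (46 * n + 15 * (initial n W δ σ₁).star.card + TT + 21) +
      (5 * Λ + 5) * finiteLeaves n σ₁ + 1 at ht₂
    omega

end RAM

/-! ### From the input graph to abstract weights and distances. -/

namespace WDigraph

variable {n : ℕ} {G : WDigraph n}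

/-- The length of the edge from `u` to `v`, and `∞` if there is none or if `u = v`. -/
noncomputable def weight (G : WDigraph n) (u v : ℕ) : ℝ≥0∞ :=
  ⨅ (e : Fin n × Fin n × ℝ≥0) (_ : e ∈ G.edges ∧ (e.1 : ℕ) = u ∧ (e.2.1 : ℕ) = v ∧ u ≠ v),
    (e.2.2 : ℝ≥0∞)

/-- The distance as a function of natural numbers. -/
noncomputable def natDist (G : WDigraph n) (u v : ℕ) : ℝ≥0∞ :=
  if h : u < n ∧ v < n then G.dist ⟨u, h.1⟩ ⟨v, h.2⟩ else ∞

theorem natDist_coe (u v : Fin n) : G.natDist u v = G.dist u v := by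
  simp [natDist]

theorem eq_of_endpoints {e e' : Fin n × Fin n × ℝ≥0} (he : e ∈ G.edges) (he' : e' ∈ G.edges)
    (h1 : e.1 = e'.1) (h2 : e.2.1 = e'.2.1) : e = e' :=
  List.inj_on_of_nodup_map G.simple he he' (by simp [h1, h2])

theorem weight_eq {e : Fin n × Fin n × ℝ≥0} (he : e ∈ G.edges) (hne : (e.1 : ℕ) ≠ e.2.1) :
    G.weight e.1 e.2.1 = e.2.2 := by
  refine le_antisymm (iInf₂_le e ⟨he, rfl, rfl, hne⟩) (le_iInf₂ ?_)
  rintro e' ⟨he', h1, h2, -⟩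
  rw [eq_of_endpoints he' he (Fin.ext h1) (Fin.ext h2)]

theorem weight_eq_top_or (G : WDigraph n) (u v : ℕ) : G.weight u v = ∞ ∨
    ∃ e ∈ G.edges, (e.1 : ℕ) = u ∧ (e.2.1 : ℕ) = v ∧ u ≠ v ∧ G.weight u v = e.2.2 := by
  by_cases h : ∃ e ∈ G.edges, (e.1 : ℕ) = u ∧ (e.2.1 : ℕ) = v ∧ u ≠ v
  · obtain ⟨e, he, rfl, rfl, hne⟩ := h
    exact .inr ⟨e, he, rfl, rfl, hne, weight_eq he hne⟩
  · refine .inl (top_le_iff.1 (le_iInf₂ fun e he => absurd ⟨e, he⟩ h))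

/-- Take the first edge of the walk that leaves S. The base point v stays fixed while the start a
moves along the walk, so that the part already traversed is absorbed into the distance from v. -/
theorem IsWalk.exists_crossing {S : ℕ → Prop} {v t : Fin n} {p : List (Fin n × Fin n × ℝ≥0)} :
    ∀ {a : Fin n}, G.IsWalk t a p → S a → ¬ S t → ∃ y z : Fin n, S y ∧ ¬ S z ∧
      G.dist v y + G.weight y z ≤ G.dist v a + pathLength p := by
  induction p with
  | nil =>
    rintro a rfl ha ht
    exact absurd ha ht
  | cons e p ih =>
    rintro a ⟨he, rfl, hp⟩ ha ht
    have hlen : ((pathLength (e :: p) : ℝ≥0) : ℝ≥0∞) = e.2.2 + pathLength p := by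
      simp [pathLength]
    by_cases hz : S e.2.1
    · obtain ⟨y, z, hy, hz, hle⟩ := ih hp hz ht
      refine ⟨y, z, hy, hz, hle.trans ?_⟩
      rw [hlen, ← add_assoc]
      gcongr
      exact (G.dist_triangle v e.1 e.2.1).trans (by gcongr; exact dist_edge he)
    · refine ⟨e.1, e.2.1, ha, hz, ?_⟩
      rw [weight_eq he fun h => hz (h ▸ ha), hlen, ← add_assoc]
      exact le_self_add

theorem StronglyConnected.isDistance (h : G.StronglyConnected) :
    IsDistance n G.weight G.natDist := by
  refine ⟨fun v hv => ?_, fun u hu v hv => ?_, fun u hu v hv w hw => ?_, fun u hu v hv => ?_,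
    fun S v t X hv ht hSv hSt hX => ?_⟩
  · rw [natDist, dif_pos ⟨hv, hv⟩, dist_self]
  · rcases G.weight_eq_top_or u v with h | ⟨e, he, rfl, rfl, hne, h⟩
    · rw [h]
      exact le_top
    · rw [h, natDist_coe]
      exact dist_edge he
  · rw [natDist, natDist, natDist, dif_pos ⟨hu, hw⟩, dif_pos ⟨hu, hv⟩, dif_pos ⟨hv, hw⟩]
    exact G.dist_triangle _ _ _
  · rw [natDist, dif_pos ⟨hu, hv⟩]
    obtain ⟨p, hp⟩ := h ⟨u, hu⟩ ⟨v, hv⟩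
    exact ((dist_le_of_isWalk hp).trans_lt ENNReal.coe_lt_top).ne
  · rw [natDist, dif_pos ⟨hv, ht⟩]
    refine le_iInf₂ fun p hp => ?_
    obtain ⟨y, z, hy, hz, hle⟩ := IsWalk.exists_crossing (S := S) (v := ⟨v, hv⟩) hp hSv hSt
    have := hX y y.2 z z.2 hy hz
    rw [natDist, dif_pos ⟨hv, y.2⟩] at this
    refine (this.trans hle).trans ?_
    rw [dist_self, zero_add]

/-- An edge whose length equals the distance of its endpoints is, taken alone, a shortest path. -/
theorem card_star_le {g : RAM.Knowledge} (hn : g.n = n) (hW : g.W = G.weight)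
    (hδ : g.δ = G.natDist) (h : G.StronglyConnected) : g.star.card ≤ G.mStar := by
  rw [mStar, ← Set.ncard_coe_finset]
  have hfin : {e | e ∈ G.edges ∧ ∃ s t p, G.IsShortestPath s t p ∧ e ∈ p}.Finite := by
    classical
    exact G.edges.toFinset.finite_toSet.subset fun e he => by simpa using he.1
  refine (Set.ncard_le_ncard ?_ (hfin.image fun e => ((e.1 : ℕ), (e.2.1 : ℕ)))).trans
    (Set.ncard_image_le hfin)
  rintro ⟨u, v⟩ huv
  simp only [RAM.Knowledge.star, hn, hW, hδ, Finset.coe_filter, Finset.mem_product,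
    Finset.mem_range, Set.mem_ofPred_eq] at huv
  obtain ⟨⟨hu, hv⟩, hne, hw⟩ := huv
  rcases G.weight_eq_top_or u v with h' | ⟨e, he, rfl, rfl, -, h'⟩
  · exact absurd (hw.symm.trans h') (h.isDistance.ne_top u hu v hv)
  · refine ⟨e, ⟨he, e.1, e.2.1, [e], ⟨⟨he, rfl, rfl⟩, ?_, ?_⟩, by simp⟩, rfl⟩
    · simpa using fun h => hne (by rw [h])
    · rw [← natDist_coe, ← hw, h']
      simp [pathLength]

end WDigraph

/-! ### Each vertex has an outgoing edge that is a shortest path. -/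

namespace RAM

variable {ψ : SSSPAlgorithm} {M B n : ℕ} {G : WDigraph n}

open Knowledge

/-- The second entry in the list of v differs from v and is reached along known edges, so some known
edge leaves v; edges leaving different vertices are different. This absorbs all terms of order n²
into m* n. -/
theorem Knowledge.Valid.le_star {g : Knowledge} (hg : g.Valid) (hk : g.k = g.n) :
    g.n ≤ g.star.card := by
  have h : ∀ v < g.n, ∃ u, g.E v u := by
    intro v hv
    have h2 := hg.two_le
    have hw := hg.closest.walk v hv 1 (by omega)
    have hne : v ≠ g.L v 1 := by
      intro h
      have := hg.closest.inj v hv 0 hg.pos 1 (by omega) (by rw [← h, hg.closest.zero v hv])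
      omega
    generalize g.L v 1 = x at hw hne
    generalize g.δ v x = d at hw
    cases hw with
    | nil => exact absurd rfl hne
    | cons _ u _ _ h => exact ⟨u, h⟩
  choose! f hf using h
  conv_lhs => rw [← Finset.card_range g.n]
  refine Finset.card_le_card_of_injOn (fun v => (v, f v)) ?_ ?_
  · intro v hv
    have := hg.closest.edge _ _ (hf v (by simpa using hv))
    simp [Knowledge.star, this]
  · intro v _ w _ h
    exact congrArg Prod.fst h

end RAM

/-! ### The output, the initial state and the bounds in natural numbers. -/

namespace RAM

variable {ψ : SSSPAlgorithm} {M B n : ℕ} {G : WDigraph n}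

open Knowledge

theorem Knowledge.Valid.listed {g : Knowledge} (hg : g.Valid) (hk : g.k = g.n) {v x : ℕ}
    (hv : v < g.n) (hx : x < g.n) : Listed g.k g.L v x := by
  have hsub : (Finset.range g.k).image (g.L v) ⊆ Finset.range g.n := by
    intro y hy
    obtain ⟨i, hi, rfl⟩ := Finset.mem_image.1 hy
    simpa using hg.closest.lt v hv i (by simpa using hi)
  have := Finset.eq_of_subset_of_card_le hsub
    (by rw [hg.closest.card_image hv, Finset.card_range, hk])
  have hx' : x ∈ (Finset.range g.k).image (g.L v) := by
    rw [this]
    simpa using hx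
  obtain ⟨i, hi, h⟩ := Finset.mem_image.1 hx'
  exact ⟨i, by simpa using hi, h⟩

theorem Knowledge.Valid.holdsAPSP {g : Knowledge} {σ : State} (hg : g.Valid) (hs : g.Holds σ)
    (hn : g.n = n) (hk : g.k = n) (hW : g.W = G.weight) (hδ : g.δ = G.natDist)
    (hP : ∀ v < n, g.P v v = 0) : HoldsAPSP G σ := by
  have hlist : ∀ u v : Fin n, ∃ i < n, g.L u i = v := by
    intro u v
    have := hg.listed (hk.trans hn.symm) (v := u) (x := v) (by omega) (by omega)
    rwa [Listed, hk] at this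
  have hself : ∀ (u v : Fin n) i, i < n → g.L u i = v → v ≠ u → 0 < i := by
    intro u v i hi h hne
    rcases Nat.eq_zero_or_pos i with rfl | h0
    · rw [hg.closest.zero u (by omega)] at h
      exact absurd (Fin.ext h.symm) hne
    · exact h0
  have hpar : ∀ (u v : Fin n) i, i < n → g.L u i = v → v ≠ u →
      ∃ j < i, g.P u v = g.L u j ∧ g.P u v < n ∧
        g.δ u (g.P u v) + g.W (g.P u v) v ≤ g.δ u v := by
    intro u v i hi h hne
    obtain ⟨j, hj, h1, h2⟩ := hg.closest.parent u (by omega) i (by omega) (hself u v i hi h hne)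
    rw [h] at h1 h2
    have h3 := hg.closest.lt u (by omega) j (by omega)
    rw [← h1] at h2 h3
    exact ⟨j, hj, h1, by omega, h2⟩
  -- At the source itself the parent still has its initial value 0, which only has to be a vertex.
  have hPlt : ∀ u v : Fin n, g.P u v < n := by
    intro u v
    by_cases hne : v = u
    · rw [hne, hP u u.2]
      exact u.pos
    · obtain ⟨i, hi, h⟩ := hlist u v
      obtain ⟨_, _, _, h', _⟩ := hpar u v i hi h hne
      exact h'
  have hdist : ∀ u v : Fin n, σ.len 1 (u * n + v) = G.dist u v := by
    intro u v
    have h := hs.dist u (by omega) v (by omega)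
    rw [hn] at h
    obtain ⟨i, hi, hv⟩ := hlist u v
    rw [h, ← hv, hg.closest.dist u (by omega) i (by omega), hv, hδ, WDigraph.natDist_coe]
  refine ⟨fun u v => ⟨g.P u v, hPlt u v⟩, fun u v => ?_, fun u => ⟨hdist u, ?_, ?_⟩⟩
  · have h := hs.parent u (by omega) v (by omega)
    rwa [hn] at h
  · intro v hne _
    obtain ⟨i, hi, hv⟩ := hlist u v
    obtain ⟨_, _, _, _, hle⟩ := hpar u v i hi hv hne
    have hfin := hg.dist.ne_top u (by omega) v (by omega)
    rcases G.weight_eq_top_or (g.P u v) v with h | ⟨⟨x, y, w⟩, he, h1, h2, -, h3⟩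
    · rw [hW, h, add_top, top_le_iff] at hle
      exact absurd hle hfin
    · have hx : x = ⟨g.P u v, hPlt u v⟩ := Fin.ext h1
      have hy : y = v := Fin.ext h2
      rw [hx, hy] at he
      refine ⟨w, he, ?_⟩
      change σ.len 1 (u * n + v) = σ.len 1 (u * n + (⟨g.P u v, hPlt u v⟩ : Fin n)) + w
      rw [hdist, hdist]
      rw [hW, h3, hδ, WDigraph.natDist_coe] at hle
      refine le_antisymm ((G.dist_triangle u ⟨g.P u v, hPlt u v⟩ v).trans ?_) ?_
      · gcongr
        exact WDigraph.dist_edge he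
      · rw [← WDigraph.natDist_coe u ⟨g.P u v, hPlt u v⟩]
        exact hle
  -- Induction on the position in the list of u: a parent stands strictly earlier than its child, so
  -- tracing terminates even along edges of length zero.
  · have key : ∀ i < n, ∀ v : Fin n, g.L u i = v →
        ∃ j : ℕ, (fun v : Fin n => (⟨g.P u v, hPlt u v⟩ : Fin n))^[j] v = u := by
      intro i
      induction i using Nat.strong_induction_on with
      | _ i ih =>
        intro hi v hv
        by_cases hne : v = u
        · exact ⟨0, hne⟩
        · obtain ⟨j, hj, h1, h2, -⟩ := hpar u v i hi hv hne
          obtain ⟨a, ha⟩ := ih j hj (hj.trans hi) ⟨g.P u v, h2⟩ h1.symm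
          exact ⟨a + 1, ha⟩
    intro v _
    obtain ⟨i, hi, hv⟩ := hlist u v
    exact key i hi v hv

theorem initState_int_one {j : ℕ} (hj : j < G.size) :
    (initState G).int 1 j = (G.edges[j]'hj).1 := by
  have hj' : j < G.edges.length := hj
  simp [initState, hj']
  rfl

theorem initState_int_two {j : ℕ} (hj : j < G.size) :
    (initState G).int 2 j = (G.edges[j]'hj).2.1 := by
  have hj' : j < G.edges.length := hj
  simp [initState, hj']
  rfl

theorem initState_len_zero {j : ℕ} (hj : j < G.size) :
    (initState G).len 0 j = (G.edges[j]'hj).2.2 := by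
  have hj' : j < G.edges.length := hj
  simp [initState, hj']
  rfl

theorem initState_int_of_lt {a : ℕ} (i : ℕ) (ha : 2 < a) : (initState G).int a i = 0 := by
  obtain ⟨b, rfl⟩ : ∃ b, a = b + 3 := ⟨a - 3, by omega⟩
  rfl

theorem initState_bdd (hn : n < M) (hm : G.size < M) : Bdd M (initState G) := by
  have h : ∀ (l : List ℕ) (j : ℕ), (∀ x ∈ l, x < M) → l.getD j 0 < M := by
    intro l j hl
    rw [List.getD_eq_getElem?_getD]
    rcases Nat.lt_or_ge j l.length with hj | hj
    · simpa [hj] using hl _ (List.getElem_mem hj)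
    · simp only [List.getElem?_eq_none hj, Option.getD_none]
      omega
  intro a j
  rcases a with _ | _ | _ | a
  · exact h _ _ (by simp [hn, hm])
  · refine h _ _ fun x hx => ?_
    obtain ⟨e, -, rfl⟩ := List.mem_map.1 hx
    omega
  · refine h _ _ fun x hx => ?_
    obtain ⟨e, -, rfl⟩ := List.mem_map.1 hx
    omega
  · rw [initState_int_of_lt _ (by omega)]
    omega

theorem size_le (G : WDigraph n) : G.size ≤ n * n := by
  have := G.simple.length_le_card
  simpa [WDigraph.size] using this

theorem initState_inj {i j : ℕ} (hi : i < G.size) (hj : j < G.size)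
    (h1 : (initState G).int 1 i = (initState G).int 1 j)
    (h2 : (initState G).int 2 i = (initState G).int 2 j) : i = j := by
  rw [initState_int_one hi, initState_int_one hj] at h1
  rw [initState_int_two hi, initState_int_two hj] at h2
  have := (G.simple.getElem_inj_iff (i := i) (hi := by simpa [WDigraph.size] using hi) (j := j)
    (hj := by simpa [WDigraph.size] using hj)).1
  refine this ?_
  simp only [List.getElem_map, Prod.mk.injEq]
  exact ⟨Fin.ext h1, Fin.ext h2⟩

theorem initState_weight (v w : ℕ) : G.weight v w = ∞ ∨ ∃ j < G.size, (initState G).int 1 j = v ∧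
    (initState G).int 2 j = w ∧ v ≠ w ∧ G.weight v w = (initState G).len 0 j := by
  refine (G.weight_eq_top_or v w).imp_right ?_
  rintro ⟨e, he, h1, h2, hne, h⟩
  obtain ⟨j, hj, rfl⟩ := List.getElem_of_mem he
  refine ⟨j, hj, ?_, ?_, hne, ?_⟩
  · rw [initState_int_one hj, h1]
  · rw [initState_int_two hj, h2]
  · rw [initState_len_zero hj, h]

theorem initState_weight_eq {j : ℕ} (hj : j < G.size)
    (hne : (initState G).int 1 j ≠ (initState G).int 2 j) :
    G.weight ((initState G).int 1 j) ((initState G).int 2 j) = (initState G).len 0 j := by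
  rw [initState_int_one hj, initState_int_two hj] at hne ⊢
  rw [initState_len_zero hj]
  exact WDigraph.weight_eq (List.getElem_mem hj) hne

/-- With arrays of 4n² + 8 cells, every index and counter is a word: the trees need 2n² cells, and
there are at most n² edges. The 64 arrays then have 256n² + 512 cells, which is at most 400n² as n ≥
2. -/
theorem allPairs_solves {T S : ℕ → ℕ → ℕ} (hT : ψ.TimeBound T) (hS : ψ.SpaceBound S)
    (h2 : 2 ≤ n) (hG : G.StronglyConnected) : ∃ t s, SolvesAPSP ψ 32 allPairs G t s ∧
      t ≤ G.size * (10 * Nat.clog 2 n + 15) + 100 * (G.mStar * n) +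
        n * maxUpTo T (G.mStar + n) (n + 1) ∧
      s ≤ 400 * (n * n) + maxUpTo S (G.mStar + n) (n + 1) := by
  have hsize := size_le G
  have hnn : 2 * n ≤ n * n := Nat.mul_le_mul_right _ h2
  have h2n : n * (n + n) = 2 * (n * n) := by ring
  have hsup : ∀ (T : ℕ → ℕ → ℕ), ∀ q ≤ (initial n G.weight G.natDist (initState G)).star.card + n,
      T q (n + 1) ≤ maxUpTo T (G.mStar + n) (n + 1) := by
    intro T q hq
    have := WDigraph.card_star_le (g := initial n G.weight G.natDist (initState G)) rfl rfl rfl hG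
    exact Finset.le_sup (f := fun q => T q (n + 1))
      (Finset.mem_range.2 (Nat.lt_succ_of_le (hq.trans (Nat.add_le_add_right this n))))
  obtain ⟨σ', t, s, hex, hsB, g, hn, hk, hW, hδ, hP, hg, hs, ht⟩ :=
    allPairs_spec (ψ := ψ) (M := 4 * (n * n) + 8) (Λ := Nat.clog 2 n) (δ := G.natDist)
      (initState_bdd (G := G) (by omega) (by omega))
      (by omega) (m := G.size) (by omega) h2 (Nat.le_pow_clog one_lt_two n) rfl rfl
      (fun a i ha => initState_int_of_lt i ha) (fun i => rfl)
      (fun j hj => by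
        rw [initState_int_one hj, initState_int_two hj]
        exact ⟨Fin.is_lt _, Fin.is_lt _⟩)
      (fun i hi j hj => initState_inj hi hj) hG.isDistance (fun v _ w _ => initState_weight v w)
      (fun j hj => initState_weight_eq hj) hT hS (hsup T) (hsup S)
  refine ⟨t, 2 * 32 * (4 * (n * n) + 8) + s, ⟨_, σ', s, by omega, by omega, by omega, by omega, hex,
    rfl, hg.holdsAPSP hs hn hk hW hδ hP⟩, ?_, by omega⟩
  have h3 : g.star.card ≤ G.mStar := WDigraph.card_star_le hn hW hδ hG
  have h4 : n ≤ g.star.card := by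
    have := hg.le_star (hk.trans hn.symm)
    omega
  have h5 : n * g.star.card ≤ G.mStar * n := by
    rw [mul_comm]
    exact Nat.mul_le_mul_right _ h3
  -- Here n ≤ m* is used; lower-order terms are in turn bounded by multiples of n², using n ≥ 2.
  have h6 : n * n ≤ G.mStar * n := Nat.mul_le_mul_right _ (h4.trans h3)
  set TT := maxUpTo T (G.mStar + n) (n + 1)
  have h7 : n * (46 * n + 15 * g.star.card + TT + 21) =
      46 * (n * n) + 15 * (n * g.star.card) + n * TT + 21 * n := by ring
  have h8 : G.size * (5 * Nat.clog 2 n + 10) + (5 * Nat.clog 2 n + 5) * G.size =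
      G.size * (10 * Nat.clog 2 n + 15) := by ring
  omega

end RAM

/-! ### Passage to real logarithms and the final constants. -/

theorem clog_le_logb {n : ℕ} (h2 : 2 ≤ n) :
    (Nat.clog 2 n : ℝ) ≤ Real.logb 2 n + 1 ∧ 1 ≤ Real.logb 2 n := by
  have h1 : (1 : ℝ) ≤ Real.logb 2 n := by
    rw [Real.le_logb_iff_rpow_le one_lt_two (by positivity)]
    simpa using (by exact_mod_cast h2 : (2 : ℝ) ≤ n)
  refine ⟨?_, h1⟩
  have := Real.natCeil_logb_natCast 2 n
  rw [← this]
  exact (Nat.ceil_lt_add_one (zero_le_one.trans h1)).le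

/-- The maximum is attained because the range is nonempty, so no sign condition on x, and later on
K, is needed. -/
theorem maxUpTo_le {T : ℕ → ℕ → ℕ} {m n : ℕ} {x : ℝ} (h : ∀ m' ≤ m, (T m' n : ℝ) ≤ x) :
    (maxUpTo T m n : ℝ) ≤ x := by
  obtain ⟨i, hi, h'⟩ := Finset.exists_mem_eq_sup (Finset.range (m + 1)) ⟨0, by simp⟩
    fun m' => T m' n
  rw [maxUpTo, h']
  exact h i (by simpa [Nat.lt_succ_iff] using hi)

theorem theorem3 :
    -- one program `c` and one constant `C` for all algorithms `ψ` and all graphs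
    ∃ (k : ℕ) (c : RAM.Cmd) (C : ℝ),
      ∀ (ψ : SSSPAlgorithm) (T S : ℕ → ℕ → ℕ), ψ.TimeBound T → ψ.SpaceBound S →
      ∀ (n : ℕ) (G : WDigraph n), 2 ≤ n → G.StronglyConnected →
      ∃ t s : ℕ, RAM.SolvesAPSP ψ k c G t s ∧
        -- the bounds in terms of the sizes of the graphs on which `ψ` is run
        ((t : ℝ) ≤ C * (G.mStar * n + G.size * Real.logb 2 n
            + n * maxUpTo T (G.mStar + n) (n + 1)) ∧
          (s : ℝ) ≤ C * ((n : ℝ) ^ 2 + maxUpTo S (G.mStar + n) (n + 1))) ∧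
        -- the same in terms of `T (m*, n)` and `S (m*, n)`, if these bounds change at
        -- most by a factor `K` under this change of the sizes
        (∀ K : ℝ, (∀ m' ≤ G.mStar + n, (T m' (n + 1) : ℝ) ≤ K * T G.mStar n) →
          (t : ℝ) ≤ C * (G.mStar * n + G.size * Real.logb 2 n + K * (n * T G.mStar n))) ∧
        (∀ K : ℝ, (∀ m' ≤ G.mStar + n, (S m' (n + 1) : ℝ) ≤ K * S G.mStar n) →
          (s : ℝ) ≤ C * ((n : ℝ) ^ 2 + K * S G.mStar n)) := by

  -- The constant 400 is dictated by the space bound. In the time bound it leaves ample room: as 1 ≤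
  -- lg n, the additive terms next to the logarithm are absorbed.
  refine ⟨32, RAM.allPairs, 400, fun ψ T S hT hS n G h2 hG => ?_⟩
  obtain ⟨t, s, hsol, ht, hs⟩ := RAM.allPairs_solves hT hS h2 hG
  obtain ⟨hlog, hone⟩ := clog_le_logb h2
  have ht' : (t : ℝ) ≤ 400 * (G.mStar * n + G.size * Real.logb 2 n) +
      n * maxUpTo T (G.mStar + n) (n + 1) := by
    have h1 : (t : ℝ) ≤ G.size * (10 * Nat.clog 2 n + 15) + 100 * (G.mStar * n) +
        n * maxUpTo T (G.mStar + n) (n + 1) := by exact_mod_cast ht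
    have h3 : (G.size : ℝ) * (10 * Nat.clog 2 n + 15) ≤ G.size * (400 * Real.logb 2 n) := by
      gcongr
      linarith
    have h4 : (0 : ℝ) ≤ G.mStar * n := by positivity
    linarith
  have hs' : (s : ℝ) ≤ 400 * (n : ℝ) ^ 2 + maxUpTo S (G.mStar + n) (n + 1) := by
    rw [sq]
    exact_mod_cast hs
  refine ⟨t, s, hsol, ⟨?_, ?_⟩, fun K hK => ?_, fun K hK => ?_⟩
  · have : (0 : ℝ) ≤ n * maxUpTo T (G.mStar + n) (n + 1) := by positivity
    linarith
  · have : (0 : ℝ) ≤ maxUpTo S (G.mStar + n) (n + 1) := by positivity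
    linarith
  · have h1 := maxUpTo_le hK
    have h3 : (n : ℝ) * maxUpTo T (G.mStar + n) (n + 1) ≤ K * (n * T G.mStar n) := by
      calc (n : ℝ) * maxUpTo T (G.mStar + n) (n + 1) ≤ n * (K * T G.mStar n) := by gcongr
        _ = K * (n * T G.mStar n) := by ring
    have h4 : (0 : ℝ) ≤ n * maxUpTo T (G.mStar + n) (n + 1) := by positivity
    linarith
  · have h1 := maxUpTo_le hK
    have h4 : (0 : ℝ) ≤ maxUpTo S (G.mStar + n) (n + 1) := by positivity
    linarith
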